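/- **Setting.** Let $(\mathcal S,\mathcal A,p,r,\rho_0,\gamma,T)$ be a Markov decision process with measurable state and action spaces, transition density $p$ and initial density $\rho_0$ with respect to a $\sigma$-finite reference measure on $\mathcal S$, bounded measurable reward $r$, discount $\gamma\in[0,1]$ and finite horizon $T\ge 1$. Let $\Theta\subseteq\mathbb R^{d}$, $d\ge 1$, be open and convex (e.g. $\Theta=\mathbb R^{d}$), and for $\theta\in\Theta$ let $\pi_\theta(\cdot|s)>0$ be a probability density on $\mathcal A$ with respect to a $\sigma$-finite reference measure. Let $p_\theta(\tau)$ be the density of the trajectory $\tau=(s_1,a_1,\dots,s_T,a_T)$ under $\pi_\theta$, $R(\tau)=\sum_t\gamma^{t-1}r(s_t,a_t)$, $J(\theta)=\mathbb E_{\tau\sim p_\theta}[R(\tau)]$, $J^*=\sup_{\theta\in\Theta}J(\theta)$. Let $\mathbf g_\theta(\tau)$ be the REINFORCE estimator $\sum_t\nabla\log\pi_\theta(a_t|s_t)R(\tau)$ or the GPOMDP estimator $\sum_t\big(\sum_{l\le t}\nabla\log\pi_\theta(a_l|s_l)\big)\gamma^{t-1}r(s_t,a_t)$. **Assumptions.**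 (i) There are $L_1,L_2>0$ such that for all $\theta\in\Theta$, $s$, $a$, $\log\pi_\theta(a|s)$ is twice differentiable in $\theta$ with $\|\nabla\log\pi_\theta(a|s)\|_2\le L_1$ and $\|\nabla^2\log\pi_\theta(a|s)\|_2\le L_2$. (ii) There is $D\ge 1$ with $\chi^2(p_{\theta_1}\|p_{\theta_2})\le D-1$ for all $\theta_1,\theta_2\in\Theta$. **Algorithm (RPG).** Given $\theta_1\in\Theta$, a number of iterations $K$, a batch size $N$, a window $\omega\ge 1$ and a step size $\zeta>0$, at iteration $k=1,\dots,K$ collect trajectories $\tau_{k,1},\dots,\tau_{k,N}$ which, given the past, are i.i.d. from $p_{\theta_k}$, and set $\theta_{k+1}=\theta_k+\zeta\,\widehat\nabla_k$, where, with $\omega_k=\min\{\omega,k\}$, $$\widehat\nabla_k=\sum_{i=k-\omega_k+1}^{k}\frac1N\sum_{j=1}^N\frac{\alpha_k\,\mathbf g_{\theta_k}(\tau_{i,j})}{(1-\lambda_k)\frac{p_{\theta_i}(\tau_{i,j})}{p_{\theta_k}(\tau_{i,j})}+\lambda_k},\qquad \alpha_k=\frac1{\omega_k},\qquad \delta_k=\frac1{N^2\omega_k^2},$$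 $$\lambda_k=\sqrt{\frac{4d\log\Big(6+M\big(1+\sqrt{\tfrac34DN\omega_k}\big)\frac{3\sqrt3\,\zeta\omega_k^2N}{4\sqrt d}\Big)+4\log(1/\delta_k)}{3DN\omega_k}},\qquad M=GTL_1+G_2,$$ with $G,G_2$ as below. It is understood that the iterates $\theta_1,\dots,\theta_{K+1}$ lie in $\Theta$ almost surely. The output $\theta_{\rm OUT}$ is uniform on $\{\theta_1,\dots,\theta_K\}$, the index being independent of the learning process. **Theorem.** There are constants $G,G_2>0$ such that for all $\theta\in\Theta$ and all trajectories $\tau$, $\|\mathbf g_\theta(\tau)\|_2\le G$ and $\|\nabla\mathbf g_\theta(\tau)\|_2\le G_2$; and for all such $G,G_2$, $J$ is differentiable with $M$-Lipschitz gradient on $\Theta$. There is an absolute constant $C>0$ such that the following holds for all such $G,G_2$. Let $L_{2,J}>0$ be a Lipschitz constant of $\nabla J$ on $\Theta$, let $0<\zeta\le 1/L_{2,J}$, $\epsilon\in(0,G^2]$, $\theta_1\in\Theta$, and put $\Delta=J^*-J(\theta_1)$, $\Psi=6+M\zeta\sqrt{D/d}$, $\ell_0=\log(\Psi d)$, $\ell=\log\big(\Psi\,G^2Dd/\epsilon\big)$.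 1. (Partial reuse, $\omega<K$.) If $K\ge C\frac{\Delta}{\zeta\epsilon}$, $N\ge C\ell^2\,\frac{G^2Dd}{\epsilon\omega}$, and the coefficients are admissible ($\lambda_k\in[0,1]$ for $k\le K$), then $\mathbb E\|\nabla J(\theta_{\rm OUT})\|_2^2\le\epsilon$. 2. (Full reuse, $\omega\ge K\ge 1$, $N\ge 1$.) If $K\ge C\frac{\Delta}{\zeta\epsilon}$, $N\ge C\ell_0\,\frac dD$ and $NK\ge C\ell^2\,\frac{G^2Dd}{\epsilon}$, then $\mathbb E\|\nabla J(\theta_{\rm OUT})\|_2^2\le\epsilon$. 3. (Sample complexity, partial reuse.) For every $\omega\ge 1$ there are integers $N\ge1$ and $K>\omega$ for which $\mathbb E\|\nabla J(\theta_{\rm OUT})\|_2^2\le\epsilon$ and, with $\kappa=\max\{1,\frac{\epsilon\omega}{G^2D\min\{D,d\}}\}$ (which is $1$ when $\omega\le G^2D\min\{D,d\}/\epsilon$), $$N\le C\ell^2\,\frac{G^2Dd}{\epsilon\omega}\,\kappa,\qquad NK\le C\ell^2\,\frac{G^2Dd}{\epsilon}\max\Big\{1,\frac{\Delta}{\zeta\omega\epsilon}\Big\}\,\kappa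 .$$ 4. (Sample complexity, full reuse.) There are integers $N,K\ge1$ such that, for every $\omega\ge K$, $\mathbb E\|\nabla J(\theta_{\rm OUT})\|_2^2\le\epsilon$, and $$N\le C\ell_0\,\frac{d}{\min\{D,d\}},\qquad NK\le C\ell^2\,\frac{d}{\epsilon}\max\Big\{G^2D,\frac{\Delta}{\min\{D,d\}\,\zeta}\Big\}.$$ For $D\le d$ these are the bounds with $\min\{D,d\}=D$. -/

import Mathlib

open MeasureTheory ProbabilityTheory

universe u v w

noncomputable section

/-- A finite-horizon Markov decision process with measurable state space `S` and action space `A`.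
Initial-state and transition distributions are given by densities with respect to the σ-finite
reference measure `refS`; policies will have densities with respect to `refA`.
The horizon is `T = H + 1 ≥ 1`. -/
structure MDP (S : Type u) (A : Type v) [MeasurableSpace S] [MeasurableSpace A] where
  refS : Measure S
  refA : Measure A
  sigmaFinite_refS : SigmaFinite refS
  sigmaFinite_refA : SigmaFinite refA
  /-- the initial-state density -/
  init : S → ℝ
  init_nonneg : ∀ s, 0 ≤ init s
  init_measurable : Measurable init
  init_lintegral : ∫⁻ s, ENNReal.ofReal (init s) ∂refS = 1
  /-- the transition density: `trans s a s'` is the density of `s'` after action `a` in `s` -/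
  trans : S → A → S → ℝ
  trans_nonneg : ∀ s a s', 0 ≤ trans s a s'
  trans_measurable : Measurable (fun x : S × A × S => trans x.1 x.2.1 x.2.2)
  trans_lintegral : ∀ s a, ∫⁻ s', ENNReal.ofReal (trans s a s') ∂refS = 1
  reward : S → A → ℝ
  reward_measurable : Measurable (fun x : S × A => reward x.1 x.2)
  Rmax : ℝ
  reward_bound : ∀ s a, |reward s a| ≤ Rmax
  γ : ℝ
  γ_nonneg : 0 ≤ γ
  γ_le_one : γ ≤ 1
  H : ℕ

attribute [instance] MDP.sigmaFinite_refS MDP.sigmaFinite_refA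

/-- The parameter space `ℝ^d` with its Euclidean norm. -/
abbrev Param (d : ℕ) : Type := EuclideanSpace ℝ (Fin d)

/-- `π θ s a` is, for every `θ ∈ Θ`, a (positive) probability density in the action `a`
for every state `s`. Positivity is what makes `log π` meaningful at every pair `(s, a)`. -/
structure IsPolicyClass {S : Type u} {A : Type v} [MeasurableSpace S] [MeasurableSpace A]
    (M : MDP S A) {d : ℕ} (Θ : Set (Param d)) (π : Param d → S → A → ℝ) : Prop where
  pos : ∀ θ ∈ Θ, ∀ s a, 0 < π θ s a
  measurable : ∀ θ ∈ Θ, Measurable (fun x : S × A => π θ x.1 x.2)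
  lintegral_eq_one : ∀ θ ∈ Θ, ∀ s, ∫⁻ a, ENNReal.ofReal (π θ s a) ∂M.refA = 1

/-- The χ²-divergence `(∫ p² q⁻¹ dμ) - 1` of two probability densities `p`, `q` with respect to
`μ` (for densities with `p = 0` wherever `q = 0`). It takes the value `∞` if the integral
diverges. -/
def chiSq {X : Type*} [MeasurableSpace X] (μ : Measure X) (p q : X → ℝ) : ENNReal :=
  (∫⁻ x, ENNReal.ofReal (p x ^ 2 * (q x)⁻¹) ∂μ) - 1

/-- `f` is `L`-Lipschitz smooth on (the open set) `Θ`: it is differentiable there and its gradient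
is `L`-Lipschitz. -/
def LipschitzSmoothOn {d : ℕ} (f : Param d → ℝ) (L : ℝ) (Θ : Set (Param d)) : Prop :=
  (∀ θ ∈ Θ, DifferentiableAt ℝ f θ) ∧
    ∀ θ₁ ∈ Θ, ∀ θ₂ ∈ Θ, ‖gradient f θ₁ - gradient f θ₂‖ ≤ L * ‖θ₁ - θ₂‖

/-- The two classical single-trajectory on-policy gradient estimators. -/
inductive GradEstimator where
  | reinforce
  | gpomdp

namespace MDP

variable {S : Type u} {A : Type v} [MeasurableSpace S] [MeasurableSpace A]

/-- Trajectories `(s₁, a₁, …, s_T, a_T)`, indexed from `0`. -/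
abbrev Traj (M : MDP S A) : Type (max u v) := Fin (M.H + 1) → S × A

/-- The horizon `T`, as a real number. -/
def T (M : MDP S A) : ℝ := (M.H : ℝ) + 1

/-- The reference measure on trajectories. -/
def refTraj (M : MDP S A) : Measure M.Traj := Measure.pi (fun _ => M.refS.prod M.refA)

/-- The discounted return `R(τ)`. -/
def ret (M : MDP S A) (τ : M.Traj) : ℝ :=
  ∑ t : Fin (M.H + 1), M.γ ^ (t : ℕ) * M.reward (τ t).1 (τ t).2

variable {d : ℕ}

/-- The trajectory density `p_θ(τ)` induced by the policy `π_θ`. -/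
def trajDensity (M : MDP S A) (π : Param d → S → A → ℝ) (θ : Param d) (τ : M.Traj) : ℝ :=
  M.init (τ 0).1 * (∏ t : Fin (M.H + 1), π θ (τ t).1 (τ t).2) *
    ∏ t : Fin M.H, M.trans (τ t.castSucc).1 (τ t.castSucc).2 (τ t.succ).1

/-- The law of a trajectory generated by `π_θ`. -/
def trajLaw (M : MDP S A) (π : Param d → S → A → ℝ) (θ : Param d) : Measure M.Traj :=
  M.refTraj.withDensity (fun τ => ENNReal.ofReal (M.trajDensity π θ τ))

/-- The expected return `J(θ)`. -/
def J (M : MDP S A) (π : Param d → S → A → ℝ) (θ : Param d) : ℝ :=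
  ∫ τ, M.ret τ ∂(M.trajLaw π θ)

/-- `J* = sup_{θ ∈ Θ} J(θ)`. -/
def Jstar (M : MDP S A) (π : Param d → S → A → ℝ) (Θ : Set (Param d)) : ℝ :=
  sSup (M.J π '' Θ)

end MDP

section Defs

variable {S : Type u} {A : Type v} [MeasurableSpace S] [MeasurableSpace A] {d : ℕ}

/-- The score `∇_θ log π_θ(a | s)`. -/
def score (π : Param d → S → A → ℝ) (s : S) (a : A) (θ : Param d) : Param d :=
  gradient (fun θ' => Real.log (π θ' s a)) θ

/-- Regularity of `log π_θ`: it is twice differentiable in `θ`, with gradient and Hessian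
bounded by `L₁` and `L₂` in (operator) norm, uniformly in `θ ∈ Θ`, `s` and `a`. -/
structure RegularPolicy (Θ : Set (Param d)) (π : Param d → S → A → ℝ) (L₁ L₂ : ℝ) : Prop where
  differentiableAt : ∀ θ ∈ Θ, ∀ s a, DifferentiableAt ℝ (fun θ' => Real.log (π θ' s a)) θ
  differentiableAt_score : ∀ θ ∈ Θ, ∀ s a, DifferentiableAt ℝ (score π s a) θ
  norm_score_le : ∀ θ ∈ Θ, ∀ s a, ‖score π s a θ‖ ≤ L₁
  norm_hessian_le : ∀ θ ∈ Θ, ∀ s a, ‖fderiv ℝ (score π s a) θ‖ ≤ L₂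

/-- The χ²-divergences between the trajectory distributions are at most `D - 1`. -/
def BoundedChiSq (M : MDP S A) (Θ : Set (Param d)) (π : Param d → S → A → ℝ) (D : ℝ) : Prop :=
  ∀ θ₁ ∈ Θ, ∀ θ₂ ∈ Θ,
    chiSq M.refTraj (M.trajDensity π θ₁) (M.trajDensity π θ₂) ≤ ENNReal.ofReal (D - 1)

/-- The single-trajectory gradient estimator `g_θ(τ)`, in its REINFORCE form
`∑_t ∇ log π_θ(a_t | s_t) R(τ)` or in its GPOMDP form
`∑_t (∑_{l ≤ t} ∇ log π_θ(a_l | s_l)) γ^{t-1} r(s_t, a_t)`. -/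
def singleGrad (M : MDP S A) (π : Param d → S → A → ℝ) (est : GradEstimator) (τ : M.Traj)
    (θ : Param d) : Param d :=
  match est with
  | .reinforce => ∑ t : Fin (M.H + 1), M.ret τ • score π (τ t).1 (τ t).2 θ
  | .gpomdp => ∑ t : Fin (M.H + 1), (M.γ ^ (t : ℕ) * M.reward (τ t).1 (τ t).2) •
      ∑ l ∈ (Finset.Iic t : Finset (Fin (M.H + 1))), score π (τ l).1 (τ l).2 θ

/-- `G` and `G₂` bound the single-trajectory gradient estimator and its Jacobian, uniformly over
parameters and trajectories. -/
def EstimatorBounds (M : MDP S A) (Θ : Set (Param d)) (π : Param d → S → A → ℝ)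
    (est : GradEstimator) (G G₂ : ℝ) : Prop :=
  ∀ θ ∈ Θ, ∀ τ : M.Traj,
    ‖singleGrad M π est τ θ‖ ≤ G ∧ ‖fderiv ℝ (singleGrad M π est τ) θ‖ ≤ G₂

/-- The effective window size `ω_k = min {ω, k}`. -/
def win (ω k : ℕ) : ℕ := min ω k

/-- The multiple power mean estimator at the target `θ`, at iteration `k ≥ 1`, built from the
parameters `θs i` and the batches `τs i` of the iterations `i = k - ω_k + 1, …, k`, with
coefficients `α i` and `lam i`. -/
def mpm (M : MDP S A) (π : Param d → S → A → ℝ) (est : GradEstimator) {N : ℕ} (ω k : ℕ)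
    (α lam : ℕ → ℝ) (θs : ℕ → Param d) (τs : ℕ → Fin N → M.Traj) (θ : Param d) : Param d :=
  ∑ i ∈ Finset.Icc (k - win ω k + 1) k, (1 / (N : ℝ)) • ∑ j : Fin N,
    (α i / ((1 - lam i) * (M.trajDensity π (θs i) (τs i j) / M.trajDensity π θ (τs i j)) + lam i))
      • singleGrad M π est (τs i j) θ

/-- The coefficient `α_{i,k} = 1 / ω_k`. -/
def alphaCoef (ω k : ℕ) : ℝ := 1 / (win ω k : ℝ)

/-- The confidence level `δ_k = 1 / (N² ω_k²)`. -/
def deltaCoef (N ω k : ℕ) : ℝ := 1 / ((N : ℝ) ^ 2 * (win ω k : ℝ) ^ 2)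

/-- The coefficient `λ_{i,k}` (independent of `i`), for the constant step size `ζ` and confidence
level `δ_k`; `B` stands for `G T L₁ + G₂`. -/
def lamCoef (d : ℕ) (D B ζ : ℝ) (N ω k : ℕ) : ℝ :=
  Real.sqrt ((4 * d * Real.log (6 + B * (1 + Real.sqrt (3 / 4 * D * N * win ω k)) *
      (3 * Real.sqrt 3 * ζ * (win ω k : ℝ) ^ 2 * N / (4 * Real.sqrt d)))
    + 4 * Real.log (1 / deltaCoef N ω k)) / (3 * D * N * win ω k))

/-- The σ-algebra generated by `θ_1, τ_1, …, θ_{k-1}, τ_{k-1}, θ_k`, where `τ_i` is the whole batch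
collected at iteration `i`. -/
@[reducible] def history {Ω : Type w} {X Y : Type*} [MeasurableSpace X] [MeasurableSpace Y]
    (θ : ℕ → Ω → X) (τ : ℕ → Ω → Y) (k : ℕ) : MeasurableSpace Ω :=
  (⨆ i ∈ Finset.Icc 1 k, MeasurableSpace.comap (θ i) inferInstance) ⊔
    ⨆ i ∈ Finset.Ico 1 k, MeasurableSpace.comap (τ i) inferInstance

/-- The random variables `θ_k` (iterates), `τ_k` (batches of `N` trajectories) and `I` (output
index) on the probability space `(Ω, P)` form a run of RPG with `K` iterations, window `ω`,
constant step size `ζ`, initial parameter `θ₁` and the coefficients `alphaCoef`, `lamCoef`. -/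
structure IsRPGRun (M : MDP S A) (Θ : Set (Param d)) (π : Param d → S → A → ℝ)
    (est : GradEstimator) (D B ζ : ℝ) (θ₁ : Param d) (N K ω : ℕ)
    {Ω : Type w} [MeasurableSpace Ω] (P : Measure Ω)
    (θ : ℕ → Ω → Param d) (τ : ℕ → Ω → Fin N → M.Traj) (I : Ω → ℕ) : Prop where
  measurable_θ : ∀ k, Measurable (θ k)
  measurable_τ : ∀ k, Measurable (τ k)
  measurable_I : Measurable I
  init : ∀ᵐ x ∂P, θ 1 x = θ₁
  /-- the iterates are parameters, i.e. elements of `Θ` (automatic if `Θ = ℝ^d`) -/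
  mem : ∀ᵐ x ∂P, ∀ k ∈ Finset.Icc 1 (K + 1), θ k x ∈ Θ
  /-- given the history, the `N` trajectories of iteration `k` are i.i.d. with law `p_{θ_k}` -/
  sample : ∀ k ∈ Finset.Icc 1 K, ∀ F : Set Ω, MeasurableSet[history θ τ k] F →
    ∀ B : Set (Fin N → M.Traj), MeasurableSet B →
      P (F ∩ τ k ⁻¹' B) = ∫⁻ x in F, (Measure.pi fun _ : Fin N => M.trajLaw π (θ k x)) B ∂P
  /-- gradient ascent with the multiple power mean estimator at `θ_k` -/
  update : ∀ k ∈ Finset.Icc 1 K, ∀ᵐ x ∂P, θ (k + 1) x = θ k x +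
    ζ • mpm M π est ω k (fun _ => alphaCoef ω k) (fun _ => lamCoef d D B ζ N ω k)
      (fun i => θ i x) (fun i => τ i x) (θ k x)
  /-- the output index is uniform on `{1, …, K}` and independent of the learning process -/
  uniform : ∀ k ∈ Finset.Icc 1 K, P (I ⁻¹' {k}) = (K : ENNReal)⁻¹
  indep : Indep (MeasurableSpace.comap I inferInstance) (history θ τ (K + 1)) P

/-- Every run of RPG (on any probability space) outputs `θ_OUT = θ_I` with
`E ‖∇J(θ_OUT)‖² ≤ ε`. -/
def RPGAchieves (M : MDP S A) (Θ : Set (Param d)) (π : Param d → S → A → ℝ)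
    (est : GradEstimator) (D B ζ : ℝ) (θ₁ : Param d) (N K ω : ℕ) (ε : ℝ) : Prop :=
  ∀ (Ω : Type w) [MeasurableSpace Ω] (P : Measure Ω) [IsProbabilityMeasure P]
    (θ : ℕ → Ω → Param d) (τ : ℕ → Ω → Fin N → M.Traj) (I : Ω → ℕ),
    IsRPGRun M Θ π est D B ζ θ₁ N K ω P θ τ I →
      Integrable (fun x => ‖gradient (M.J π) (θ (I x) x)‖ ^ 2) P ∧
        ∫ x, ‖gradient (M.J π) (θ (I x) x)‖ ^ 2 ∂P ≤ ε

/-- The `ε`-free logarithmic factor `log (d (6 + B ζ √(D / d)))`, with `B = G T L₁ + G₂`. -/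
def logFactor (d : ℕ) (D B ζ : ℝ) : ℝ :=
  Real.log (d * (6 + B * ζ * Real.sqrt (D / d)))

/-- The logarithmic factor `log ((G² D d / ε) (6 + B ζ √(D / d)))`, with `B = G T L₁ + G₂`. -/
def logFactorEps (d : ℕ) (G D B ζ ε : ℝ) : ℝ :=
  Real.log (G ^ 2 * D * d / ε * (6 + B * ζ * Real.sqrt (D / d)))

end Defs

end

/-! Smoothness of `J` turns each iteration into an inexact ascent step: `‖∇J(θ_k)‖²` is at most
`2/ζ` times the gain in `J` plus the squared error of the estimator
(`LipschitzSmoothOn.ascent_step`). The gains telescope to at most `Δ = J* - J(θ₁)`, so averaging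
over `k` leaves `2Δ/(ζK)` plus the mean of the squared errors. Both are made at most `ε/2`. The
heart of the matter is the error of the estimator.

For a fixed target `ϑ` the power-mean weight behaves well. It never exceeds `1/λ`, it differs from
the true importance weight by `O(λ)` with second-moment control, and the χ² bound controls that
moment. Hence every trajectory has an exponential moment `exp(⟨v,∇J(ϑ)⟩ λ/G + 4Dλ²)` at most,
whichever iterate generated it (`lintegral_exp_pmGrad_le`). Conditioning batch by batch multiplies
these bounds over a window (`IsRPGRun.lintegral_mul_prod_le`), although the batches are dependent.

The actual target `θ_k` is a function of the reused data, so it cannot be treated as fixed. It is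
replaced by a point of a countable net of `Θ`, with a second net for the direction `v` in the unit
ball. Since `Θ` may be unbounded, only net points near the iterate at the start of the window are
counted. Nearness is known before the window is sampled, so it does not disturb the conditional
bounds, and bounded steps prevent `θ_k` from drifting far away (`IsRPGRun.norm_sub_le`). The
expected sum of the exponential weights over both nets is therefore at most a product of covering
numbers (`IsRPGRun.lintegral_netSum_le`). If the error exceeds `15GDλ`, some net term is at least
`exp(3Dnλ²)`, where `n = Nω_k` (`norm_mpm_error_le_or_exists`, `one_le_netSum`). The value of `λ` is
such that `exp(-3Dnλ²)` beats the covering numbers and leaves `n⁻²`. The result is a mean squared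
error of order `(GDλ)²` (`IsRPGRun.exists_error_bound`).

Finally `Dnλ²` is at most `7d log(Ψn)`, so averaging over iterations costs only a harmonic sum, that
is, one more logarithm (`mean_error_le`). `lamCoef_le_one` gives admissibility when `N` is of order
`ℓ₀d/D`. The sample complexities follow by rounding suitable real values of `N` and `K` up to
integers. -/

noncomputable section

/-! ### Separated nets in finite-dimensional spaces -/

section Covering

open Metric Module

variable {E : Type*} [NormedAddCommGroup E] [NormedSpace ℝ E] [FiniteDimensional ℝ E]

/-- Volume comparison: the balls of radius `η/2` around the points are disjoint and fit into the
ball of radius `R + η/2` around `x`. -/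
theorem card_le_of_separated_of_dist_le (s : Finset E) (x : E) {R η : ℝ} (hη : 0 < η) (hR : 0 ≤ R)
    (hs : ∀ c ∈ s, dist x c ≤ R) (h : ∀ c ∈ s, ∀ c' ∈ s, c ≠ c' → η ≤ dist c c') :
    (s.card : ℝ) ≤ (1 + 2 * R / η) ^ finrank ℝ E := by
  borelize E
  let μ : Measure E := Measure.addHaar
  have hδ : 0 < η / 2 := half_pos hη
  have hρ : 0 < R + η / 2 := by positivity
  have hdisj : Set.Pairwise (s : Set E) (Function.onFun Disjoint fun c => ball (c : E) (η / 2)) := by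
    rintro c hc c' hc' hcc
    apply ball_disjoint_ball
    linarith [h c hc c' hc' hcc]
  have hsub : (⋃ c ∈ s, ball (c : E) (η / 2)) ⊆ ball x (R + η / 2) := by
    refine Set.iUnion₂_subset fun c hc => ball_subset_ball' ?_
    rw [dist_comm]
    linarith [hs c hc]
  have key : (s.card : ENNReal) * ENNReal.ofReal ((η / 2) ^ finrank ℝ E) * μ (ball 0 1) ≤
      ENNReal.ofReal ((R + η / 2) ^ finrank ℝ E) * μ (ball 0 1) := by
    calc
      (s.card : ENNReal) * ENNReal.ofReal ((η / 2) ^ finrank ℝ E) * μ (ball 0 1)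
          = μ (⋃ c ∈ s, ball (c : E) (η / 2)) := by
        rw [measure_biUnion_finset hdisj fun c _ => measurableSet_ball]
        simp only [μ.addHaar_ball_of_pos _ hδ, Finset.sum_const, nsmul_eq_mul, mul_assoc]
      _ ≤ μ (ball x (R + η / 2)) := measure_mono hsub
      _ = _ := by simp only [μ.addHaar_ball_of_pos _ hρ]
  have key2 : (s.card : ENNReal) * ENNReal.ofReal ((η / 2) ^ finrank ℝ E) ≤
      ENNReal.ofReal ((R + η / 2) ^ finrank ℝ E) :=
    (ENNReal.mul_le_mul_iff_left (measure_ball_pos _ _ zero_lt_one).ne' measure_ball_lt_top.ne).1 key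
  have key3 : (s.card : ℝ) * (η / 2) ^ finrank ℝ E ≤ (R + η / 2) ^ finrank ℝ E := by
    have := ENNReal.toReal_le_of_le_ofReal (pow_nonneg hρ.le _) key2
    simpa [ENNReal.toReal_mul, ENNReal.toReal_ofReal (pow_nonneg hδ.le _)] using this
  have hpos : 0 < (η / 2) ^ finrank ℝ E := pow_pos hδ _
  rw [← le_div_iff₀ hpos, ← div_pow] at key3
  rwa [show (R + η / 2) / (η / 2) = 1 + 2 * R / η by field_simp; ring] at key3

/-- A maximal `η`-separated subset of `A`, with the volumetric bound on its local cardinality. -/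
theorem exists_separated_net (A : Set E) {η : ℝ} (hη : 0 < η) :
    ∃ Q : Set E, Q ⊆ A ∧ Q.Countable ∧ (∀ a ∈ A, ∃ q ∈ Q, dist a q ≤ η) ∧
      ∀ (x : E) (R : ℝ), 0 ≤ R →
        ∑' q : Q, Set.indicator {q : E | dist x q ≤ R} (fun _ => (1 : ENNReal)) q ≤
          ENNReal.ofReal ((1 + 2 * R / η) ^ finrank ℝ E) := by
  classical
  obtain ⟨Q, hQ⟩ : ∃ Q, Maximal (fun Q : Set E => Q ⊆ A ∧ Q.Pairwise fun x y => η ≤ dist x y) Q := by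
    refine zorn_subset _ fun c hc hchain => ⟨⋃₀ c, ⟨?_, ?_⟩, fun s hs => Set.subset_sUnion_of_mem hs⟩
    · exact Set.sUnion_subset fun s hs => (hc hs).1
    · exact (Set.pairwise_sUnion hchain.directedOn).2 fun s hs => (hc hs).2
  obtain ⟨hQA, hQs⟩ := hQ.prop
  refine ⟨Q, hQA, ?_, ?_, ?_⟩
  -- Countability comes from separability of `E`: disjoint nonempty open balls can only be countably
  -- many. It allows sums over the net to be exchanged with integrals later.
  · have hdj : Q.PairwiseDisjoint fun q => ball q (η / 2) := by
      intro x hx y hy hxy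
      apply ball_disjoint_ball
      linarith [hQs hx hy hxy]
    have := FiniteDimensional.proper_rclike ℝ E
    exact hdj.countable_of_isOpen (fun _ _ => isOpen_ball)
      (fun q _ => ⟨q, mem_ball_self (half_pos hη)⟩)
  · intro a ha
    by_contra! hcon
    have haQ : a ∈ Q := by
      refine hQ.mem_of_prop_insert ⟨Set.insert_subset ha hQA, ?_⟩
      rw [Set.pairwise_insert]
      exact ⟨hQs, fun b hb _ => ⟨(hcon b hb).le, by rw [dist_comm]; exact (hcon b hb).le⟩⟩
    have := hcon a haQ
    rw [dist_self] at this
    linarith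
  · intro x R hR
    rw [ENNReal.tsum_eq_iSup_sum]
    refine iSup_le fun s => ?_
    set t : Finset E := (s.map (Function.Embedding.subtype _)).filter fun q => dist x q ≤ R with ht
    have htQ : ∀ c ∈ t, c ∈ Q ∧ dist x c ≤ R := by
      intro c hc
      simp only [ht, Finset.mem_filter, Finset.mem_map, Function.Embedding.subtype_apply] at hc
      obtain ⟨⟨q, -, rfl⟩, h⟩ := hc
      exact ⟨q.2, h⟩
    have hcard := card_le_of_separated_of_dist_le t x hη hR (fun c hc => (htQ c hc).2)
      fun c hc c' hc' hne => hQs (htQ c hc).1 (htQ c' hc').1 hne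
    have hsum : ∑ q ∈ s, Set.indicator {q : E | dist x q ≤ R} (fun _ => (1 : ENNReal)) (q : E) =
        (t.card : ENNReal) := by
      rw [Finset.card_filter, Finset.sum_map]
      push_cast
      refine Finset.sum_congr rfl fun q _ => ?_
      by_cases h : dist x (q : E) ≤ R <;> simp [h]
    rw [hsum, ← ENNReal.ofReal_natCast]
    exact ENNReal.ofReal_le_ofReal hcard

end Covering

/-! ### Scalar inequalities for exponentials and power-mean weights -/

section Scalar

/-- The logarithmic mean is at most the arithmetic mean. In this symmetric form the right-hand side
integrates to a constant when the exponentials are two probability densities. -/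
theorem abs_exp_sub_exp_le_mul_add (x y : ℝ) :
    |Real.exp x - Real.exp y| ≤ |x - y| * ((Real.exp x + Real.exp y) / 2) := by
  have key : ∀ t : ℝ, 0 ≤ t → Real.exp t - 1 ≤ t * ((Real.exp t + 1) / 2) := by
    intro t ht
    have hd : ∀ t : ℝ, HasDerivAt (fun t => t * ((Real.exp t + 1) / 2) - Real.exp t)
        (1 * ((Real.exp t + 1) / 2) + t * (Real.exp t / 2) - Real.exp t) t := fun t =>
      ((hasDerivAt_id t).mul (((Real.hasDerivAt_exp t).add_const 1).div_const 2)).sub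
        (Real.hasDerivAt_exp t)
    have hmono : MonotoneOn (fun t => t * ((Real.exp t + 1) / 2) - Real.exp t) (Set.Ici 0) := by
      refine monotoneOn_of_deriv_nonneg (convex_Ici 0)
        (fun t _ => (hd t).continuousAt.continuousWithinAt)
        (fun t _ => (hd t).differentiableAt.differentiableWithinAt) fun t _ => ?_
      rw [(hd t).deriv]
      -- The derivative equals `(1 + (t - 1)eᵗ)/2`, and it is nonnegative because `e⁻ᵗ ≥ 1 - t`.
      have h1 := Real.add_one_le_exp (-t)
      have h2 : Real.exp (-t) * Real.exp t = 1 := by rw [← Real.exp_add]; simp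
      nlinarith [Real.exp_pos t]
    have := hmono (Set.mem_Ici.2 le_rfl) (Set.mem_Ici.2 ht) ht
    simp only [zero_mul, Real.exp_zero] at this
    linarith
  have key2 : ∀ x y : ℝ, y ≤ x →
      |Real.exp x - Real.exp y| ≤ |x - y| * ((Real.exp x + Real.exp y) / 2) := by
    intro x y hxy
    rw [abs_of_nonneg (sub_nonneg.2 (Real.exp_le_exp.2 hxy)), abs_of_nonneg (sub_nonneg.2 hxy)]
    have h := mul_le_mul_of_nonneg_right (key (x - y) (sub_nonneg.2 hxy)) (Real.exp_pos y).le
    have he : Real.exp (x - y) * Real.exp y = Real.exp x := by rw [← Real.exp_add]; simp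
    nlinarith
  rcases le_total y x with h | h
  · exact key2 x y h
  · rw [abs_sub_comm, abs_sub_comm x, add_comm]
    exact key2 y x h

variable {l : ℝ}

theorem powerMean_le_inv (hl : 0 < l) (hl1 : l ≤ 1) {x : ℝ} (hx : 0 ≤ x) :
    0 ≤ 1 / ((1 - l) * x + l) ∧ 1 / ((1 - l) * x + l) ≤ 1 / l := by
  have : 0 ≤ (1 - l) * x := mul_nonneg (sub_nonneg.2 hl1) hx
  exact ⟨by positivity, one_div_le_one_div_of_le hl (by linarith)⟩

/-- The bias of the weight: the difference is `-l w(w - 1)/(1 - l + lw)`, and the denominator is a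
weighted mean of `1` and `w`, hence at least the smaller of the two. -/
theorem abs_powerMean_sub_le (hl : 0 < l) (hl1 : l ≤ 1) {w : ℝ} (hw : 0 < w) :
    |1 / ((1 - l) * w⁻¹ + l) - w| ≤ l * (1 + w ^ 2) := by
  have hden : 0 < 1 - l + l * w := by nlinarith
  have e : 1 / ((1 - l) * w⁻¹ + l) - w = - (l * (w * (w - 1)) / (1 - l + l * w)) := by
    have : (1 - l) * w⁻¹ + l = (1 - l + l * w) / w := by field_simp
    rw [this]
    field_simp
    ring
  rw [e, abs_neg, abs_div, abs_of_pos hden, div_le_iff₀ hden, abs_mul, abs_of_pos hl, mul_assoc]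
  refine mul_le_mul_of_nonneg_left ?_ hl.le
  rw [abs_mul, abs_of_pos hw]
  rcases le_total 1 w with h | h
  · rw [abs_of_nonneg (by linarith)]
    have : 1 ≤ 1 - l + l * w := by nlinarith
    nlinarith
  · rw [abs_of_nonpos (by linarith)]
    have : w ≤ 1 - l + l * w := by nlinarith
    nlinarith

/-- The weight is a weighted harmonic mean of `w` and `1`, so it is at most the larger of them. -/
theorem powerMean_sq_le (hl : 0 < l) (hl1 : l ≤ 1) {w : ℝ} (hw : 0 < w) :
    (1 / ((1 - l) * w⁻¹ + l)) ^ 2 ≤ 1 + w ^ 2 := by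
  have hden : 0 < 1 - l + l * w := by nlinarith
  have : (1 - l) * w⁻¹ + l = (1 - l + l * w) / w := by field_simp
  rw [this, one_div_div, div_pow, div_le_iff₀ (by positivity)]
  rcases le_total 1 w with h | h
  · have : 1 ≤ (1 - l + l * w) ^ 2 := by
      have : 1 ≤ 1 - l + l * w := by nlinarith
      nlinarith
    nlinarith [sq_nonneg w]
  · have : w ^ 2 ≤ (1 - l + l * w) ^ 2 := by
      have : w ≤ 1 - l + l * w := by nlinarith
      exact pow_le_pow_left₀ hw.le this 2
    nlinarith [sq_nonneg w]

/-- As a function of the log-ratio, the weight has derivative bounded by the weight itself, which is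
at most `1/l`. Log-ratios are the right variable because bounded scores make them Lipschitz in the
parameter. -/
theorem abs_powerMean_exp_sub_le (hl : 0 < l) (hl1 : l ≤ 1) (x y : ℝ) :
    |1 / ((1 - l) * Real.exp x + l) - 1 / ((1 - l) * Real.exp y + l)| ≤ 1 / l * |x - y| := by
  have key : ∀ x y : ℝ, y ≤ x →
      |1 / ((1 - l) * Real.exp x + l) - 1 / ((1 - l) * Real.exp y + l)| ≤ 1 / l * |x - y| := by
    intro x y h
    have h1l : 0 ≤ 1 - l := sub_nonneg.2 hl1
    have hx : 0 < (1 - l) * Real.exp x + l := by positivity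
    have hy : 0 < (1 - l) * Real.exp y + l := by positivity
    have e1 : Real.exp y = Real.exp x * Real.exp (y - x) := by rw [← Real.exp_add]; simp
    have e2 := Real.add_one_le_exp (y - x)
    have hxy : Real.exp y ≤ Real.exp x := Real.exp_le_exp.2 h
    rw [abs_sub_comm, abs_of_nonneg (sub_nonneg.2 (one_div_le_one_div_of_le hy (by nlinarith))),
      abs_of_nonneg (sub_nonneg.2 h), div_sub_div _ _ hy.ne' hx.ne', div_le_iff₀ (mul_pos hy hx)]
    have h3 : 1 * ((1 - l) * Real.exp x + l) - ((1 - l) * Real.exp y + l) * 1 ≤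
        (x - y) * ((1 - l) * Real.exp x + l) := by
      have : Real.exp x - Real.exp y ≤ (x - y) * Real.exp x := by
        rw [e1]; nlinarith [Real.exp_pos x]
      nlinarith [mul_nonneg (sub_nonneg.2 h) hl.le]
    refine h3.trans ?_
    have h4 : 1 ≤ 1 / l * ((1 - l) * Real.exp y + l) := by
      rw [one_div, mul_add, inv_mul_cancel₀ hl.ne']
      have : 0 ≤ l⁻¹ * ((1 - l) * Real.exp y) := by positivity
      linarith
    nlinarith [mul_nonneg (sub_nonneg.2 h) hx.le]
  rcases le_total y x with h | h
  · exact key x y h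
  · rw [abs_sub_comm, abs_sub_comm x]
    exact key y x h

/-- The truncation `W ≤ 1/l` puts the exponent `z` in `[-1, 1]`, where `eᶻ ≤ 1 + z + z²`. Replacing
`W` by the unbiased weight `w` in the linear term and bounding `z²` each cost `l²(1 + w²)`, which
explains the factor `2`. -/
theorem exp_powerMean_le (hl : 0 < l) (hl1 : l ≤ 1) {G g w : ℝ} (hG : 0 < G) (hg : |g| ≤ G)
    (hw : 0 < w) :
    Real.exp (l / G * (1 / ((1 - l) * w⁻¹ + l) * g)) ≤
      1 + l / G * (w * g) + 2 * l ^ 2 * (1 + w ^ 2) := by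
  set W := 1 / ((1 - l) * w⁻¹ + l) with hW
  obtain ⟨hW0, hW1⟩ := powerMean_le_inv hl hl1 (inv_nonneg.2 hw.le)
  have hW2 := powerMean_sq_le hl hl1 hw
  have hW3 := abs_powerMean_sub_le hl hl1 hw
  rw [← hW] at hW0 hW1 hW2 hW3
  have hgG : |g / G| ≤ 1 := by rw [abs_div, abs_of_pos hG]; exact (div_le_one hG).2 hg
  have hz : |l / G * (W * g)| ≤ 1 := by
    have : l / G * (W * g) = (l * W) * (g / G) := by field_simp
    rw [this, abs_mul, abs_of_nonneg (mul_nonneg hl.le hW0)]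
    have : l * W ≤ 1 := by
      calc l * W ≤ l * (1 / l) := by gcongr
        _ = 1 := by field_simp
    exact mul_le_one₀ this (abs_nonneg _) hgG
  have h1 := (abs_le.1 (Real.abs_exp_sub_one_sub_id_le hz)).2
  have h2 : (l / G * (W * g)) ^ 2 ≤ l ^ 2 * (1 + w ^ 2) := by
    have : (l / G * (W * g)) ^ 2 = l ^ 2 * (W ^ 2 * (g / G) ^ 2) := by field_simp
    rw [this]
    have : (g / G) ^ 2 ≤ 1 := (sq_le_one_iff_abs_le_one _).2 hgG
    gcongr
    nlinarith [sq_nonneg W]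
  have h3 : l / G * (W * g) - l / G * (w * g) ≤ l ^ 2 * (1 + w ^ 2) := by
    have : l / G * (W * g) - l / G * (w * g) = l * ((W - w) * (g / G)) := by field_simp
    rw [this, sq, mul_assoc]
    refine mul_le_mul_of_nonneg_left ((le_abs_self _).trans ?_) hl.le
    rw [abs_mul]
    calc |W - w| * |g / G| ≤ |W - w| * 1 := by gcongr
      _ ≤ _ := by rw [mul_one]; exact hW3
  linarith

end Scalar

/-! ### Densities and laws of paths, and their consistency under prefixes -/

section PathLaw

variable {S : Type u} {A : Type v} [MeasurableSpace S] [MeasurableSpace A] {d : ℕ}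

namespace MDP

/-- The policy-independent factor of the density of a path with `n + 1` steps. -/
def pathBase (M : MDP S A) (n : ℕ) (τ : Fin (n + 1) → S × A) : ℝ :=
  M.init (τ 0).1 * ∏ t : Fin n, M.trans (τ t.castSucc).1 (τ t.castSucc).2 (τ t.succ).1

/-- The density of a path with `n + 1` steps under the policy `π θ`. -/
def pathDensity (M : MDP S A) (π : Param d → S → A → ℝ) (n : ℕ) (θ : Param d)
    (τ : Fin (n + 1) → S × A) : ℝ :=
  M.init (τ 0).1 * (∏ t : Fin (n + 1), π θ (τ t).1 (τ t).2) *
    ∏ t : Fin n, M.trans (τ t.castSucc).1 (τ t.castSucc).2 (τ t.succ).1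

/-- The reference measure on paths with `n + 1` steps. -/
def pathRef (M : MDP S A) (n : ℕ) : Measure (Fin (n + 1) → S × A) :=
  Measure.pi fun _ => M.refS.prod M.refA

instance (M : MDP S A) (n : ℕ) : SigmaFinite (M.pathRef n) := by
  unfold pathRef; infer_instance

/-- The law of the first `n + 1` steps under the policy `π θ`. -/
def pathLaw (M : MDP S A) (π : Param d → S → A → ℝ) (n : ℕ) (θ : Param d) :
    Measure (Fin (n + 1) → S × A) :=
  (M.pathRef n).withDensity fun τ => ENNReal.ofReal (M.pathDensity π n θ τ)

/-- The log-likelihood `∑ₜ log π_θ(aₜ | sₜ)` of a path. -/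
def logPolicy {n : ℕ} (π : Param d → S → A → ℝ) (τ : Fin (n + 1) → S × A) (θ : Param d) : ℝ :=
  ∑ t, Real.log (π θ (τ t).1 (τ t).2)

/-- The score `∇ log p_θ(τ) = ∑ₜ ∇ log π_θ(aₜ | sₜ)` of a path. -/
def pathScore {n : ℕ} (π : Param d → S → A → ℝ) (τ : Fin (n + 1) → S × A) (θ : Param d) :
    Param d :=
  ∑ t, score π (τ t).1 (τ t).2 θ

variable {M : MDP S A} {π : Param d → S → A → ℝ} {Θ : Set (Param d)} {n : ℕ} {θ θ' : Param d}

theorem trajLaw_eq_pathLaw : M.trajLaw π θ = M.pathLaw π M.H θ := rfl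

theorem trajDensity_eq_pathDensity (τ : M.Traj) :
    M.trajDensity π θ τ = M.pathDensity π M.H θ τ := rfl

theorem pathBase_nonneg (τ : Fin (n + 1) → S × A) : 0 ≤ M.pathBase n τ :=
  mul_nonneg (M.init_nonneg _) (Finset.prod_nonneg fun _ _ => M.trans_nonneg _ _ _)

theorem measurable_pathBase : Measurable (M.pathBase n) := by
  refine (M.init_measurable.comp (by fun_prop)).mul (Finset.measurable_fun_prod _ fun t _ => ?_)
  exact M.trans_measurable.comp (f := fun τ : Fin (n + 1) → S × A =>
    ((τ t.castSucc).1, (τ t.castSucc).2, (τ t.succ).1)) (by fun_prop)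

theorem pathDensity_eq (hπ : IsPolicyClass M Θ π) (hθ : θ ∈ Θ) (τ : Fin (n + 1) → S × A) :
    M.pathDensity π n θ τ = M.pathBase n τ * Real.exp (logPolicy π τ θ) := by
  rw [logPolicy, Real.exp_sum, Finset.prod_congr rfl fun t _ => Real.exp_log (hπ.pos θ hθ _ _),
    pathDensity, pathBase]
  ring

theorem pathDensity_nonneg (hπ : IsPolicyClass M Θ π) (hθ : θ ∈ Θ) (τ : Fin (n + 1) → S × A) :
    0 ≤ M.pathDensity π n θ τ := by
  rw [pathDensity_eq hπ hθ]
  exact mul_nonneg (pathBase_nonneg τ) (Real.exp_pos _).le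

theorem measurable_policy_comp (hπ : IsPolicyClass M Θ π) (hθ : θ ∈ Θ) {X : Type*}
    [MeasurableSpace X] {f : X → S × A} (hf : Measurable f) :
    Measurable fun x => π θ (f x).1 (f x).2 :=
  (hπ.measurable θ hθ).comp hf

theorem measurable_pathDensity (hπ : IsPolicyClass M Θ π) (hθ : θ ∈ Θ) :
    Measurable (M.pathDensity π n θ) := by
  have : M.pathDensity π n θ = fun τ => M.pathBase n τ * ∏ t, π θ (τ t).1 (τ t).2 := by
    funext τ; rw [pathDensity, pathBase]; ring
  rw [this]
  exact measurable_pathBase.mul (Finset.measurable_fun_prod _ fun t _ =>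
    measurable_policy_comp hπ hθ (measurable_pi_apply t))

theorem pathDensity_succ (τ : Fin (n + 2) → S × A) :
    M.pathDensity π (n + 1) θ τ = M.pathDensity π n θ (fun j => τ j.castSucc) *
      (M.trans (τ (Fin.last n).castSucc).1 (τ (Fin.last n).castSucc).2 (τ (Fin.last (n + 1))).1 *
        π θ (τ (Fin.last (n + 1))).1 (τ (Fin.last (n + 1))).2) := by
  simp only [pathDensity]
  rw [Fin.prod_univ_castSucc (n := n + 1), Fin.prod_univ_castSucc (n := n)
    (f := fun t : Fin (n + 1) => M.trans (τ t.castSucc).1 (τ t.castSucc).2 (τ t.succ).1)]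
  simp only [Fin.succ_castSucc, Fin.succ_last, Fin.castSucc_zero]
  ring

theorem lintegral_step (hπ : IsPolicyClass M Θ π) (hθ : θ ∈ Θ) {q : S → ℝ} (hq : Measurable q)
    (hq0 : ∀ s, 0 ≤ q s) (hq1 : ∫⁻ s, ENNReal.ofReal (q s) ∂M.refS = 1) :
    ∫⁻ x : S × A, ENNReal.ofReal (q x.1 * π θ x.1 x.2) ∂(M.refS.prod M.refA) = 1 := by
  rw [lintegral_prod _ (by
    have := hπ.measurable θ hθ
    have h2 : Measurable fun x : S × A => q x.1 := hq.comp measurable_fst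
    exact (h2.mul this).ennreal_ofReal.aemeasurable)]
  rw [← hq1]
  refine lintegral_congr fun s => ?_
  simp only [ENNReal.ofReal_mul (hq0 s)]
  rw [lintegral_const_mul' _ _ ENNReal.ofReal_ne_top, hπ.lintegral_eq_one θ hθ s, mul_one]

theorem lintegral_pathLaw (hπ : IsPolicyClass M Θ π) (hθ : θ ∈ Θ)
    {f : (Fin (n + 1) → S × A) → ENNReal} (hf : Measurable f) :
    ∫⁻ τ, f τ ∂M.pathLaw π n θ =
      ∫⁻ τ, ENNReal.ofReal (M.pathDensity π n θ τ) * f τ ∂M.pathRef n :=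
  lintegral_withDensity_eq_lintegral_mul _ (measurable_pathDensity hπ hθ).ennreal_ofReal hf

/-- The last state-action pair enters the density only through its transition and policy factors,
which integrate to one for every past, so Tonelli removes it. -/
theorem lintegral_pathLaw_succ (hπ : IsPolicyClass M Θ π) (hθ : θ ∈ Θ)
    {f : (Fin (n + 1) → S × A) → ENNReal} (hf : Measurable f) :
    ∫⁻ τ, f (fun j => τ j.castSucc) ∂M.pathLaw π (n + 1) θ = ∫⁻ τ, f τ ∂M.pathLaw π n θ := by
  rw [lintegral_pathLaw hπ hθ (f := fun τ => f fun j => τ j.castSucc) (hf.comp (by fun_prop)),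
    lintegral_pathLaw hπ hθ hf]
  have hmeasF : Measurable fun p : (S × A) × (Fin (n + 1) → S × A) =>
      ENNReal.ofReal (M.pathDensity π n θ p.2 *
        (M.trans (p.2 (Fin.last n)).1 (p.2 (Fin.last n)).2 p.1.1 * π θ p.1.1 p.1.2)) * f p.2 := by
    refine (Measurable.ennreal_ofReal ?_).mul (hf.comp measurable_snd)
    refine ((measurable_pathDensity hπ hθ).comp measurable_snd).mul (Measurable.mul ?_
      (measurable_policy_comp hπ hθ measurable_fst))
    exact M.trans_measurable.comp (f := fun p : (S × A) × (Fin (n + 1) → S × A) =>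
      ((p.2 (Fin.last n)).1, (p.2 (Fin.last n)).2, p.1.1)) (by fun_prop)
  have hmp := measurePreserving_piFinSuccAbove (n := n + 1)
    (fun _ : Fin (n + 2) => M.refS.prod M.refA) (Fin.last (n + 1))
  have := hmp.lintegral_comp hmeasF
  simp only [MeasurableEquiv.piFinSuccAbove_apply] at this
  rw [pathRef]
  calc _ = _ := ?_
    _ = _ := this
    _ = _ := ?_
  · refine lintegral_congr fun τ => ?_
    rw [pathDensity_succ]
    simp [Fin.insertNthEquiv, Fin.init]
    rfl
  · rw [lintegral_prod_symm _ hmeasF.aemeasurable]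
    refine lintegral_congr fun τ => ?_
    have h0 := pathDensity_nonneg hπ hθ τ
    simp only [ENNReal.ofReal_mul h0]
    have hq : Measurable fun s => M.trans (τ (Fin.last n)).1 (τ (Fin.last n)).2 s :=
      M.trans_measurable.comp (f := fun s => ((τ (Fin.last n)).1, (τ (Fin.last n)).2, s))
        (by fun_prop)
    have h1 := lintegral_step hπ hθ hq (fun s => M.trans_nonneg _ _ s) (M.trans_lintegral _ _)
    have hm : Measurable fun x : S × A => ENNReal.ofReal
        (M.trans (τ (Fin.last n)).1 (τ (Fin.last n)).2 x.1 * π θ x.1 x.2) :=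
      ((hq.comp measurable_fst).mul (hπ.measurable θ hθ)).ennreal_ofReal
    rw [lintegral_mul_const _ (hm.const_mul _), lintegral_const_mul _ hm, h1, mul_one]

theorem isProbabilityMeasure_pathLaw (hπ : IsPolicyClass M Θ π) (hθ : θ ∈ Θ) :
    IsProbabilityMeasure (M.pathLaw π n θ) := by
  constructor
  induction n with
  | zero =>
    rw [← lintegral_one, lintegral_pathLaw hπ hθ measurable_const]
    have hm : Measurable fun x : S × A => ENNReal.ofReal (M.init x.1 * π θ x.1 x.2) :=
      ((M.init_measurable.comp measurable_fst).mul (hπ.measurable θ hθ)).ennreal_ofReal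
    have hmp := measurePreserving_piUnique (fun _ : Fin 1 => M.refS.prod M.refA)
    have := hmp.lintegral_comp hm
    rw [lintegral_step hπ hθ M.init_measurable M.init_nonneg M.init_lintegral] at this
    refine Eq.trans (lintegral_congr fun τ => ?_) this
    simp [pathDensity]
  | succ n ih =>
    have := lintegral_pathLaw_succ hπ hθ (n := n) (f := fun _ => 1) measurable_const
    simp only [lintegral_one] at this
    rw [this, ih]

theorem map_pathLaw_succ (hπ : IsPolicyClass M Θ π) (hθ : θ ∈ Θ) :
    (M.pathLaw π (n + 1) θ).map (fun τ j => τ (Fin.castSucc j)) = M.pathLaw π n θ := by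
  refine Measure.ext_of_lintegral _ fun f hf => ?_
  rw [lintegral_map hf (by fun_prop), lintegral_pathLaw_succ hπ hθ hf]

/-- The law of a prefix of the path does not depend on the horizon. -/
theorem map_pathLaw_castLE (hπ : IsPolicyClass M Θ π) (hθ : θ ∈ Θ) {m n : ℕ} (hmn : m ≤ n) :
    (M.pathLaw π n θ).map (fun τ j => τ (Fin.castLE (Nat.succ_le_succ hmn) j)) =
      M.pathLaw π m θ := by
  induction n, hmn using Nat.le_induction with
  | base => simp
  | succ n hmn ih =>
    rw [← ih, ← map_pathLaw_succ hπ hθ (n := n), Measure.map_map (by fun_prop) (by fun_prop)]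
    rfl

end MDP

end PathLaw

/-! ### Scores, and differentiation under the integral sign -/

section Score

variable {S : Type u} {A : Type v} [MeasurableSpace S] [MeasurableSpace A] {d : ℕ}
  {M : MDP S A} {π : Param d → S → A → ℝ} {Θ : Set (Param d)} {n : ℕ} {θ θ' : Param d}
  {L₁ L₂ : ℝ}

open MDP

theorem measurable_param_of_apply {X : Type*} [MeasurableSpace X] {f : X → Param d}
    (hf : ∀ j, Measurable fun x => f x j) : Measurable f :=
  (MeasurableEquiv.toLp 2 (Fin d → ℝ)).measurable.comp (measurable_pi_lambda _ hf)

/-- Each coordinate of the score is a pointwise limit of difference quotients of `log π`, which are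
measurable in the state-action pair. -/
theorem measurable_score (hΘ : IsOpen Θ) (hπ : IsPolicyClass M Θ π)
    (hreg : RegularPolicy Θ π L₁ L₂) (hθ : θ ∈ Θ) :
    Measurable fun x : S × A => score π x.1 x.2 θ := by
  classical
  refine measurable_param_of_apply fun j => ?_
  set e : Param d := EuclideanSpace.single j 1 with he
  have hlim : Filter.Tendsto (fun m : ℕ => θ + (m : ℝ)⁻¹ • e) Filter.atTop (nhds θ) := by
    simpa using ((tendsto_inv_atTop_nhds_zero_nat (𝕜 := ℝ)).smul_const e).const_add θ
  -- The default value `0` covers the indices `m` for which the shifted parameter leaves `Θ`, where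
  -- `π` need not be measurable. Openness of `Θ` makes them irrelevant to the limit.
  refine measurable_of_tendsto_metrizable (f := fun (m : ℕ) (x : S × A) =>
    if θ + (m : ℝ)⁻¹ • e ∈ Θ then (m : ℝ) •
      (Real.log (π (θ + (m : ℝ)⁻¹ • e) x.1 x.2) - Real.log (π θ x.1 x.2)) else 0) ?_ ?_
  · intro m
    split_ifs with h
    · simp only [smul_eq_mul]
      exact (((hπ.measurable _ h).log).sub (hπ.measurable _ hθ).log).const_mul _
    · exact measurable_const
  · rw [tendsto_pi_nhds]
    intro x
    have hd := hreg.differentiableAt θ hθ x.1 x.2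
    have h1 := (hd.hasFDerivAt.lim_real e).comp (tendsto_natCast_atTop_atTop (R := ℝ))
    rw [hd.hasGradientAt.fderiv_apply, he, EuclideanSpace.inner_single_right] at h1
    simp only [one_mul, conj_trivial] at h1
    refine h1.congr' ?_
    filter_upwards [hlim.eventually (hΘ.mem_nhds hθ)] with m hm
    have hm' : θ + (m : ℝ)⁻¹ • e ∈ Θ := hm
    simp only [Function.comp_apply, he] at hm' ⊢
    rw [if_pos hm']

theorem hasGradientAt_logPolicy (hreg : RegularPolicy Θ π L₁ L₂) (hθ : θ ∈ Θ) (τ : Fin (n + 1) → S × A) :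
    HasGradientAt (logPolicy π τ) (pathScore π τ θ) θ := by
  rw [hasGradientAt_iff_hasFDerivAt, pathScore, map_sum]
  exact HasFDerivAt.fun_sum fun t _ =>
    (hreg.differentiableAt θ hθ (τ t).1 (τ t).2).hasGradientAt.hasFDerivAt

theorem norm_pathScore_le (hreg : RegularPolicy Θ π L₁ L₂) (hθ : θ ∈ Θ) (τ : Fin (n + 1) → S × A) :
    ‖pathScore π τ θ‖ ≤ (n + 1) * L₁ := by
  refine (norm_sum_le_of_le _ fun t _ => hreg.norm_score_le θ hθ (τ t).1 (τ t).2).trans ?_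
  simp

theorem measurable_pathScore (hΘ : IsOpen Θ) (hπ : IsPolicyClass M Θ π)
    (hreg : RegularPolicy Θ π L₁ L₂) (hθ : θ ∈ Θ) :
    Measurable fun τ : Fin (n + 1) → S × A => pathScore π τ θ :=
  Finset.measurable_fun_sum _ fun t _ =>
    (measurable_score hΘ hπ hreg hθ).comp (measurable_pi_apply t)

theorem abs_logPolicy_sub_le (hc : Convex ℝ Θ)
    (hreg : RegularPolicy Θ π L₁ L₂) (hθ : θ ∈ Θ) (hθ' : θ' ∈ Θ) (τ : Fin (n + 1) → S × A) :
    |logPolicy π τ θ - logPolicy π τ θ'| ≤ (n + 1) * L₁ * ‖θ - θ'‖ := by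
  refine hc.norm_image_sub_le_of_norm_hasFDerivWithin_le (f := logPolicy π τ)
    (fun x hx => (hasGradientAt_logPolicy hreg hx τ).hasFDerivAt.hasFDerivWithinAt)
    (fun x hx => ?_) hθ' hθ
  rw [LinearIsometryEquiv.norm_map]
  exact norm_pathScore_le hreg hx τ

theorem integral_pathLaw (hπ : IsPolicyClass M Θ π) {E : Type*} [NormedAddCommGroup E] [NormedSpace ℝ E] (hθ : θ ∈ Θ)
    (F : (Fin (n + 1) → S × A) → E) :
    ∫ τ, F τ ∂M.pathLaw π n θ = ∫ τ, M.pathDensity π n θ τ • F τ ∂M.pathRef n := by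
  rw [pathLaw, integral_withDensity_eq_integral_toReal_smul
    (measurable_pathDensity hπ hθ).ennreal_ofReal (by simp)]
  simp only [ENNReal.toReal_ofReal (pathDensity_nonneg hπ hθ _)]

theorem integrable_pathDensity (hπ : IsPolicyClass M Θ π) (hθ : θ ∈ Θ) : Integrable (M.pathDensity π n θ) (M.pathRef n) := by
  refine ⟨(measurable_pathDensity hπ hθ).aestronglyMeasurable, ?_⟩
  rw [hasFiniteIntegral_iff_ofReal (Filter.Eventually.of_forall (pathDensity_nonneg hπ hθ))]
  have := isProbabilityMeasure_pathLaw (n := n) hπ hθ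
  have h1 := lintegral_pathLaw (n := n) hπ hθ (f := fun _ => 1) measurable_const
  simp only [lintegral_one, measure_univ, mul_one] at h1
  rw [← h1]
  exact ENNReal.one_lt_top

theorem integral_pathDensity (hπ : IsPolicyClass M Θ π) (hθ : θ ∈ Θ) : ∫ τ, M.pathDensity π n θ τ ∂M.pathRef n = 1 := by
  have := isProbabilityMeasure_pathLaw (n := n) hπ hθ
  have h1 := integral_pathLaw (n := n) hπ hθ fun _ => (1 : ℝ)
  simpa using h1.symm

/-- The log-derivative identity `∇p = p ∇log p` under the integral. Domination is uniform on a small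
ball: bounded scores make `log p` Lipschitz, so nearby densities are at most a constant multiple of
the density at the centre. -/
theorem hasGradientAt_integral_pathLaw (hΘ : IsOpen Θ) (hc : Convex ℝ Θ) (hπ : IsPolicyClass M Θ π)
    (hreg : RegularPolicy Θ π L₁ L₂) (hθ : θ ∈ Θ) {F : (Fin (n + 1) → S × A) → ℝ}
    (hF : Measurable F) {c : ℝ} (hFc : ∀ τ, |F τ| ≤ c) :
    HasGradientAt (fun θ => ∫ τ, F τ ∂M.pathLaw π n θ)
      (∫ τ, F τ • pathScore π τ θ ∂M.pathLaw π n θ) θ := by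
  obtain ⟨r, hr, hball⟩ := Metric.isOpen_iff.1 hΘ θ hθ
  have hs := Metric.ball_mem_nhds θ hr
  have hmeas : ∀ θ' ∈ Θ, AEStronglyMeasurable (fun τ => M.pathDensity π n θ' τ * F τ)
      (M.pathRef n) := fun θ' h => ((measurable_pathDensity hπ h).mul hF).aestronglyMeasurable
  have key := hasFDerivAt_integral_of_dominated_of_fderiv_le (𝕜 := ℝ) (μ := M.pathRef n)
    (F := fun θ' τ => M.pathDensity π n θ' τ * F τ) (x₀ := θ) (s := Metric.ball θ r)
    (F' := fun θ' τ => InnerProductSpace.toDual ℝ _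
      ((M.pathDensity π n θ' τ * F τ) • pathScore π τ θ'))
    (bound := fun τ => (Real.exp ((n + 1) * L₁ * r) * M.pathDensity π n θ τ) * c * ((n + 1) * L₁))
    hs (Filter.eventually_of_mem hs fun θ' h => hmeas θ' (hball h)) ?_ ?_ ?_ ?_ ?_
  · have e1 : (fun θ => ∫ τ, F τ ∂M.pathLaw π n θ) =ᶠ[nhds θ]
        fun θ' => ∫ τ, M.pathDensity π n θ' τ * F τ ∂M.pathRef n :=
      Filter.eventually_of_mem hs fun θ' h => integral_pathLaw hπ (hball h) F
    refine HasGradientAt.congr_of_eventuallyEq ?_ e1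
    rw [hasGradientAt_iff_hasFDerivAt]
    refine key.congr_fderiv ?_
    rw [integral_pathLaw hπ hθ]
    simp only [smul_smul]
    exact ((InnerProductSpace.toDual ℝ (Param d)).toContinuousLinearEquiv.integral_comp_comm
      _)
  · exact (integrable_pathDensity hπ hθ).mul_bdd (c := c) hF.aestronglyMeasurable
      (Filter.Eventually.of_forall hFc)
  · refine (LinearIsometryEquiv.continuous _).comp_aestronglyMeasurable ?_
    exact (((measurable_pathDensity hπ hθ).mul hF).smul
      (measurable_pathScore hΘ hπ hreg hθ)).aestronglyMeasurable
  · refine Filter.Eventually.of_forall fun τ θ' h => ?_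
    have hθ' := hball h
    rw [LinearIsometryEquiv.norm_map, norm_smul, norm_mul, Real.norm_eq_abs, Real.norm_eq_abs,
      abs_of_nonneg (pathDensity_nonneg hπ hθ' τ)]
    have h0 : 0 ≤ c := (abs_nonneg _).trans (hFc τ)
    have hdens : M.pathDensity π n θ' τ ≤
        Real.exp ((n + 1) * L₁ * r) * M.pathDensity π n θ τ := by
      rw [pathDensity_eq hπ hθ', pathDensity_eq hπ hθ, mul_left_comm, ← Real.exp_add]
      refine mul_le_mul_of_nonneg_left (Real.exp_le_exp.2 ?_) (pathBase_nonneg τ)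
      have h1 := (abs_le.1 (abs_logPolicy_sub_le hc hreg hθ' hθ τ)).2
      have h2 : ‖θ' - θ‖ ≤ r := by rw [← dist_eq_norm]; exact (Metric.mem_ball.1 h).le
      have h3 : 0 ≤ (n + 1) * L₁ := (norm_nonneg _).trans (norm_pathScore_le hreg hθ τ)
      nlinarith [mul_le_mul_of_nonneg_left h2 h3]
    have hnn := pathDensity_nonneg hπ hθ' τ
    have hnn' := pathDensity_nonneg hπ hθ τ
    gcongr
    · exact hFc τ
    · exact norm_pathScore_le hreg hθ' τ
  · exact (((integrable_pathDensity hπ hθ).const_mul _).mul_const _).mul_const _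
  · refine Filter.Eventually.of_forall fun τ θ' h => ?_
    have hθ' := hball h
    have h1 := ((hasGradientAt_logPolicy hreg hθ' τ).hasFDerivAt.exp.const_mul
      (M.pathBase n τ)).mul_const (F τ)
    refine HasFDerivAt.congr_of_eventuallyEq (f := fun θ' => M.pathBase n τ *
      Real.exp (logPolicy π τ θ') * F τ) ?_ (Filter.eventually_of_mem (hΘ.mem_nhds hθ')
        fun x hx => by simp only [pathDensity_eq hπ hx])
    refine h1.congr_fderiv ?_
    rw [pathDensity_eq hπ hθ', map_smul, smul_smul, smul_smul]
    congr 1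
    ring

end Score

/-! ### REINFORCE and GPOMDP: bounds, unbiasedness, smoothness of `J` -/

section Estimator

variable {S : Type u} {A : Type v} [MeasurableSpace S] [MeasurableSpace A] {d : ℕ}
  {M : MDP S A} {π : Param d → S → A → ℝ} {Θ : Set (Param d)} {θ θ' : Param d}
  {L₁ L₂ G G₂ : ℝ} {est : GradEstimator}

open MDP

/-- The discounted reward at time `t`. -/
def discReward (M : MDP S A) (τ : M.Traj) (t : Fin (M.H + 1)) : ℝ :=
  M.γ ^ (t : ℕ) * M.reward (τ t).1 (τ t).2

/-- The coefficient of the score at time `l` in the single-trajectory gradient estimator. -/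
def gradCoef (M : MDP S A) (est : GradEstimator) (τ : M.Traj) (l : Fin (M.H + 1)) : ℝ :=
  match est with
  | .reinforce => M.ret τ
  | .gpomdp => ∑ t ∈ Finset.Ici l, discReward M τ t

theorem singleGrad_eq (τ : M.Traj) (θ : Param d) :
    singleGrad M π est τ θ = ∑ l, gradCoef M est τ l • score π (τ l).1 (τ l).2 θ := by
  cases est with
  | reinforce => rfl
  | gpomdp =>
    simp only [singleGrad, gradCoef, Finset.smul_sum, Finset.sum_smul]
    rw [Finset.sum_comm' (t' := Finset.univ) (s' := fun l => Finset.Ici l) (by simp)]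
    rfl

theorem abs_discReward_le (τ : M.Traj) (t : Fin (M.H + 1)) : |discReward M τ t| ≤ |M.Rmax| := by
  rw [discReward, abs_mul, abs_pow, abs_of_nonneg M.γ_nonneg]
  calc M.γ ^ (t : ℕ) * |M.reward (τ t).1 (τ t).2| ≤ 1 * |M.reward (τ t).1 (τ t).2| := by
        gcongr; exact pow_le_one₀ M.γ_nonneg M.γ_le_one
    _ ≤ |M.Rmax| := by rw [one_mul]; exact (M.reward_bound _ _).trans (le_abs_self _)

theorem abs_sum_discReward_le (τ : M.Traj) (s : Finset (Fin (M.H + 1))) :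
    |∑ t ∈ s, discReward M τ t| ≤ M.T * |M.Rmax| := by
  refine (Finset.abs_sum_le_sum_abs _ _).trans ((Finset.sum_le_univ_sum_of_nonneg
    fun _ => abs_nonneg _).trans ((Finset.sum_le_sum fun t _ => abs_discReward_le τ t).trans ?_))
  simp [MDP.T]

theorem abs_ret_le (τ : M.Traj) : |M.ret τ| ≤ M.T * |M.Rmax| := abs_sum_discReward_le τ _

theorem abs_gradCoef_le (τ : M.Traj) (l : Fin (M.H + 1)) :
    |gradCoef M est τ l| ≤ M.T * |M.Rmax| := by
  cases est with
  | reinforce => exact abs_ret_le τ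
  | gpomdp => exact abs_sum_discReward_le τ _

theorem measurable_discReward (t : Fin (M.H + 1)) : Measurable fun τ => discReward M τ t :=
  (M.reward_measurable.comp (measurable_pi_apply t)).const_mul _

theorem measurable_ret : Measurable M.ret :=
  Finset.measurable_fun_sum _ fun t _ => measurable_discReward t

theorem measurable_gradCoef (l : Fin (M.H + 1)) : Measurable fun τ => gradCoef M est τ l := by
  cases est with
  | reinforce => exact measurable_ret
  | gpomdp => exact Finset.measurable_fun_sum _ fun t _ => measurable_discReward t

theorem measurable_singleGrad (hΘ : IsOpen Θ) (hπ : IsPolicyClass M Θ π)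
    (hreg : RegularPolicy Θ π L₁ L₂) (hθ : θ ∈ Θ) :
    Measurable fun τ => singleGrad M π est τ θ := by
  simp only [singleGrad_eq]
  exact Finset.measurable_fun_sum _ fun l _ => (measurable_gradCoef l).smul
    ((measurable_score hΘ hπ hreg hθ).comp (measurable_pi_apply l))

theorem hasFDerivAt_singleGrad (hreg : RegularPolicy Θ π L₁ L₂) (hθ : θ ∈ Θ) (τ : M.Traj) :
    HasFDerivAt (singleGrad M π est τ)
      (∑ l, gradCoef M est τ l • fderiv ℝ (score π (τ l).1 (τ l).2) θ) θ := by
  have : singleGrad M π est τ = fun θ => ∑ l, gradCoef M est τ l • score π (τ l).1 (τ l).2 θ :=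
    funext fun θ => singleGrad_eq τ θ
  rw [this]
  exact HasFDerivAt.fun_sum fun l _ =>
    (hreg.differentiableAt_score θ hθ _ _).hasFDerivAt.fun_const_smul _

theorem MDP.T_pos (M : MDP S A) : 0 < M.T := by unfold MDP.T; positivity

theorem exists_estimatorBounds (hL₁ : 0 < L₁) (hL₂ : 0 < L₂) (hreg : RegularPolicy Θ π L₁ L₂) :
    ∃ G G₂ : ℝ, 0 < G ∧ 0 < G₂ ∧ EstimatorBounds M Θ π est G G₂ := by
  have hT := M.T_pos
  have hT1 : M.T = ((Finset.univ : Finset (Fin (M.H + 1))).card : ℝ) := by simp [MDP.T]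
  refine ⟨M.T * (M.T * |M.Rmax| * L₁) + 1, M.T * (M.T * |M.Rmax| * L₂) + 1, by positivity,
    by positivity, fun θ hθ τ => ⟨?_, ?_⟩⟩
  · rw [singleGrad_eq]
    refine (norm_sum_le_of_le _ (n := fun _ => M.T * |M.Rmax| * L₁) fun l _ => ?_).trans ?_
    · rw [norm_smul, Real.norm_eq_abs]
      exact mul_le_mul (abs_gradCoef_le τ l) (hreg.norm_score_le θ hθ _ _) (norm_nonneg _)
        (by positivity)
    · rw [Finset.sum_const, nsmul_eq_mul, ← hT1]; linarith
  · rw [(hasFDerivAt_singleGrad hreg hθ τ).fderiv]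
    refine (norm_sum_le_of_le _ (n := fun _ => M.T * |M.Rmax| * L₂) fun l _ => ?_).trans ?_
    · rw [norm_smul, Real.norm_eq_abs]
      exact mul_le_mul (abs_gradCoef_le τ l) (hreg.norm_hessian_le θ hθ _ _) (norm_nonneg _)
        (by positivity)
    · rw [Finset.sum_const, nsmul_eq_mul, ← hT1]; linarith

theorem norm_singleGrad_sub_le (hc : Convex ℝ Θ) (hreg : RegularPolicy Θ π L₁ L₂)
    (hG : EstimatorBounds M Θ π est G G₂) (hθ : θ ∈ Θ) (hθ' : θ' ∈ Θ) (τ : M.Traj) :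
    ‖singleGrad M π est τ θ - singleGrad M π est τ θ'‖ ≤ G₂ * ‖θ - θ'‖ :=
  hc.norm_image_sub_le_of_norm_fderiv_le
    (fun _ hx => (hasFDerivAt_singleGrad hreg hx τ).differentiableAt)
    (fun x hx => (hG x hx τ).2) hθ' hθ

theorem integrable_of_bound {X E : Type*} [MeasurableSpace X] [NormedAddCommGroup E] {μ : Measure X}
    [IsFiniteMeasure μ] {f : X → E} (hf : AEStronglyMeasurable f μ) {c : ℝ} (hc : ∀ x, ‖f x‖ ≤ c) :
    Integrable f μ :=
  Integrable.of_bound hf c (Filter.Eventually.of_forall hc)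

theorem isProbabilityMeasure_trajLaw (hπ : IsPolicyClass M Θ π) (hθ : θ ∈ Θ) :
    IsProbabilityMeasure (M.trajLaw π θ) :=
  isProbabilityMeasure_pathLaw hπ hθ

theorem sum_Iic_eq_sum_castLE {E : Type*} [AddCommMonoid E] {H : ℕ} (t : Fin (H + 1))
    (f : Fin (H + 1) → E) :
    ∑ l ∈ Finset.Iic t, f l =
      ∑ j : Fin ((t : ℕ) + 1), f (Fin.castLE (Nat.succ_le_succ (Nat.le_of_lt_succ t.2)) j) := by
  refine (Finset.sum_bij (fun j _ => Fin.castLE (Nat.succ_le_succ (Nat.le_of_lt_succ t.2)) j)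
    ?_ ?_ ?_ ?_).symm
  · intro j _
    rw [Finset.mem_Iic, Fin.le_def]
    exact Nat.le_of_lt_succ j.2
  · intro i _ j _ h
    exact Fin.castLE_injective _ h
  · intro l hl
    rw [Finset.mem_Iic, Fin.le_def] at hl
    exact ⟨⟨l, Nat.lt_succ_of_le hl⟩, Finset.mem_univ _, rfl⟩
  · intro _ _; rfl

/-- Causality: the reward at time `t` depends only on the prefix up to `t`, whose law is independent
of the horizon. Differentiating the prefix law produces only the scores up to `t`, as GPOMDP
requires. -/
theorem hasGradientAt_integral_discReward (hΘ : IsOpen Θ) (hc : Convex ℝ Θ)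
    (hπ : IsPolicyClass M Θ π) (hreg : RegularPolicy Θ π L₁ L₂) (hθ : θ ∈ Θ)
    (t : Fin (M.H + 1)) :
    HasGradientAt (fun θ => ∫ τ, discReward M τ t ∂M.trajLaw π θ)
      (∫ τ, discReward M τ t • ∑ l ∈ Finset.Iic t, score π (τ l).1 (τ l).2 θ ∂M.trajLaw π θ) θ := by
  have htH : (t : ℕ) ≤ M.H := Nat.le_of_lt_succ t.2
  set pr : M.Traj → Fin ((t : ℕ) + 1) → S × A :=
    fun τ j => τ (Fin.castLE (Nat.succ_le_succ htH) j) with hpr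
  have hprm : Measurable pr := measurable_pi_lambda _ fun j => measurable_pi_apply _
  have hlast : ∀ τ : M.Traj, pr τ (Fin.last t) = τ t := fun τ => rfl
  set F : (Fin ((t : ℕ) + 1) → S × A) → ℝ := fun σ =>
    M.γ ^ (t : ℕ) * M.reward (σ (Fin.last t)).1 (σ (Fin.last t)).2 with hFdef
  have hF : Measurable F := (M.reward_measurable.comp (measurable_pi_apply _)).const_mul _
  have hFb : ∀ σ, |F σ| ≤ |M.Rmax| := by
    intro σ
    have := abs_discReward_le (M := M) (fun _ => σ (Fin.last t)) t
    exact this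
  have hmap : ∀ θ ∈ Θ, (M.trajLaw π θ).map pr = M.pathLaw π t θ := fun θ hθ =>
    map_pathLaw_castLE hπ hθ htH
  have key := hasGradientAt_integral_pathLaw (M := M) (n := t) hΘ hc hπ hreg hθ hF hFb
  have e1 : (fun θ => ∫ τ, discReward M τ t ∂M.trajLaw π θ) =ᶠ[nhds θ]
      fun θ => ∫ σ, F σ ∂M.pathLaw π t θ := by
    filter_upwards [hΘ.mem_nhds hθ] with x hx
    rw [← hmap x hx, integral_map hprm.aemeasurable hF.aestronglyMeasurable]
    rfl
  refine HasGradientAt.congr_of_eventuallyEq ?_ e1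
  convert key using 1
  rw [← hmap θ hθ, integral_map (f := fun τ => F τ • pathScore π τ θ) hprm.aemeasurable
    (hF.smul (measurable_pathScore hΘ hπ hreg hθ)).aestronglyMeasurable]
  refine integral_congr_ae (Filter.Eventually.of_forall fun τ => ?_)
  simp only [sum_Iic_eq_sum_castLE]
  rfl

theorem HasGradientAt.fun_sum' {ι : Type*} (s : Finset ι) {f : ι → Param d → ℝ}
    {f' : ι → Param d} (h : ∀ i ∈ s, HasGradientAt (f i) (f' i) θ) :
    HasGradientAt (fun θ => ∑ i ∈ s, f i θ) (∑ i ∈ s, f' i) θ := by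
  rw [hasGradientAt_iff_hasFDerivAt, map_sum]
  exact HasFDerivAt.fun_sum fun i hi => (h i hi).hasFDerivAt

/-- The policy gradient theorem, for both estimators. -/
theorem hasGradientAt_J (hΘ : IsOpen Θ) (hc : Convex ℝ Θ) (hπ : IsPolicyClass M Θ π)
    (hreg : RegularPolicy Θ π L₁ L₂) (est : GradEstimator) (hθ : θ ∈ Θ) :
    HasGradientAt (M.J π) (∫ τ, singleGrad M π est τ θ ∂M.trajLaw π θ) θ := by
  cases est with
  | reinforce =>
    have key := hasGradientAt_integral_pathLaw (M := M) (n := M.H) hΘ hc hπ hreg hθ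
      measurable_ret abs_ret_le
    simp only [singleGrad, ← Finset.smul_sum]
    exact key
  | gpomdp =>
    have key := HasGradientAt.fun_sum' Finset.univ fun t _ =>
      hasGradientAt_integral_discReward hΘ hc hπ hreg hθ t
    have e1 : M.J π =ᶠ[nhds θ] fun θ => ∑ t, ∫ τ, discReward M τ t ∂M.trajLaw π θ := by
      filter_upwards [hΘ.mem_nhds hθ] with x hx
      have := isProbabilityMeasure_trajLaw (M := M) hπ hx
      rw [← integral_finsetSum _ fun t _ => integrable_of_bound
        (measurable_discReward t).aestronglyMeasurable fun τ => abs_discReward_le τ t]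
      rfl
    refine HasGradientAt.congr_of_eventuallyEq ?_ e1
    convert key using 1
    have := isProbabilityMeasure_trajLaw (M := M) hπ hθ
    rw [← integral_finsetSum]
    · rfl
    intro t _
    refine integrable_of_bound (((measurable_discReward t).smul
      (Finset.measurable_fun_sum _ fun l _ => (measurable_score hΘ hπ hreg hθ).comp
        (measurable_pi_apply l))).aestronglyMeasurable)
      (c := |M.Rmax| * ((Finset.Iic t).card • L₁)) fun τ => ?_
    rw [norm_smul, Real.norm_eq_abs]
    refine mul_le_mul (abs_discReward_le τ t) ?_ (norm_nonneg _) (abs_nonneg _)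
    exact (norm_sum_le_of_le _ fun l _ => hreg.norm_score_le θ hθ _ _).trans (by simp)

theorem gradient_J (hΘ : IsOpen Θ) (hc : Convex ℝ Θ) (hπ : IsPolicyClass M Θ π)
    (hreg : RegularPolicy Θ π L₁ L₂) (est : GradEstimator) (hθ : θ ∈ Θ) :
    gradient (M.J π) θ = ∫ τ, singleGrad M π est τ θ ∂M.trajLaw π θ :=
  (hasGradientAt_J hΘ hc hπ hreg est hθ).gradient

theorem norm_gradient_J_le (hΘ : IsOpen Θ) (hc : Convex ℝ Θ) (hπ : IsPolicyClass M Θ π)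
    (hreg : RegularPolicy Θ π L₁ L₂) (hG : EstimatorBounds M Θ π est G G₂) (hθ : θ ∈ Θ) :
    ‖gradient (M.J π) θ‖ ≤ G := by
  have := isProbabilityMeasure_trajLaw (M := M) hπ hθ
  rw [gradient_J hΘ hc hπ hreg est hθ]
  simpa using norm_integral_le_of_norm_le_const (μ := M.trajLaw π θ) (C := G)
    (Filter.Eventually.of_forall fun τ => (hG θ hθ τ).1)

theorem abs_J_le (hπ : IsPolicyClass M Θ π) (hθ : θ ∈ Θ) : |M.J π θ| ≤ M.T * |M.Rmax| := by
  have := isProbabilityMeasure_trajLaw (M := M) hπ hθ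
  simpa [MDP.J] using norm_integral_le_of_norm_le_const (μ := M.trajLaw π θ) (f := M.ret)
    (Filter.Eventually.of_forall fun τ => abs_ret_le τ)

theorem J_le_Jstar (hπ : IsPolicyClass M Θ π) (hθ : θ ∈ Θ) : M.J π θ ≤ M.Jstar π Θ := by
  refine le_csSup ⟨M.T * |M.Rmax|, ?_⟩ (Set.mem_image_of_mem _ hθ)
  rintro _ ⟨x, hx, rfl⟩
  exact (abs_le.1 (abs_J_le hπ hx)).2

/-- The log-likelihoods differ by at most the right-hand side, and the arithmetic mean of the two
densities has integral one. -/
theorem integral_abs_pathDensity_sub_le {n : ℕ} (hc : Convex ℝ Θ) (hπ : IsPolicyClass M Θ π)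
    (hreg : RegularPolicy Θ π L₁ L₂) (hθ : θ ∈ Θ) (hθ' : θ' ∈ Θ) :
    ∫ τ, |M.pathDensity π n θ τ - M.pathDensity π n θ' τ| ∂M.pathRef n ≤
      (n + 1) * L₁ * ‖θ - θ'‖ := by
  have h1 := integrable_pathDensity (M := M) (n := n) hπ hθ
  have h2 := integrable_pathDensity (M := M) (n := n) hπ hθ'
  have hle : ∀ τ, |M.pathDensity π n θ τ - M.pathDensity π n θ' τ| ≤
      (n + 1) * L₁ * ‖θ - θ'‖ * ((M.pathDensity π n θ τ + M.pathDensity π n θ' τ) / 2) := by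
    intro τ
    have h3 := abs_logPolicy_sub_le hc hreg hθ hθ' τ
    have h4 := abs_exp_sub_exp_le_mul_add (logPolicy π τ θ) (logPolicy π τ θ')
    have h5 := pathBase_nonneg (M := M) τ
    rw [pathDensity_eq hπ hθ, pathDensity_eq hπ hθ', ← mul_sub, abs_mul, abs_of_nonneg h5]
    calc _ ≤ M.pathBase n τ * ((n + 1) * L₁ * ‖θ - θ'‖ *
          ((Real.exp (logPolicy π τ θ) + Real.exp (logPolicy π τ θ')) / 2)) := by
          refine mul_le_mul_of_nonneg_left (h4.trans ?_) h5
          gcongr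
      _ = _ := by ring
  refine (integral_mono (h1.sub h2).abs (((h1.add h2).div_const 2).const_mul _) hle).trans ?_
  rw [integral_const_mul]
  simp only [Pi.add_apply]
  rw [integral_div, integral_add h1 h2, integral_pathDensity hπ hθ, integral_pathDensity hπ hθ']
  norm_num

/-- In `∇J = ∫ p g` the estimator contributes its Lipschitz constant `G₂`, and the density
contributes its `L¹` modulus `T L₁` times the bound `G`. -/
theorem lipschitzSmoothOn_J (hΘ : IsOpen Θ) (hc : Convex ℝ Θ) (hπ : IsPolicyClass M Θ π)
    (hreg : RegularPolicy Θ π L₁ L₂) (hG : EstimatorBounds M Θ π est G G₂) :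
    LipschitzSmoothOn (M.J π) (G * M.T * L₁ + G₂) Θ := by
  refine ⟨fun θ hθ => (hasGradientAt_J hΘ hc hπ hreg est hθ).differentiableAt,
    fun θ hθ θ' hθ' => ?_⟩
  have hp := integrable_pathDensity (M := M) (n := M.H) hπ hθ
  have hp' := integrable_pathDensity (M := M) (n := M.H) hπ hθ'
  have hg := measurable_singleGrad (M := M) (est := est) hΘ hπ hreg hθ
  have hg' := measurable_singleGrad (M := M) (est := est) hΘ hπ hreg hθ'
  rw [gradient_J hΘ hc hπ hreg est hθ, gradient_J hΘ hc hπ hreg est hθ', trajLaw_eq_pathLaw,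
    trajLaw_eq_pathLaw, integral_pathLaw hπ hθ, integral_pathLaw hπ hθ', ← integral_sub]
  rotate_left
  · exact hp.smul_bdd G hg.aestronglyMeasurable
      (Filter.Eventually.of_forall fun τ => (hG θ hθ τ).1)
  · exact hp'.smul_bdd G hg'.aestronglyMeasurable
      (Filter.Eventually.of_forall fun τ => (hG θ' hθ' τ).1)
  have hint := (hp.mul_const (G₂ * ‖θ - θ'‖)).add ((hp.sub hp').abs.mul_const G)
  refine (norm_integral_le_of_norm_le hint (Filter.Eventually.of_forall fun τ => ?_)).trans ?_
  · set p := M.pathDensity π M.H θ τ with hpdef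
    set p' := M.pathDensity π M.H θ' τ
    have h0 : 0 ≤ p := pathDensity_nonneg hπ hθ τ
    have e : p • singleGrad M π est τ θ - p' • singleGrad M π est τ θ' =
        p • (singleGrad M π est τ θ - singleGrad M π est τ θ') +
          (p - p') • singleGrad M π est τ θ' := by
      rw [smul_sub, sub_smul]; abel
    rw [e]
    refine (norm_add_le _ _).trans (add_le_add ?_ ?_)
    · rw [norm_smul, Real.norm_eq_abs, abs_of_nonneg h0]
      exact mul_le_mul_of_nonneg_left (norm_singleGrad_sub_le hc hreg hG hθ hθ' τ) h0
    · rw [norm_smul, Real.norm_eq_abs]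
      exact mul_le_mul_of_nonneg_left (hG θ' hθ' τ).1 (abs_nonneg _)
  · refine (integral_add (hp.mul_const _) ((hp.sub hp').abs.mul_const G)).le.trans ?_
    rw [integral_mul_const, integral_mul_const, integral_pathDensity hπ hθ]
    simp only [Pi.sub_apply]
    have h1 := integral_abs_pathDensity_sub_le (M := M) (n := M.H) hc hπ hreg hθ hθ'
    have hGG : 0 ≤ G := (norm_nonneg _).trans (norm_gradient_J_le hΘ hc hπ hreg hG hθ)
    have := mul_le_mul_of_nonneg_right h1 hGG
    simp only [MDP.T]
    linarith

end Estimator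

/-! ### The power-mean weighted estimator for a fixed target -/

section PowerMean

variable {S : Type u} {A : Type v} [MeasurableSpace S] [MeasurableSpace A] {d : ℕ}
  {M : MDP S A} {π : Param d → S → A → ℝ} {Θ : Set (Param d)} {θ θ' ϑ : Param d}
  {L₁ L₂ G G₂ D l : ℝ} {est : GradEstimator}

open MDP

/-- The power-mean importance weight of a trajectory sampled under `θ`, for the target `ϑ`. -/
def pmWeight (M : MDP S A) (π : Param d → S → A → ℝ) (l : ℝ) (θ ϑ : Param d) (τ : M.Traj) : ℝ :=
  1 / ((1 - l) * (M.trajDensity π θ τ / M.trajDensity π ϑ τ) + l)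

/-- The single-trajectory gradient estimator at `ϑ` weighted by the power-mean weight. -/
def pmGrad (M : MDP S A) (π : Param d → S → A → ℝ) (est : GradEstimator) (l : ℝ) (θ ϑ : Param d)
    (τ : M.Traj) : Param d :=
  pmWeight M π l θ ϑ τ • singleGrad M π est τ ϑ

theorem pmWeight_bounds (hπ : IsPolicyClass M Θ π) (hl : 0 < l) (hl1 : l ≤ 1) (hθ : θ ∈ Θ)
    (hϑ : ϑ ∈ Θ) (τ : M.Traj) : 0 ≤ pmWeight M π l θ ϑ τ ∧ pmWeight M π l θ ϑ τ ≤ 1 / l :=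
  powerMean_le_inv hl hl1 (div_nonneg (pathDensity_nonneg hπ hθ τ) (pathDensity_nonneg hπ hϑ τ))

theorem norm_pmGrad_le (hπ : IsPolicyClass M Θ π) (hG : EstimatorBounds M Θ π est G G₂)
    (hl : 0 < l) (hl1 : l ≤ 1) (hθ : θ ∈ Θ) (hϑ : ϑ ∈ Θ) (τ : M.Traj) :
    ‖pmGrad M π est l θ ϑ τ‖ ≤ G / l := by
  obtain ⟨h0, h1⟩ := pmWeight_bounds hπ hl hl1 hθ hϑ τ
  rw [pmGrad, norm_smul, Real.norm_eq_abs, abs_of_nonneg h0]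
  calc _ ≤ 1 / l * G := mul_le_mul h1 (hG ϑ hϑ τ).1 (norm_nonneg _) (by positivity)
    _ = G / l := by ring

theorem trajDensity_div (hπ : IsPolicyClass M Θ π) (hθ : θ ∈ Θ) (hϑ : ϑ ∈ Θ) {τ : M.Traj}
    (hb : M.pathBase M.H τ ≠ 0) :
    M.trajDensity π θ τ / M.trajDensity π ϑ τ =
      Real.exp (logPolicy π τ θ - logPolicy π τ ϑ) := by
  rw [trajDensity_eq_pathDensity, trajDensity_eq_pathDensity, pathDensity_eq hπ hθ,
    pathDensity_eq hπ hϑ, mul_div_mul_left _ _ hb, Real.exp_sub]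

theorem abs_pmWeight_sub_le (hc : Convex ℝ Θ) (hπ : IsPolicyClass M Θ π)
    (hreg : RegularPolicy Θ π L₁ L₂) (hl : 0 < l) (hl1 : l ≤ 1) (hθ : θ ∈ Θ) (hϑ : ϑ ∈ Θ)
    (hθ' : θ' ∈ Θ) (τ : M.Traj) :
    |pmWeight M π l θ ϑ τ - pmWeight M π l θ θ' τ| ≤ 1 / l * (M.T * L₁ * ‖ϑ - θ'‖) := by
  have h1 := abs_logPolicy_sub_le hc hreg hϑ hθ' τ
  -- On impossible trajectories all densities vanish. The convention `0 / 0 = 0` then gives the same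
  -- weight for every target, so nothing has to be excluded.
  by_cases hb : M.pathBase M.H τ = 0
  · simp only [pmWeight, trajDensity_eq_pathDensity, pathDensity_eq hπ hθ, hb, zero_mul, zero_div,
      mul_zero, sub_self, abs_zero]
    have : 0 ≤ M.T * L₁ * ‖ϑ - θ'‖ := (abs_nonneg _).trans h1
    positivity
  · simp only [pmWeight, trajDensity_div hπ hθ hϑ hb, trajDensity_div hπ hθ hθ' hb]
    refine (abs_powerMean_exp_sub_le hl hl1 _ _).trans ?_
    refine mul_le_mul_of_nonneg_left ?_ (by positivity)
    rw [sub_sub_sub_cancel_left, abs_sub_comm]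
    exact h1

theorem norm_pmGrad_sub_le (hc : Convex ℝ Θ) (hπ : IsPolicyClass M Θ π)
    (hreg : RegularPolicy Θ π L₁ L₂) (hG : EstimatorBounds M Θ π est G G₂) (hl : 0 < l)
    (hl1 : l ≤ 1) (hθ : θ ∈ Θ) (hϑ : ϑ ∈ Θ) (hθ' : θ' ∈ Θ) (τ : M.Traj) :
    ‖pmGrad M π est l θ ϑ τ - pmGrad M π est l θ θ' τ‖ ≤
      (G * M.T * L₁ + G₂) / l * ‖ϑ - θ'‖ := by
  obtain ⟨h0, h1⟩ := pmWeight_bounds hπ hl hl1 hθ hϑ τ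
  have h2 := norm_singleGrad_sub_le hc hreg hG hϑ hθ' τ
  have h3 := abs_pmWeight_sub_le hc hπ hreg hl hl1 hθ hϑ hθ' τ
  have e : pmGrad M π est l θ ϑ τ - pmGrad M π est l θ θ' τ =
      pmWeight M π l θ ϑ τ • (singleGrad M π est τ ϑ - singleGrad M π est τ θ') +
        (pmWeight M π l θ ϑ τ - pmWeight M π l θ θ' τ) • singleGrad M π est τ θ' := by
    simp only [pmGrad]
    rw [smul_sub, sub_smul]; abel
  rw [e]
  refine (norm_add_le _ _).trans ?_
  rw [norm_smul, norm_smul, Real.norm_eq_abs, Real.norm_eq_abs, abs_of_nonneg h0]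
  calc _ ≤ 1 / l * (G₂ * ‖ϑ - θ'‖) + 1 / l * (M.T * L₁ * ‖ϑ - θ'‖) * G :=
        add_le_add (mul_le_mul h1 h2 (norm_nonneg _) (by positivity))
          (mul_le_mul h3 (hG θ' hθ' τ).1 (norm_nonneg _) ((abs_nonneg _).trans h3))
    _ = _ := by ring

theorem lintegral_chiSq_le (hD : 1 ≤ D) (hchi : BoundedChiSq M Θ π D) (hθ : θ ∈ Θ) (hϑ : ϑ ∈ Θ) :
    ∫⁻ τ, ENNReal.ofReal (M.pathDensity π M.H ϑ τ ^ 2 * (M.pathDensity π M.H θ τ)⁻¹)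
      ∂M.pathRef M.H ≤ ENNReal.ofReal D := by
  have h := hchi ϑ hϑ θ hθ
  rw [chiSq, tsub_le_iff_right, ← ENNReal.ofReal_one, ← ENNReal.ofReal_add (by linarith)
    zero_le_one, sub_add_cancel] at h
  exact h

/-- Integrating `exp_powerMean_le` against `p_θ`: the linear term becomes the exact gradient at `ϑ`
by importance sampling, and `∫ w² p_θ` is at most `D` by the χ² assumption. Thus the quadratic term
is at most `2l²(1 + D) ≤ 4Dl²`. The bound does not depend on the sampling parameter. -/
theorem lintegral_exp_pmGrad_le (hΘ : IsOpen Θ) (hc : Convex ℝ Θ) (hπ : IsPolicyClass M Θ π)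
    (hreg : RegularPolicy Θ π L₁ L₂) (hG0 : 0 < G) (hG : EstimatorBounds M Θ π est G G₂)
    (hD : 1 ≤ D) (hchi : BoundedChiSq M Θ π D) (hl : 0 < l) (hl1 : l ≤ 1) (hθ : θ ∈ Θ)
    (hϑ : ϑ ∈ Θ) {v : Param d} (hv : ‖v‖ ≤ 1)
    (hmeas : Measurable fun τ : M.Traj =>
      ENNReal.ofReal (Real.exp (l / G * inner ℝ v (pmGrad M π est l θ ϑ τ)))) :
    ∫⁻ τ, ENNReal.ofReal (Real.exp (l / G * inner ℝ v (pmGrad M π est l θ ϑ τ)))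
      ∂M.trajLaw π θ ≤
      ENNReal.ofReal (Real.exp (l / G * inner ℝ v (gradient (M.J π) ϑ) + 4 * D * l ^ 2)) := by
  set p := M.pathDensity π M.H θ with hp
  set q := M.pathDensity π M.H ϑ with hq
  have hp0 : ∀ τ, 0 ≤ p τ := pathDensity_nonneg hπ hθ
  have hq0 : ∀ τ, 0 ≤ q τ := pathDensity_nonneg hπ hϑ
  have hpm : Measurable p := measurable_pathDensity hπ hθ
  have hqm : Measurable q := measurable_pathDensity hπ hϑ
  have hgm := measurable_singleGrad (M := M) (est := est) hΘ hπ hreg hϑ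
  have hinner : ∀ τ, |inner ℝ v (singleGrad M π est τ ϑ)| ≤ G := fun τ =>
    (abs_real_inner_le_norm _ _).trans
      ((mul_le_mul hv (hG ϑ hϑ τ).1 (norm_nonneg _) zero_le_one).trans (one_mul G).le)
  have hpi : Integrable p (M.pathRef M.H) := integrable_pathDensity hπ hθ
  have hqi : Integrable q (M.pathRef M.H) := integrable_pathDensity hπ hϑ
  have hqg : Integrable (fun τ => q τ • singleGrad M π est τ ϑ) (M.pathRef M.H) :=
    hqi.smul_bdd G hgm.aestronglyMeasurable (Filter.Eventually.of_forall fun τ => (hG ϑ hϑ τ).1)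
  have hchi2 := lintegral_chiSq_le hD hchi hθ hϑ
  have hw0 : ∀ τ, 0 ≤ q τ ^ 2 * (p τ)⁻¹ := fun τ => mul_nonneg (sq_nonneg _) (inv_nonneg.2 (hp0 τ))
  have hwm : Measurable fun τ => q τ ^ 2 * (p τ)⁻¹ := (hqm.pow_const 2).mul hpm.inv
  have hwi : Integrable (fun τ => q τ ^ 2 * (p τ)⁻¹) (M.pathRef M.H) := by
    refine ⟨hwm.aestronglyMeasurable, ?_⟩
    rw [hasFiniteIntegral_iff_ofReal (Filter.Eventually.of_forall hw0)]
    exact hchi2.trans_lt ENNReal.ofReal_lt_top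
  have hwD : ∫ τ, q τ ^ 2 * (p τ)⁻¹ ∂M.pathRef M.H ≤ D := by
    rw [integral_eq_lintegral_of_nonneg_ae (Filter.Eventually.of_forall hw0)
      hwm.aestronglyMeasurable]
    exact ENNReal.toReal_le_of_le_ofReal (by linarith) hchi2
  -- The scalar bound multiplied by `p`, with `pw` and `pw²` rewritten as `q` and `q²/p`. This form
  -- also makes sense where the densities vanish.
  set R : M.Traj → ℝ := fun τ => (p τ + l / G * inner ℝ v (q τ • singleGrad M π est τ ϑ)) +
    2 * l ^ 2 * (p τ + q τ ^ 2 * (p τ)⁻¹) with hR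
  have hpoint : ∀ τ, p τ * Real.exp (l / G * inner ℝ v (pmGrad M π est l θ ϑ τ)) ≤ R τ := by
    intro τ
    by_cases hb : M.pathBase M.H τ = 0
    · have h1 : p τ = 0 := by rw [hp, pathDensity_eq hπ hθ, hb, zero_mul]
      have h2 : q τ = 0 := by rw [hq, pathDensity_eq hπ hϑ, hb, zero_mul]
      simp [hR, h1, h2]
    · have hbpos := lt_of_le_of_ne (pathBase_nonneg τ) (Ne.symm hb)
      have hppos : 0 < p τ := by rw [hp, pathDensity_eq hπ hθ]; positivity
      have hqpos : 0 < q τ := by rw [hq, pathDensity_eq hπ hϑ]; positivity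
      have h1 := exp_powerMean_le hl hl1 hG0 (hinner τ) (div_pos hqpos hppos)
      have h2 : pmWeight M π l θ ϑ τ = 1 / ((1 - l) * (q τ / p τ)⁻¹ + l) := by
        rw [inv_div]; rfl
      rw [pmGrad, real_inner_smul_right, h2]
      refine (mul_le_mul_of_nonneg_left h1 hppos.le).trans_eq ?_
      simp only [hR, real_inner_smul_right]
      field_simp
  have hRi1 := hpi.add ((hqg.const_inner v).const_mul (l / G))
  have hRi2 := (hpi.add hwi).const_mul (2 * l ^ 2)
  have hRi : Integrable R (M.pathRef M.H) := hRi1.add hRi2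
  have hR0 : ∀ τ, 0 ≤ R τ := fun τ =>
    (mul_nonneg (hp0 τ) (Real.exp_pos _).le).trans (hpoint τ)
  have hgrad : ∫ τ, q τ • singleGrad M π est τ ϑ ∂M.pathRef M.H = gradient (M.J π) ϑ := by
    rw [gradient_J hΘ hc hπ hreg est hϑ, trajLaw_eq_pathLaw, integral_pathLaw hπ hϑ]
  have hRint : ∫ τ, R τ ∂M.pathRef M.H ≤
      1 + l / G * inner ℝ v (gradient (M.J π) ϑ) + 4 * D * l ^ 2 := by
    have e1 : ∫ τ, R τ ∂M.pathRef M.H = (1 + l / G * inner ℝ v (gradient (M.J π) ϑ)) +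
        2 * l ^ 2 * (1 + ∫ τ, q τ ^ 2 * (p τ)⁻¹ ∂M.pathRef M.H) := by
      refine (integral_add hRi1 hRi2).trans ?_
      rw [integral_const_mul]
      congr 1
      · refine (integral_add hpi ((hqg.const_inner v).const_mul (l / G))).trans ?_
        rw [integral_const_mul, integral_inner hqg, hgrad, integral_pathDensity hπ hθ]
      · congr 1
        refine (integral_add hpi hwi).trans ?_
        rw [integral_pathDensity hπ hθ]
    rw [e1]
    nlinarith [sq_nonneg l]
  rw [trajLaw_eq_pathLaw, lintegral_pathLaw hπ hθ hmeas]
  calc _ ≤ ∫⁻ τ, ENNReal.ofReal (R τ) ∂M.pathRef M.H := by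
        refine lintegral_mono fun τ => ?_
        rw [← ENNReal.ofReal_mul (hp0 τ)]
        exact ENNReal.ofReal_le_ofReal (hpoint τ)
    _ = ENNReal.ofReal (∫ τ, R τ ∂M.pathRef M.H) :=
        (ofReal_integral_eq_lintegral_ofReal hRi (Filter.Eventually.of_forall hR0)).symm
    _ ≤ _ := by
        refine ENNReal.ofReal_le_ofReal (hRint.trans ?_)
        have := Real.add_one_le_exp (l / G * inner ℝ v (gradient (M.J π) ϑ) + 4 * D * l ^ 2)
        linarith

end PowerMean

/-! ### Integration over a freshly sampled batch -/

section Sampling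

/-- One supermartingale step. The sampling rule says that `τ` has conditional law `κ (η x)` given
`m`, so integrating `τ` out first leaves a factor of at most one. -/
theorem lintegral_mul_le_of_sample {Ω α Y : Type*} {m : MeasurableSpace Ω} [m₀ : MeasurableSpace Ω]
    [MeasurableSpace α] [MeasurableSpace Y] (hm : m ≤ m₀) (P : Measure Ω) [IsFiniteMeasure P]
    {η : Ω → α} (hη : Measurable[m] η) {τ : Ω → Y} (hτ : Measurable τ) (κ : Kernel α Y)
    [IsMarkovKernel κ]
    (hsample : ∀ F : Set Ω, MeasurableSet[m] F → ∀ B : Set Y, MeasurableSet B →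
      P (F ∩ τ ⁻¹' B) = ∫⁻ x in F, κ (η x) B ∂P)
    {ψ : α → Y → ENNReal} (hψ : Measurable (Function.uncurry ψ))
    (hψ1 : ∀ a, ∫⁻ y, ψ a y ∂κ a ≤ 1) {U : Ω → ENNReal} (hU : Measurable[m] U) :
    ∫⁻ x, U x * ψ (η x) (τ x) ∂P ≤ ∫⁻ x, U x ∂P := by
  -- Carrying `U` along with `η` turns the joint law with `τ` into a composition product, which
  -- replaces the use of conditional expectations.
  set q : Ω → ENNReal × α := fun x => (U x, η x) with hqdef
  have hqm : Measurable[m] q := hU.prodMk hη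
  have hq : Measurable q := hqm.mono hm le_rfl
  have hf : Measurable fun z : (ENNReal × α) × Y => z.1.1 * ψ z.1.2 z.2 :=
    (measurable_fst.comp measurable_fst).mul
      (hψ.comp (f := fun z : (ENNReal × α) × Y => (z.1.2, z.2)) (by fun_prop))
  have hlaw : P.map (fun x => (q x, τ x)) =
      (P.map q) ⊗ₘ (κ.comap (Prod.snd : ENNReal × α → α) measurable_snd) := by
    refine Measure.ext_prod fun {s t} hs ht => ?_
    rw [Measure.map_apply (hq.prodMk hτ) (hs.prod ht), Measure.compProd_apply_prod hs ht,
      setLIntegral_map hs (Kernel.measurable_coe _ ht) hq]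
    exact hsample _ (hqm hs) t ht
  calc ∫⁻ x, U x * ψ (η x) (τ x) ∂P
      = ∫⁻ z, z.1.1 * ψ z.1.2 z.2 ∂P.map (fun x => (q x, τ x)) :=
        (lintegral_map hf (hq.prodMk hτ)).symm
    _ = ∫⁻ a, ∫⁻ y, a.1 * ψ a.2 y ∂κ a.2 ∂P.map q := by
        rw [hlaw, Measure.lintegral_compProd hf]
        rfl
    _ ≤ ∫⁻ a, a.1 ∂P.map q := by
        refine lintegral_mono fun a => ?_
        rw [lintegral_const_mul (f := ψ a.2) _ (hψ.comp measurable_prodMk_left)]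
        exact (mul_le_mul_right (hψ1 a.2) _).trans (mul_one _).le
    _ = ∫⁻ x, U x ∂P := lintegral_map measurable_fst hq

theorem lintegral_pi_prod_le_one {N : ℕ} {X : Type*} [MeasurableSpace X] (μ : Measure X)
    [IsProbabilityMeasure μ] {φ : X → ENNReal} (hφ : Measurable φ) (h : ∫⁻ x, φ x ∂μ ≤ 1) :
    ∫⁻ x : Fin N → X, ∏ j, φ (x j) ∂Measure.pi (fun _ => μ) ≤ 1 := by
  have hind := iIndepFun_pi (ι := Fin N) (μ := fun _ => μ) (X := fun _ => φ)
    fun _ => hφ.aemeasurable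
  have := lintegral_prod_eq_prod_lintegral_of_indepFun Finset.univ _ hind
    fun j => hφ.comp (measurable_pi_apply j)
  rw [this]
  refine Finset.prod_le_one' fun j _ => ?_
  rw [(measurePreserving_eval (fun _ : Fin N => μ) j).lintegral_comp hφ]
  exact h

end Sampling

/-! ### Joint measurability and the batch kernel -/

section TrajKernel

variable {S : Type u} {A : Type v} [MeasurableSpace S] [MeasurableSpace A] {d : ℕ}
  {M : MDP S A} {π : Param d → S → A → ℝ} {Θ : Set (Param d)} {ϑ : Param d}
  {L₁ L₂ l : ℝ} {est : GradEstimator}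

open MDP

/-- A Carathéodory function: continuous in the parameter, because `log π` is differentiable there,
and measurable in the state-action pair. -/
theorem measurable_uncurry_policy (hπ : IsPolicyClass M Θ π) (hreg : RegularPolicy Θ π L₁ L₂) :
    Measurable fun p : Θ × S × A => π p.1 p.2.1 p.2.2 := by
  refine measurable_uncurry_of_continuous_of_measurable
    (u := fun (θ : Θ) (x : S × A) => π θ x.1 x.2) (fun x => ?_) (fun θ => hπ.measurable θ θ.2)
  have h1 : Continuous fun θ : Θ => Real.log (π θ x.1 x.2) := by
    rw [continuous_iff_continuousAt]
    intro θ
    exact (hreg.differentiableAt θ θ.2 x.1 x.2).continuousAt.comp continuous_subtype_val.continuousAt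
  have h2 : (fun θ : Θ => π θ x.1 x.2) = fun θ : Θ => Real.exp (Real.log (π θ x.1 x.2)) :=
    funext fun θ => (Real.exp_log (hπ.pos θ θ.2 _ _)).symm
  rw [h2]
  exact Real.continuous_exp.comp h1

theorem measurable_uncurry_trajDensity (hπ : IsPolicyClass M Θ π)
    (hreg : RegularPolicy Θ π L₁ L₂) :
    Measurable fun p : Θ × M.Traj => M.trajDensity π p.1 p.2 := by
  have : (fun p : Θ × M.Traj => M.trajDensity π p.1 p.2) = fun p =>
      M.pathBase M.H p.2 * ∏ t, π p.1 (p.2 t).1 (p.2 t).2 := by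
    funext p; rw [trajDensity, pathBase]; ring
  rw [this]
  refine (measurable_pathBase.comp measurable_snd).mul (Finset.measurable_fun_prod _ fun t _ => ?_)
  exact (measurable_uncurry_policy hπ hreg).comp (f := fun p : Θ × M.Traj => (p.1, p.2 t))
    (by fun_prop)

theorem measurable_uncurry_pmGrad (hΘ : IsOpen Θ) (hπ : IsPolicyClass M Θ π)
    (hreg : RegularPolicy Θ π L₁ L₂) (hϑ : ϑ ∈ Θ) :
    Measurable fun p : Θ × M.Traj => pmGrad M π est l p.1 ϑ p.2 := by
  refine Measurable.smul (f := fun p : Θ × M.Traj => pmWeight M π l p.1 ϑ p.2)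
    (g := fun p : Θ × M.Traj => singleGrad M π est p.2 ϑ) ?_ ((measurable_singleGrad hΘ hπ hreg hϑ).comp measurable_snd)
  refine measurable_const.div (((Measurable.div (measurable_uncurry_trajDensity hπ hreg) ?_).const_mul
    _).add_const _)
  exact (measurable_pathDensity (n := M.H) hπ hϑ).comp measurable_snd

theorem measurable_trajLaw (hπ : IsPolicyClass M Θ π) (hreg : RegularPolicy Θ π L₁ L₂) :
    Measurable fun θ : Θ => M.trajLaw π θ := by
  refine Measure.measurable_of_measurable_coe _ fun B hB => ?_
  simp only [trajLaw_eq_pathLaw, pathLaw, withDensity_apply _ hB]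
  exact (measurable_uncurry_trajDensity hπ hreg).ennreal_ofReal.lintegral_prod_right'

theorem measurable_pi_trajLaw (hπ : IsPolicyClass M Θ π) (hreg : RegularPolicy Θ π L₁ L₂)
    (N : ℕ) : Measurable fun θ : Θ => Measure.pi fun _ : Fin N => M.trajLaw π θ := by
  have hp : ∀ θ : Θ, IsProbabilityMeasure (M.trajLaw π θ) := fun θ =>
    isProbabilityMeasure_trajLaw hπ θ.2
  refine Measurable.measure_of_isPiSystem_of_isProbabilityMeasure generateFrom_pi.symm isPiSystem_pi ?_
  rintro _ ⟨B, hB, rfl⟩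
  simp only [Measure.pi_pi]
  exact Finset.measurable_fun_prod _ fun j _ =>
    (Measure.measurable_coe (s := B j) (hB j (Set.mem_univ _))).comp (measurable_trajLaw hπ hreg)

/-- The law of a batch of `N` independent trajectories, as a kernel from the parameters. -/
def batchKernel (hπ : IsPolicyClass M Θ π) (hreg : RegularPolicy Θ π L₁ L₂) (N : ℕ) :
    Kernel Θ (Fin N → M.Traj) :=
  ⟨fun θ => Measure.pi fun _ : Fin N => M.trajLaw π θ, measurable_pi_trajLaw hπ hreg N⟩

theorem batchKernel_apply (hπ : IsPolicyClass M Θ π) (hreg : RegularPolicy Θ π L₁ L₂) (N : ℕ)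
    (θ : Θ) : batchKernel hπ hreg N θ = Measure.pi fun _ : Fin N => M.trajLaw π θ := rfl

instance (hπ : IsPolicyClass M Θ π) (hreg : RegularPolicy Θ π L₁ L₂) (N : ℕ) :
    IsMarkovKernel (batchKernel hπ hreg N) :=
  ⟨fun θ => by
    have := isProbabilityMeasure_trajLaw (M := M) hπ θ.2
    rw [batchKernel_apply]; infer_instance⟩

end TrajKernel

/-! ### The filtration of the algorithm -/

section History

variable {Ω X Y : Type*} [MeasurableSpace X] [MeasurableSpace Y] {θ : ℕ → Ω → X} {τ : ℕ → Ω → Y}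

theorem history_mono {m n : ℕ} (h : m ≤ n) : history θ τ m ≤ history θ τ n :=
  sup_le_sup (biSup_mono fun _ hi => Finset.Icc_subset_Icc_right h hi)
    (biSup_mono fun _ hi => Finset.Ico_subset_Ico_right h hi)

theorem measurable_history_left {i n : ℕ} (hi : 1 ≤ i) (hin : i ≤ n) :
    Measurable[history θ τ n] (θ i) :=
  Measurable.of_comap_le ((le_biSup (fun i => MeasurableSpace.comap (θ i) inferInstance)
    (Finset.mem_Icc.2 ⟨hi, hin⟩)).trans le_sup_left)

theorem measurable_history_right {i n : ℕ} (hi : 1 ≤ i) (hin : i < n) :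
    Measurable[history θ τ n] (τ i) :=
  Measurable.of_comap_le ((le_biSup (fun i => MeasurableSpace.comap (τ i) inferInstance)
    (Finset.mem_Ico.2 ⟨hi, hin⟩)).trans le_sup_right)

theorem history_le [m₀ : MeasurableSpace Ω] (hθ : ∀ k, Measurable (θ k))
    (hτ : ∀ k, Measurable (τ k)) (n : ℕ) : history θ τ n ≤ m₀ :=
  sup_le (iSup₂_le fun i _ => (hθ i).comap_le) (iSup₂_le fun i _ => (hτ i).comap_le)

end History

/-! ### Products of conditional bounds along a run -/

section Run

open Classical in
/-- The element `x` of `Θ`, or a default value if `x ∉ Θ`. -/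
def toSet {X : Type*} {Θ : Set X} (θ₁ : Θ) (x : X) : Θ := if h : x ∈ Θ then ⟨x, h⟩ else θ₁

theorem toSet_of_mem {X : Type*} {Θ : Set X} (θ₁ : Θ) {x : X} (h : x ∈ Θ) :
    toSet θ₁ x = ⟨x, h⟩ := dif_pos h

theorem measurable_toSet {X : Type*} [MeasurableSpace X] {Θ : Set X} (hΘ : MeasurableSet Θ)
    (θ₁ : Θ) : Measurable (toSet θ₁) := by
  classical
  exact Measurable.dite (s := Θ) measurable_id measurable_const hΘ

variable {S : Type u} {A : Type v} [MeasurableSpace S] [MeasurableSpace A] {d : ℕ}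
  {M : MDP S A} {π : Param d → S → A → ℝ} {Θ : Set (Param d)} {est : GradEstimator}
  {L₁ L₂ D B ζ : ℝ} {N K ω : ℕ} {Ω : Type w} [MeasurableSpace Ω] {P : Measure Ω}
  [IsProbabilityMeasure P] {θ : ℕ → Ω → Param d} {τ : ℕ → Ω → Fin N → M.Traj} {I : Ω → ℕ}

/-- The last batch is peeled off repeatedly: the remaining factors and its sampling parameter are
known from the history. This needs `φ` to be deterministic, which is why the random target `θ_k`
must be replaced by net points. The factor `h` may use the iterate at the start of the window. -/
theorem IsRPGRun.lintegral_mul_prod_le {θ₁ : Param d} (hθ₁ : θ₁ ∈ Θ) (hΘ : IsOpen Θ)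
    (hπ : IsPolicyClass M Θ π) (hreg : RegularPolicy Θ π L₁ L₂)
    (hrun : IsRPGRun M Θ π est D B ζ θ₁ N K ω P θ τ I)
    {φ : Θ → M.Traj → ENNReal} (hφ : Measurable (Function.uncurry φ))
    (hφ1 : ∀ a : Θ, ∫⁻ y, φ a y ∂M.trajLaw π a ≤ 1) {m n : ℕ} (hm : 1 ≤ m) (hmn : m ≤ n)
    (hn : n ≤ K + 1) {h : Ω → ENNReal} (hh : Measurable[history θ τ m] h) :
    ∫⁻ x, h x * ∏ i ∈ Finset.Ico m n, ∏ j, φ (toSet ⟨θ₁, hθ₁⟩ (θ i x)) (τ i x j) ∂P ≤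
      ∫⁻ x, h x ∂P := by
  induction n, hmn using Nat.le_induction with
  | base => simp
  | succ n hmn ih =>
    refine le_trans ?_ (ih (by omega))
    have hproj := measurable_toSet hΘ.measurableSet (⟨θ₁, hθ₁⟩ : Θ)
    have hm1 : 1 ≤ n := hm.trans hmn
    have hnK : n ∈ Finset.Icc 1 K := Finset.mem_Icc.2 ⟨hm1, by omega⟩
    have hU : Measurable[history θ τ n] fun x => h x * ∏ i ∈ Finset.Ico m n, ∏ j,
        φ (toSet ⟨θ₁, hθ₁⟩ (θ i x)) (τ i x j) := by
      refine Measurable.mul (hh.mono (history_mono hmn) le_rfl) ?_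
      refine Finset.measurable_fun_prod _ fun i hi => Finset.measurable_fun_prod _ fun j _ => ?_
      rw [Finset.mem_Ico] at hi
      have h1 := measurable_history_left (θ := θ) (τ := τ) (hm.trans hi.1) hi.2.le
      have h2 := measurable_history_right (θ := θ) (τ := τ) (hm.trans hi.1) hi.2
      exact hφ.comp ((hproj.comp h1).prodMk ((measurable_pi_apply j).comp h2))
    have hψ : Measurable (Function.uncurry fun (a : Θ) (y : Fin N → M.Traj) => ∏ j, φ a (y j)) :=
      Finset.measurable_fun_prod _ fun j _ => hφ.comp
        (f := fun z : Θ × (Fin N → M.Traj) => (z.1, z.2 j)) (by fun_prop)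
    have key := lintegral_mul_le_of_sample
      (history_le hrun.measurable_θ hrun.measurable_τ n) P
      (hproj.comp (measurable_history_left (θ := θ) (τ := τ) hm1 le_rfl)) (hrun.measurable_τ n)
      (batchKernel hπ hreg N) (fun F hF B hB => ?_) hψ (fun a => ?_) hU
    · refine le_trans (le_of_eq (lintegral_congr fun x => ?_)) key
      rw [Finset.prod_Ico_succ_top hmn, mul_assoc]
      rfl
    · rw [hrun.sample n hnK F hF B hB]
      refine lintegral_congr_ae (ae_restrict_of_ae ?_)
      filter_upwards [hrun.mem] with x hx
      rw [Function.comp_apply, toSet_of_mem _ (hx n (Finset.mem_Icc.2 ⟨hm1, by omega⟩))]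
      rfl
    · have := isProbabilityMeasure_trajLaw (M := M) hπ a.2
      exact lintegral_pi_prod_le_one _ (hφ.comp measurable_prodMk_left) (hφ1 a)

end Run

/-! ### What the choice of `λ_k` and `δ_k` achieves -/

section Coefficients

variable {d N ω k : ℕ} {D B ζ G : ℝ}

/-- The argument of the logarithm in the coefficient `lamCoef`, minus `6`. -/
def lamArg (d : ℕ) (D B ζ : ℝ) (N ω k : ℕ) : ℝ :=
  B * (1 + Real.sqrt (3 / 4 * D * N * win ω k)) *
      (3 * Real.sqrt 3 * ζ * (win ω k : ℝ) ^ 2 * N / (4 * Real.sqrt d))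

theorem one_le_win (hω : 1 ≤ ω) (hk : 1 ≤ k) : 1 ≤ win ω k := le_min hω hk

theorem win_le_right : win ω k ≤ k := min_le_right _ _

theorem lamArg_nonneg (hB : 0 ≤ B) (hζ : 0 ≤ ζ) : 0 ≤ lamArg d D B ζ N ω k := by
  unfold lamArg; positivity

theorem one_le_log_six : 1 ≤ Real.log 6 := by
  rw [Real.le_log_iff_exp_le (by norm_num)]
  linarith [Real.exp_one_lt_d9]

theorem one_le_log_lamArg (hB : 0 ≤ B) (hζ : 0 ≤ ζ) :
    1 ≤ Real.log (6 + lamArg d D B ζ N ω k) :=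
  one_le_log_six.trans (Real.log_le_log (by norm_num)
    (by linarith [lamArg_nonneg (d := d) (D := D) (N := N) (ω := ω) (k := k) hB hζ]))

theorem one_le_mul_win (hN : 1 ≤ N) (hω : 1 ≤ ω) (hk : 1 ≤ k) :
    (1 : ℝ) ≤ (N : ℝ) * win ω k := by
  have : 1 ≤ N * win ω k := Nat.one_le_iff_ne_zero.2
    (Nat.mul_ne_zero (by omega) (by have := one_le_win hω hk; omega))
  exact_mod_cast this

theorem lamCoef_nonneg : 0 ≤ lamCoef d D B ζ N ω k := Real.sqrt_nonneg _

/-- The quantity `D n λ²` with `n = N ω_k` is the scale of all tail exponents. The two summands pay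
for the covering number and for the confidence level, since `log (1/δ_k) = 2 log n`. -/
theorem mul_lamCoef_sq (hD : 1 ≤ D) (hB : 0 ≤ B) (hζ : 0 ≤ ζ) (hN : 1 ≤ N) (hω : 1 ≤ ω)
    (hk : 1 ≤ k) :
    D * ((N : ℝ) * win ω k) * lamCoef d D B ζ N ω k ^ 2 =
      4 / 3 * (d * Real.log (6 + lamArg d D B ζ N ω k) + 2 * Real.log ((N : ℝ) * win ω k)) := by
  have hn := one_le_mul_win hN hω hk
  have h1 := one_le_log_lamArg (d := d) (D := D) (N := N) (ω := ω) (k := k) hB hζ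
  have h2 : Real.log (1 / deltaCoef N ω k) = 2 * Real.log ((N : ℝ) * win ω k) := by
    rw [deltaCoef, one_div_one_div, ← mul_pow, Real.log_pow]; norm_num
  have h3 := Real.log_nonneg hn
  rw [lamCoef, Real.sq_sqrt]
  · rw [h2, ← lamArg]
    set n := (N : ℝ) * win ω k with hndef
    have hD0 : D ≠ 0 := by positivity
    have hn0 : n ≠ 0 := by positivity
    rw [show 3 * D * N * (win ω k : ℝ) = 3 * D * n by rw [hndef]; ring]
    field_simp
  · rw [h2, ← lamArg]
    positivity

theorem le_mul_lamCoef_sq (hD : 1 ≤ D) (hB : 0 ≤ B) (hζ : 0 ≤ ζ) (hN : 1 ≤ N) (hω : 1 ≤ ω)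
    (hk : 1 ≤ k) :
    4 / 3 * (d : ℝ) ≤ D * ((N : ℝ) * win ω k) * lamCoef d D B ζ N ω k ^ 2 := by
  rw [mul_lamCoef_sq hD hB hζ hN hω hk]
  have h1 := one_le_log_lamArg (d := d) (D := D) (N := N) (ω := ω) (k := k) hB hζ
  have h3 := Real.log_nonneg (one_le_mul_win hN hω hk)
  nlinarith [mul_le_mul_of_nonneg_left h1 (Nat.cast_nonneg (α := ℝ) d)]

theorem lamCoef_pos (hd : 1 ≤ d) (hD : 1 ≤ D) (hB : 0 ≤ B) (hζ : 0 ≤ ζ) (hN : 1 ≤ N)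
    (hω : 1 ≤ ω) (hk : 1 ≤ k) : 0 < lamCoef d D B ζ N ω k := by
  have h1 := le_mul_lamCoef_sq (d := d) hD hB hζ hN hω hk
  have hd' : (1 : ℝ) ≤ d := by exact_mod_cast hd
  refine lt_of_le_of_ne lamCoef_nonneg fun h => ?_
  rw [← h] at h1
  norm_num at h1
  linarith

theorem inv_lamCoef_le (hd : 1 ≤ d) (hD : 1 ≤ D) (hB : 0 ≤ B) (hζ : 0 ≤ ζ) (hN : 1 ≤ N)
    (hω : 1 ≤ ω) (hk : 1 ≤ k) {W : ℕ} (hW : win ω k ≤ W) :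
    1 / lamCoef d D B ζ N ω k ≤ Real.sqrt (3 * D * ((N : ℝ) * W) / (4 * d)) := by
  have h1 := le_mul_lamCoef_sq (d := d) hD hB hζ hN hω hk
  have h2 := lamCoef_pos hd hD hB hζ hN hω hk
  have hd' : (1 : ℝ) ≤ d := by exact_mod_cast hd
  have hW' : (win ω k : ℝ) ≤ W := by exact_mod_cast hW
  apply Real.le_sqrt_of_sq_le
  rw [div_pow, one_pow, div_le_div_iff₀ (by positivity) (by positivity)]
  have h3 : D * ((N : ℝ) * win ω k) * lamCoef d D B ζ N ω k ^ 2 ≤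
      D * ((N : ℝ) * W) * lamCoef d D B ζ N ω k ^ 2 := by gcongr
  linarith

/-- The logarithm inside `λ_k` was designed for this ratio of drift radius `r` to mesh `η`. Bounding
one factor `1/λ` in `r/η` by `√(3Dn/4)` and the other by `√(3Dn/(4d))` gives `r/η ≤ lamArg`, so the
left-hand side is at most `3 + 2 lamArg`. -/
theorem covering_ratio_le (hd : 1 ≤ d) (hD : 1 ≤ D) (hB : 0 < B) (hζ : 0 < ζ) (hG : 0 < G)
    (hN : 1 ≤ N) (hω : 1 ≤ ω) (hk : 1 ≤ k) {r η : ℝ}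
    (hr : r = ζ * win ω k * G * Real.sqrt (3 * D * ((N : ℝ) * win ω k) / (4 * d)))
    (hη : η = G * D * lamCoef d D B ζ N ω k / (B * (1 + 1 / lamCoef d D B ζ N ω k))) :
    1 + 2 * (r + η) / η ≤ (6 + lamArg d D B ζ N ω k) ^ 2 := by
  set l := lamCoef d D B ζ N ω k with hl
  have hl0 : 0 < l := lamCoef_pos hd hD hB.le hζ.le hN hω hk
  have hlq := inv_lamCoef_le (B := B) (ζ := ζ) hd hD hB.le hζ.le hN hω hk le_rfl
  rw [← hl] at hlq
  set q := Real.sqrt (3 * D * ((N : ℝ) * win ω k) / (4 * d)) with hq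
  have hd' : (1 : ℝ) ≤ d := by exact_mod_cast hd
  have hn := one_le_mul_win hN hω hk
  have hA := lamArg_nonneg (d := d) (D := D) (N := N) (ω := ω) (k := k) hB.le hζ.le
  have hW : (0 : ℝ) ≤ win ω k := Nat.cast_nonneg _
  have hq0 : 0 ≤ q := Real.sqrt_nonneg _
  have hqs : q ≤ Real.sqrt (3 / 4 * D * N * win ω k) := by
    refine Real.sqrt_le_sqrt ?_
    rw [div_le_iff₀ (by positivity)]
    have : 0 ≤ 3 * D * ((N : ℝ) * win ω k) := by positivity
    nlinarith
  set s := Real.sqrt (3 / 4 * D * N * win ω k) with hs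
  have hs0 : 0 ≤ s := Real.sqrt_nonneg _
  have hqq : q * q = 3 * D * ((N : ℝ) * win ω k) / (4 * d) := Real.mul_self_sqrt (by positivity)
  have hη0 : 0 < η := by rw [hη]; positivity
  have e1 : 1 + 2 * (r + η) / η = 3 + 2 * (r / η) := by field_simp; ring
  have e2 : r / η = ζ * win ω k * B * (1 + 1 / l) * (q * (1 / l)) / D := by
    rw [hr, hη]; field_simp
  have e3 : r / η ≤ ζ * win ω k * B * (1 + s) * (q * q) / D := by
    rw [e2]; gcongr; exact hlq.trans hqs
  have e4 : ζ * win ω k * B * (1 + s) * (q * q) / D =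
      B * (1 + s) * (ζ * (win ω k : ℝ) ^ 2 * N) * (3 / 4) / d := by
    rw [hqq]; field_simp
  have hsd1 : 1 ≤ Real.sqrt d := Real.one_le_sqrt.2 hd'
  have hsd : Real.sqrt d ≤ d := by
    rw [Real.sqrt_le_left (by linarith)]; nlinarith
  have h3 : 1 ≤ Real.sqrt 3 := Real.one_le_sqrt.2 (by norm_num)
  have e5 : B * (1 + s) * (ζ * (win ω k : ℝ) ^ 2 * N) * (3 / 4) / d ≤ lamArg d D B ζ N ω k := by
    rw [lamArg, ← hs]
    calc _ ≤ B * (1 + s) * (ζ * (win ω k : ℝ) ^ 2 * N) * (3 / 4 * Real.sqrt 3) / Real.sqrt d := by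
          gcongr; linarith
      _ = _ := by field_simp
  rw [e1]
  nlinarith

/-- A union bound over both nets. Their sizes together are at most `(6 + lamArg)^(3d)`, while the
exponential supplies `(6 + lamArg)^(-4d)` and `n⁻⁸`. -/
theorem covering_mul_exp_le (hd : 1 ≤ d) (hD : 1 ≤ D) (hB : 0 < B) (hζ : 0 < ζ)
    (hN : 1 ≤ N) (hω : 1 ≤ ω) (hk : 1 ≤ k) {ρ : ℝ} (hρ0 : 0 ≤ ρ)
    (hρ : ρ ≤ (6 + lamArg d D B ζ N ω k) ^ 2) :
    Real.exp (-(3 * (D * ((N : ℝ) * win ω k) * lamCoef d D B ζ N ω k ^ 2))) * (ρ ^ d * 5 ^ d) ≤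
      1 / ((N : ℝ) * win ω k) ^ 2 := by
  have hn := one_le_mul_win hN hω hk
  have hA := lamArg_nonneg (d := d) (D := D) (N := N) (ω := ω) (k := k) hB.le hζ.le
  rw [mul_lamCoef_sq hD hB.le hζ.le hN hω hk]
  set A := lamArg d D B ζ N ω k
  set n := (N : ℝ) * win ω k
  have h1 := one_le_log_lamArg (d := d) (D := D) (N := N) (ω := ω) (k := k) hB.le hζ.le
  have h2 := Real.log_nonneg hn
  have h3 : ρ ^ d * 5 ^ d ≤ Real.exp (3 * (d * Real.log (6 + A))) := by
    calc ρ ^ d * 5 ^ d ≤ ((6 + A) ^ 2) ^ d * (6 + A) ^ d := by gcongr; linarith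
      _ = (6 + A) ^ (3 * d) := by rw [← pow_mul, ← pow_add]; ring_nf
      _ = Real.exp (3 * (d * Real.log (6 + A))) := by
        rw [← Real.rpow_natCast, Real.rpow_def_of_pos (by linarith)]
        push_cast; ring_nf
  have h4 : 1 / n ^ 2 = Real.exp (-(2 * Real.log n)) := by
    rw [Real.exp_neg, ← Real.log_rpow (by linarith), Real.exp_log (by positivity), one_div]
    norm_num
  rw [h4]
  calc _ ≤ Real.exp (-(3 * (4 / 3 * (d * Real.log (6 + A) + 2 * Real.log n)))) *
        Real.exp (3 * (d * Real.log (6 + A))) := by gcongr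
    _ ≤ _ := by
      rw [← Real.exp_add]
      refine Real.exp_le_exp.2 ?_
      have : 0 ≤ d * Real.log (6 + A) := by positivity
      linarith

/-- The bad event contributes the crude bound `(2G/λ)²` times its weight `n⁻²`. This is of the same
order as the good event because `D n λ² ≥ 1`. -/
theorem sq_div_lamCoef_le (hd : 1 ≤ d) (hD : 1 ≤ D) (hB : 0 < B) (hζ : 0 < ζ)
    (hN : 1 ≤ N) (hω : 1 ≤ ω) (hk : 1 ≤ k) :
    (2 * G / lamCoef d D B ζ N ω k) ^ 2 * (1 / ((N : ℝ) * win ω k) ^ 2) ≤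
      4 * (G * D * lamCoef d D B ζ N ω k) ^ 2 := by
  have hn := one_le_mul_win hN hω hk
  have h1 := le_mul_lamCoef_sq (d := d) hD hB.le hζ.le hN hω hk
  have h2 := lamCoef_pos hd hD hB.le hζ.le hN hω hk
  set l := lamCoef d D B ζ N ω k
  set n := (N : ℝ) * win ω k
  have hd' : (1 : ℝ) ≤ d := by exact_mod_cast hd
  have h3 : 1 ≤ D * n * l ^ 2 := by linarith
  have h4 : 1 ≤ (D * n * l ^ 2) ^ 2 := one_le_pow₀ h3
  have e : (2 * G / l) ^ 2 * (1 / n ^ 2) = 4 * G ^ 2 * 1 / (l ^ 2 * n ^ 2) := by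
    field_simp; ring
  rw [e, div_le_iff₀ (by positivity)]
  calc 4 * G ^ 2 * 1 ≤ 4 * G ^ 2 * (D * n * l ^ 2) ^ 2 := by gcongr
    _ = _ := by ring

end Coefficients

/-! ### Window averages and their exponential weights -/

section IterationError

variable {S : Type u} {A : Type v} [MeasurableSpace S] [MeasurableSpace A] {d : ℕ}
  {M : MDP S A} {π : Param d → S → A → ℝ} {Θ : Set (Param d)} {est : GradEstimator}
  {L₁ L₂ G G₂ D B ζ l : ℝ} {N K ω k : ℕ} {ϑ ϑ' : Param d}

theorem Icc_win_eq :
    Finset.Icc (k - win ω k + 1) k = Finset.Ico (k - win ω k + 1) (k + 1) := by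
  ext i; simp only [Finset.mem_Icc, Finset.mem_Ico]; omega

theorem card_Icc_win : (Finset.Icc (k - win ω k + 1) k).card = win ω k := by
  have := win_le_right (ω := ω) (k := k)
  rw [Nat.card_Icc]; omega

theorem mpm_eq (θs : ℕ → Param d) (τs : ℕ → Fin N → M.Traj) (ϑ : Param d) :
    mpm M π est ω k (fun _ => alphaCoef ω k) (fun _ => l) θs τs ϑ =
      ((N : ℝ) * win ω k)⁻¹ • ∑ i ∈ Finset.Icc (k - win ω k + 1) k, ∑ j,
        pmGrad M π est l (θs i) ϑ (τs i j) := by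
  rw [mpm, Finset.smul_sum]
  refine Finset.sum_congr rfl fun i _ => ?_
  rw [Finset.smul_sum, Finset.smul_sum]
  refine Finset.sum_congr rfl fun j _ => ?_
  rw [pmGrad, pmWeight, smul_smul, smul_smul]
  congr 1
  rw [alphaCoef, mul_inv]
  ring

theorem norm_sum_window_le {E : Type*} [SeminormedAddCommGroup E] {f : ℕ → Fin N → E} {c : ℝ}
    (h : ∀ i ∈ Finset.Icc (k - win ω k + 1) k, ∀ j, ‖f i j‖ ≤ c) :
    ‖∑ i ∈ Finset.Icc (k - win ω k + 1) k, ∑ j, f i j‖ ≤ (N : ℝ) * win ω k * c := by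
  refine (norm_sum_le_of_le _ (n := fun _ => (N : ℝ) * c) fun i hi => ?_).trans ?_
  · exact (norm_sum_le_of_le _ fun j _ => h i hi j).trans (by simp)
  · rw [Finset.sum_const, card_Icc_win, nsmul_eq_mul]
    linarith

theorem norm_mpm_le (hπ : IsPolicyClass M Θ π) (hG : EstimatorBounds M Θ π est G G₂)
    (hl : 0 < l) (hl1 : l ≤ 1) (hN : 1 ≤ N) (hω : 1 ≤ ω) (hk : 1 ≤ k) {θs : ℕ → Param d}
    (hθs : ∀ i ∈ Finset.Icc 1 k, θs i ∈ Θ) (τs : ℕ → Fin N → M.Traj) (hϑ : ϑ ∈ Θ) :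
    ‖mpm M π est ω k (fun _ => alphaCoef ω k) (fun _ => l) θs τs ϑ‖ ≤ G / l := by
  have hn := one_le_mul_win hN hω hk
  rw [mpm_eq, norm_smul, norm_inv, Real.norm_eq_abs, abs_of_pos (by linarith),
    inv_mul_le_iff₀ (by linarith)]
  refine norm_sum_window_le fun i hi j => norm_pmGrad_le hπ hG hl hl1 (hθs i ?_) hϑ _
  rw [Finset.mem_Icc] at hi ⊢
  omega

theorem norm_mpm_sub_le (hc : Convex ℝ Θ) (hπ : IsPolicyClass M Θ π)
    (hreg : RegularPolicy Θ π L₁ L₂) (hG : EstimatorBounds M Θ π est G G₂)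
    (hl : 0 < l) (hl1 : l ≤ 1) (hN : 1 ≤ N) (hω : 1 ≤ ω) (hk : 1 ≤ k) {θs : ℕ → Param d}
    (hθs : ∀ i ∈ Finset.Icc 1 k, θs i ∈ Θ) (τs : ℕ → Fin N → M.Traj) (hϑ : ϑ ∈ Θ)
    (hϑ' : ϑ' ∈ Θ) :
    ‖mpm M π est ω k (fun _ => alphaCoef ω k) (fun _ => l) θs τs ϑ -
      mpm M π est ω k (fun _ => alphaCoef ω k) (fun _ => l) θs τs ϑ'‖ ≤
      (G * M.T * L₁ + G₂) / l * ‖ϑ - ϑ'‖ := by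
  have hn := one_le_mul_win hN hω hk
  rw [mpm_eq, mpm_eq, ← smul_sub, norm_smul, norm_inv, Real.norm_eq_abs, abs_of_pos (by linarith),
    inv_mul_le_iff₀ (by linarith), ← Finset.sum_sub_distrib]
  simp only [← Finset.sum_sub_distrib]
  refine norm_sum_window_le fun i hi j =>
    norm_pmGrad_sub_le hc hπ hreg hG hl hl1 (hθs i ?_) hϑ hϑ' _
  rw [Finset.mem_Icc] at hi ⊢
  omega

/-- The exponential weight whose conditional mean is at most one. -/
def expWeight (M : MDP S A) (π : Param d → S → A → ℝ) (est : GradEstimator) (G D l : ℝ)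
    (v ϑ : Param d) (θ : Param d) (τ : M.Traj) : ENNReal :=
  ENNReal.ofReal (Real.exp (l / G * inner ℝ v (pmGrad M π est l θ ϑ τ - gradient (M.J π) ϑ) -
    4 * D * l ^ 2))

theorem measurable_expWeight (hΘ : IsOpen Θ) (hπ : IsPolicyClass M Θ π)
    (hreg : RegularPolicy Θ π L₁ L₂) (v : Param d) (hϑ : ϑ ∈ Θ) :
    Measurable (Function.uncurry fun (θ : Θ) (τ : M.Traj) =>
      expWeight M π est G D l v ϑ θ τ) := by
  have h := measurable_uncurry_pmGrad (est := est) (l := l) hΘ hπ hreg hϑ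
  exact ((((measurable_const.inner (h.sub_const _)).const_mul _).sub_const _).exp).ennreal_ofReal

theorem lintegral_expWeight_le (hΘ : IsOpen Θ) (hc : Convex ℝ Θ) (hπ : IsPolicyClass M Θ π)
    (hreg : RegularPolicy Θ π L₁ L₂) (hG0 : 0 < G) (hG : EstimatorBounds M Θ π est G G₂)
    (hD : 1 ≤ D) (hchi : BoundedChiSq M Θ π D) (hl : 0 < l) (hl1 : l ≤ 1)
    (hϑ : ϑ ∈ Θ) {v : Param d} (hv : ‖v‖ ≤ 1) (θ : Θ) :
    ∫⁻ τ, expWeight M π est G D l v ϑ θ τ ∂M.trajLaw π θ ≤ 1 := by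
  set b := l / G * inner ℝ v (gradient (M.J π) ϑ) + 4 * D * l ^ 2 with hb
  have h := (measurable_uncurry_pmGrad (M := M) (est := est) (l := l) hΘ hπ hreg hϑ).comp
    (measurable_prodMk_left (x := θ))
  have hm : Measurable fun τ : M.Traj =>
      ENNReal.ofReal (Real.exp (l / G * inner ℝ v (pmGrad M π est l θ ϑ τ))) :=
    ((measurable_const.inner h).const_mul _).exp.ennreal_ofReal
  have key := lintegral_exp_pmGrad_le hΘ hc hπ hreg hG0 hG hD hchi hl hl1 θ.2 hϑ hv hm
  rw [← hb] at key
  have e : ∀ τ, expWeight M π est G D l v ϑ θ τ =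
      ENNReal.ofReal (Real.exp (-b)) *
        ENNReal.ofReal (Real.exp (l / G * inner ℝ v (pmGrad M π est l θ ϑ τ))) := by
    intro τ
    rw [expWeight, ← ENNReal.ofReal_mul (Real.exp_pos _).le, ← Real.exp_add, inner_sub_right, hb]
    congr 2
    ring
  simp only [e]
  rw [lintegral_const_mul _ hm]
  refine (mul_le_mul_right key _).trans ?_
  rw [← ENNReal.ofReal_mul (Real.exp_pos _).le, ← Real.exp_add]
  simp

/-- The estimator is a plain average over the `N ω_k` trajectories of the window, because all of
them share the same `α` and `λ`. The exponents therefore add up to its error. -/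
theorem prod_expWeight (hN : 1 ≤ N) (hω : 1 ≤ ω) (hk : 1 ≤ k) (v : Param d)
    (θs : ℕ → Param d) (τs : ℕ → Fin N → M.Traj) :
    ∏ i ∈ Finset.Icc (k - win ω k + 1) k, ∏ j, expWeight M π est G D l v ϑ (θs i) (τs i j) =
      ENNReal.ofReal (Real.exp (l / G * ((N : ℝ) * win ω k) * inner ℝ v
        (mpm M π est ω k (fun _ => alphaCoef ω k) (fun _ => l) θs τs ϑ - gradient (M.J π) ϑ) -
        4 * (D * ((N : ℝ) * win ω k) * l ^ 2))) := by
  have hn := one_le_mul_win hN hω hk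
  simp only [expWeight]
  rw [Finset.prod_congr rfl fun i _ =>
    (ENNReal.ofReal_prod_of_nonneg fun j _ => (Real.exp_pos _).le).symm,
    ← ENNReal.ofReal_prod_of_nonneg fun i _ => Finset.prod_nonneg fun j _ => (Real.exp_pos _).le]
  simp only [← Real.exp_sum]
  congr 2
  have e : ∑ i ∈ Finset.Icc (k - win ω k + 1) k, ∑ j,
      (pmGrad M π est l (θs i) ϑ (τs i j) - gradient (M.J π) ϑ) =
      ((N : ℝ) * win ω k) • (mpm M π est ω k (fun _ => alphaCoef ω k) (fun _ => l) θs τs ϑ -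
        gradient (M.J π) ϑ) := by
    rw [mpm_eq, smul_sub, smul_inv_smul₀ (by linarith)]
    simp only [Finset.sum_sub_distrib, Finset.sum_const, card_Icc_win, Finset.card_univ,
      Fintype.card_fin]
    congr 1
    rw [← Nat.cast_smul_eq_nsmul ℝ, ← Nat.cast_smul_eq_nsmul ℝ, smul_smul, mul_comm]
  simp only [Finset.sum_sub_distrib (f := fun j => l / G * _), ← Finset.mul_sum, ← inner_sum,
    Finset.sum_const, card_Icc_win, Finset.card_univ, Fintype.card_fin]
  rw [e, real_inner_smul_right]
  simp only [nsmul_eq_mul]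
  ring

end IterationError

/-! ### Mean squared error at one iteration -/

section IterationBound

variable {S : Type u} {A : Type v} [MeasurableSpace S] [MeasurableSpace A] {d : ℕ}
  {M : MDP S A} {π : Param d → S → A → ℝ} {Θ : Set (Param d)} {est : GradEstimator}
  {L₁ L₂ G G₂ D B ζ l : ℝ} {N K ω k : ℕ}

theorem exists_half_le_inner {E : Type*} [NormedAddCommGroup E] [InnerProductSpace ℝ E]
    {V : Set E} (hV : ∀ a ∈ Metric.closedBall (0 : E) 1, ∃ q ∈ V, dist a q ≤ 1 / 2) (x : E) :
    ∃ v ∈ V, ‖x‖ / 2 ≤ inner ℝ v x := by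
  have hu : (‖x‖⁻¹ • x) ∈ Metric.closedBall (0 : E) 1 := by
    rw [mem_closedBall_zero_iff, norm_smul, norm_inv, norm_norm]
    exact inv_mul_le_one
  obtain ⟨v, hv, hd⟩ := hV _ hu
  refine ⟨v, hv, ?_⟩
  by_cases hx : x = 0
  · simp [hx]
  have hx0 : 0 < ‖x‖ := norm_pos_iff.2 hx
  have h1 : inner ℝ (‖x‖⁻¹ • x) x = ‖x‖ := by
    rw [real_inner_smul_left, real_inner_self_eq_norm_sq]; field_simp
  have h2 : inner ℝ (‖x‖⁻¹ • x - v) x ≤ 1 / 2 * ‖x‖ :=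
    (real_inner_le_norm _ _).trans (mul_le_mul_of_nonneg_right (by rwa [← dist_eq_norm]) hx0.le)
  rw [inner_sub_left, h1] at h2
  linarith

/-- Passing from `θ_k` to a net point changes the error by at most `GDl`, through the Lipschitz
constants `B/l` of the estimator and `B` of the gradient, with `B = GTL₁ + G₂`. An error above
`15GDl` thus stays above `14GDl` at the net point. Half of it is visible in some direction of the
second net, which gives the constant `7`. -/
theorem norm_mpm_error_le_or_exists (hΘ : IsOpen Θ) (hc : Convex ℝ Θ) (hπ : IsPolicyClass M Θ π)
    (hreg : RegularPolicy Θ π L₁ L₂) (hG0 : 0 < G) (hG : EstimatorBounds M Θ π est G G₂)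
    (hl : 0 < l) (hl1 : l ≤ 1) (hN : 1 ≤ N) (hω : 1 ≤ ω) (hk : 1 ≤ k) {η : ℝ}
    (hη : (G * M.T * L₁ + G₂) * (1 + 1 / l) * η ≤ G * D * l)
    (hB : 0 ≤ G * M.T * L₁ + G₂) {Q V : Set (Param d)} (hQΘ : Q ⊆ Θ)
    (hQ : ∀ a ∈ Θ, ∃ q ∈ Q, dist a q ≤ η)
    (hV : ∀ a ∈ Metric.closedBall (0 : Param d) 1, ∃ q ∈ V, dist a q ≤ 1 / 2)
    {θs : ℕ → Param d} (hθs : ∀ i ∈ Finset.Icc 1 k, θs i ∈ Θ) (τs : ℕ → Fin N → M.Traj) :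
    ‖mpm M π est ω k (fun _ => alphaCoef ω k) (fun _ => l) θs τs (θs k) -
        gradient (M.J π) (θs k)‖ ≤ 15 * (G * D * l) ∨
      ∃ ϑ ∈ Q, ∃ v ∈ V, dist (θs k) ϑ ≤ η ∧ 7 * (D * ((N : ℝ) * win ω k) * l ^ 2) ≤
        l / G * ((N : ℝ) * win ω k) * inner ℝ v
          (mpm M π est ω k (fun _ => alphaCoef ω k) (fun _ => l) θs τs ϑ -
            gradient (M.J π) ϑ) := by
  have hn := one_le_mul_win hN hω hk
  have hkΘ : θs k ∈ Θ := hθs k (Finset.mem_Icc.2 ⟨hk, le_rfl⟩)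
  obtain ⟨ϑ, hϑQ, hϑ⟩ := hQ _ hkΘ
  have hϑΘ := hQΘ hϑQ
  set err : Param d → Param d := fun ϑ =>
    mpm M π est ω k (fun _ => alphaCoef ω k) (fun _ => l) θs τs ϑ - gradient (M.J π) ϑ with herr
  have h1 := norm_mpm_sub_le (ω := ω) hc hπ hreg hG hl hl1 hN hω hk hθs τs hkΘ hϑΘ
  have h2 := (lipschitzSmoothOn_J hΘ hc hπ hreg hG).2 _ hkΘ _ hϑΘ
  have h3 : ‖err (θs k)‖ ≤ ‖err ϑ‖ + G * D * l := by
    have e : err (θs k) = err ϑ +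
        ((mpm M π est ω k (fun _ => alphaCoef ω k) (fun _ => l) θs τs (θs k) -
          mpm M π est ω k (fun _ => alphaCoef ω k) (fun _ => l) θs τs ϑ) -
          (gradient (M.J π) (θs k) - gradient (M.J π) ϑ)) := by
      simp only [herr]; abel
    rw [e]
    refine (norm_add_le _ _).trans (add_le_add le_rfl ((norm_sub_le _ _).trans ?_))
    refine (add_le_add h1 h2).trans (le_trans ?_ hη)
    rw [← dist_eq_norm]
    calc _ = (G * M.T * L₁ + G₂) * (1 + 1 / l) * dist (θs k) ϑ := by ring
      _ ≤ _ := by gcongr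
  by_cases hle : ‖err (θs k)‖ ≤ 15 * (G * D * l)
  · exact Or.inl hle
  · right
    obtain ⟨v, hv, hvi⟩ := exists_half_le_inner hV (err ϑ)
    refine ⟨ϑ, hϑQ, v, hv, hϑ, ?_⟩
    push Not at hle
    have h4 : 7 * (G * D * l) ≤ inner ℝ v (err ϑ) := by linarith
    calc 7 * (D * ((N : ℝ) * win ω k) * l ^ 2)
        = l / G * ((N : ℝ) * win ω k) * (7 * (G * D * l)) := by field_simp
      _ ≤ _ := by gcongr

variable {Ω : Type w} [MeasurableSpace Ω] {P : Measure Ω}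
  [IsProbabilityMeasure P] {θ : ℕ → Ω → Param d} {τ : ℕ → Ω → Fin N → M.Traj} {I : Ω → ℕ}

/-- Each step moves by at most `ζG/λ_i`, and `1/λ_i` is bounded through the window size at iteration
`k`. The bound is deterministic, so the relevant net points can be selected before the window is
sampled. -/
theorem IsRPGRun.norm_sub_le {θ₁ : Param d} (hπ : IsPolicyClass M Θ π) (hG0 : 0 < G)
    (hG : EstimatorBounds M Θ π est G G₂) (hd : 1 ≤ d) (hD : 1 ≤ D) (hB : 0 < B) (hζ : 0 < ζ)
    (hN : 1 ≤ N) (hω : 1 ≤ ω) (hrun : IsRPGRun M Θ π est D B ζ θ₁ N K ω P θ τ I)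
    (hk : k ∈ Finset.Icc 1 K)
    (hl1 : ∀ i ∈ Finset.Icc 1 k, lamCoef d D B ζ N ω i ≤ 1) :
    ∀ᵐ x ∂P, ‖θ k x - θ (k - win ω k + 1) x‖ ≤
      ζ * win ω k * G * Real.sqrt (3 * D * ((N : ℝ) * win ω k) / (4 * d)) := by
  rw [Finset.mem_Icc] at hk
  have hw1 := one_le_win hω hk.1
  have hw2 := win_le_right (ω := ω) (k := k)
  have hupd : ∀ᵐ x ∂P, ∀ i ∈ Finset.Icc 1 K, θ (i + 1) x = θ i x +
      ζ • mpm M π est ω i (fun _ => alphaCoef ω i) (fun _ => lamCoef d D B ζ N ω i)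
        (fun i => θ i x) (fun i => τ i x) (θ i x) := by
    exact (Filter.eventually_all_finset _).2 hrun.update
  filter_upwards [hupd, hrun.mem] with x hx hmem
  set q := Real.sqrt (3 * D * ((N : ℝ) * win ω k) / (4 * d)) with hq
  have hstep : ∀ j, k - win ω k + 1 + j ≤ k →
      ‖θ (k - win ω k + 1 + j) x - θ (k - win ω k + 1) x‖ ≤ j * (ζ * (G * q)) := by
    intro j
    induction j with
    | zero => simp
    | succ j ih =>
      intro hj
      set i := k - win ω k + 1 + j with hi
      have hi1 : 1 ≤ i := by omega
      have hik : i < k := by omega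
      have h1 := ih (by omega)
      have h2 := hx i (Finset.mem_Icc.2 ⟨hi1, by omega⟩)
      have h3 := norm_mpm_le (ω := ω) hπ hG
        (lamCoef_pos (ω := ω) hd hD hB.le hζ.le hN hω hi1) (hl1 i (Finset.mem_Icc.2 ⟨hi1, hik.le⟩))
        hN hω hi1 (θs := fun i => θ i x)
        (fun i' hi' => hmem i' (Finset.mem_Icc.2 ⟨(Finset.mem_Icc.1 hi').1, by
          have := (Finset.mem_Icc.1 hi').2; omega⟩)) (fun i => τ i x)
        (hmem i (Finset.mem_Icc.2 ⟨hi1, by omega⟩))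
      have h4 := inv_lamCoef_le (D := D) (B := B) (ζ := ζ) (N := N) (ω := ω) (k := i) hd hD hB.le hζ.le hN hω hi1
        (W := win ω k) (min_le_min le_rfl hik.le)
      have h5 : G / lamCoef d D B ζ N ω i ≤ G * q := by
        rw [div_eq_mul_one_div]; gcongr
      have e : k - win ω k + 1 + (j + 1) = i + 1 := by omega
      rw [e, h2, add_sub_right_comm]
      refine (norm_add_le _ _).trans ?_
      rw [norm_smul, Real.norm_eq_abs, abs_of_pos hζ]
      push_cast
      have := mul_le_mul_of_nonneg_left (h3.trans h5) hζ.le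
      linarith
  -- The window contains `win ω k` iterates, hence one step fewer.
  have h := hstep (win ω k - 1) (by omega)
  rw [show k - win ω k + 1 + (win ω k - 1) = k by omega] at h
  refine h.trans ?_
  have hq0 : 0 ≤ q := Real.sqrt_nonneg _
  have : ((win ω k - 1 : ℕ) : ℝ) ≤ win ω k := by exact_mod_cast Nat.sub_le _ _
  calc _ ≤ (win ω k : ℝ) * (ζ * (G * q)) := by gcongr
    _ = _ := by ring

/-- The product of the exponential weights over a window, restricted to targets near `θ m`. -/
def netTerm (M : MDP S A) (π : Param d → S → A → ℝ) (est : GradEstimator) (G D l R : ℝ)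
    (m n : ℕ) (θ₁ : Θ) (θ : ℕ → Ω → Param d) (τ : ℕ → Ω → Fin N → M.Traj) (ϑ v : Param d)
    (x : Ω) : ENNReal :=
  Set.indicator {q : Param d | dist (θ m x) q ≤ R} (fun _ => 1) ϑ *
    ∏ i ∈ Finset.Ico m n, ∏ j, expWeight M π est G D l v ϑ (toSet θ₁ (θ i x)) (τ i x j)

/-- The sum of the exponential weights over a net of targets near the iterate `θ m` and a net of
directions. -/
def netSum (M : MDP S A) (π : Param d → S → A → ℝ) (est : GradEstimator) (G D l R : ℝ)
    (Q V : Set (Param d)) (m n : ℕ) (θ₁ : Θ) (θ : ℕ → Ω → Param d)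
    (τ : ℕ → Ω → Fin N → M.Traj) (x : Ω) : ENNReal :=
  ∑' ϑ : Q, ∑' v : V, netTerm M π est G D l R m n θ₁ θ τ ϑ v x

theorem measurable_indicator_dist_le {X : Type*} {mX : MeasurableSpace X} {f : X → Param d}
    (hf : Measurable f) (R : ℝ) (ϑ : Param d) :
    Measurable fun x =>
      Set.indicator {q : Param d | dist (f x) q ≤ R} (fun _ => (1 : ENNReal)) ϑ := by
  have h2 : MeasurableSet {y : Param d | dist y ϑ ≤ R} :=
    measurableSet_le (measurable_id.dist measurable_const) measurable_const
  exact (measurable_const.indicator h2).comp hf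

theorem IsRPGRun.measurable_prod_window {θ₁ : Param d} (hθ₁ : θ₁ ∈ Θ) (hΘ : IsOpen Θ)
    (hrun : IsRPGRun M Θ π est D B ζ θ₁ N K ω P θ τ I) {φ : Θ → M.Traj → ENNReal}
    (hφ : Measurable (Function.uncurry φ)) (m n : ℕ) :
    Measurable fun x => ∏ i ∈ Finset.Ico m n, ∏ j, φ (toSet ⟨θ₁, hθ₁⟩ (θ i x)) (τ i x j) := by
  refine Finset.measurable_fun_prod _ fun i hi => Finset.measurable_fun_prod _ fun j _ => ?_
  have h1 := (measurable_toSet hΘ.measurableSet (⟨θ₁, hθ₁⟩ : Θ)).comp (hrun.measurable_θ i)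
  exact hφ.comp (h1.prodMk ((measurable_pi_apply j).comp (hrun.measurable_τ i)))

theorem IsRPGRun.measurable_netTerm {θ₁ : Param d} (hθ₁ : θ₁ ∈ Θ) (hΘ : IsOpen Θ)
    (hπ : IsPolicyClass M Θ π) (hreg : RegularPolicy Θ π L₁ L₂)
    (hrun : IsRPGRun M Θ π est D B ζ θ₁ N K ω P θ τ I) {ϑ : Param d} (hϑ : ϑ ∈ Θ) (v : Param d)
    (R : ℝ) (m n : ℕ) :
    Measurable (netTerm M π est G D l R m n ⟨θ₁, hθ₁⟩ θ τ ϑ v) :=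
  (measurable_indicator_dist_le (hrun.measurable_θ m) R ϑ).mul
    (hrun.measurable_prod_window hθ₁ hΘ (φ := fun a y => expWeight M π est G D l v ϑ a y)
      (measurable_expWeight hΘ hπ hreg v hϑ) m n)

theorem IsRPGRun.measurable_netSum {θ₁ : Param d} (hθ₁ : θ₁ ∈ Θ) (hΘ : IsOpen Θ)
    (hπ : IsPolicyClass M Θ π) (hreg : RegularPolicy Θ π L₁ L₂)
    (hrun : IsRPGRun M Θ π est D B ζ θ₁ N K ω P θ τ I) {Q V : Set (Param d)} (hQΘ : Q ⊆ Θ)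
    (hQc : Q.Countable) (hVc : V.Countable) (R : ℝ) (m n : ℕ) :
    Measurable (netSum M π est G D l R Q V m n ⟨θ₁, hθ₁⟩ θ τ) := by
  have := hQc.to_subtype
  have := hVc.to_subtype
  exact Measurable.tsum fun ϑ => Measurable.tsum fun v =>
    hrun.measurable_netTerm hθ₁ hΘ hπ hreg (hQΘ ϑ.2) v R m n

/-- Each product of weights has conditional mean at most one given the history at `m`, and the
nearness indicator belongs to that history. Only the indicators survive, and they are summed
pointwise before integration. The net `Q` may therefore be infinite, as long as it is locally
bounded in number. -/
theorem IsRPGRun.lintegral_netSum_le {θ₁ : Param d} (hθ₁ : θ₁ ∈ Θ) (hΘ : IsOpen Θ)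
    (hc : Convex ℝ Θ) (hπ : IsPolicyClass M Θ π) (hreg : RegularPolicy Θ π L₁ L₂) (hG0 : 0 < G)
    (hG : EstimatorBounds M Θ π est G G₂) (hD : 1 ≤ D) (hchi : BoundedChiSq M Θ π D)
    (hrun : IsRPGRun M Θ π est D B ζ θ₁ N K ω P θ τ I) (hl : 0 < l) (hl1 : l ≤ 1)
    {Q V : Set (Param d)} (hQΘ : Q ⊆ Θ) (hQc : Q.Countable) (hVc : V.Countable)
    (hV : ∀ v ∈ V, ‖v‖ ≤ 1) {R : ℝ} {cQ cV : ENNReal}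
    (hcQ : ∀ x : Param d,
      ∑' q : Q, Set.indicator {q : Param d | dist x q ≤ R} (fun _ => (1 : ENNReal)) q ≤ cQ)
    (hcV : ∑' _ : V, (1 : ENNReal) ≤ cV) {m n : ℕ} (hm : 1 ≤ m) (hmn : m ≤ n) (hn : n ≤ K + 1) :
    ∫⁻ x, netSum M π est G D l R Q V m n ⟨θ₁, hθ₁⟩ θ τ x ∂P ≤ cQ * cV := by
  have := hQc.to_subtype
  have := hVc.to_subtype
  have hnear : ∀ ϑ : Param d, Measurable[history θ τ m] fun x =>
      Set.indicator {q : Param d | dist (θ m x) q ≤ R} (fun _ => (1 : ENNReal)) ϑ := fun ϑ =>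
    measurable_indicator_dist_le (mX := history θ τ m) (measurable_history_left hm le_rfl) R ϑ
  have hterm : ∀ (ϑ : Q) (v : V),
      ∫⁻ x, netTerm M π est G D l R m n ⟨θ₁, hθ₁⟩ θ τ ϑ v x ∂P ≤
      ∫⁻ x, Set.indicator {q : Param d | dist (θ m x) q ≤ R} (fun _ => 1) (ϑ : Param d) ∂P :=
    fun ϑ v => hrun.lintegral_mul_prod_le hθ₁ hΘ hπ hreg
      (φ := fun a y => expWeight M π est G D l v ϑ a y)
      (measurable_expWeight hΘ hπ hreg (v : Param d) (hQΘ ϑ.2))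
      (lintegral_expWeight_le hΘ hc hπ hreg hG0 hG hD hchi hl hl1 (hQΘ ϑ.2) (hV v v.2))
      hm hmn hn (hnear ϑ)
  have hmeas : ∀ (ϑ : Q) (v : V),
      Measurable (netTerm M π est G D l R m n ⟨θ₁, hθ₁⟩ θ τ ϑ v) := fun ϑ v =>
    hrun.measurable_netTerm hθ₁ hΘ hπ hreg (hQΘ ϑ.2) v R m n
  calc ∫⁻ x, netSum M π est G D l R Q V m n ⟨θ₁, hθ₁⟩ θ τ x ∂P
      = ∑' ϑ : Q, ∑' v : V, ∫⁻ x, netTerm M π est G D l R m n ⟨θ₁, hθ₁⟩ θ τ ϑ v x ∂P :=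
        (lintegral_tsum fun ϑ => (Measurable.tsum fun v => hmeas ϑ v).aemeasurable).trans
          (tsum_congr fun ϑ => lintegral_tsum fun v => (hmeas ϑ v).aemeasurable)
    _ ≤ ∑' ϑ : Q, ∑' v : V, (∫⁻ x, Set.indicator {q : Param d | dist (θ m x) q ≤ R}
          (fun _ => 1) (ϑ : Param d) ∂P) * 1 :=
        ENNReal.tsum_le_tsum fun ϑ => ENNReal.tsum_le_tsum fun v =>
          (hterm ϑ v).trans (mul_one _).ge
    _ = (∑' ϑ : Q, ∫⁻ x, Set.indicator {q : Param d | dist (θ m x) q ≤ R}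
          (fun _ => 1) (ϑ : Param d) ∂P) * ∑' _ : V, (1 : ENNReal) := by
        rw [← ENNReal.tsum_mul_right]
        exact tsum_congr fun ϑ => ENNReal.tsum_mul_left
    _ = (∫⁻ x, ∑' ϑ : Q, Set.indicator {q : Param d | dist (θ m x) q ≤ R}
          (fun _ => 1) (ϑ : Param d) ∂P) * ∑' _ : V, (1 : ENNReal) := by
        rw [lintegral_tsum fun ϑ : Q =>
          (measurable_indicator_dist_le (hrun.measurable_θ m) R ϑ).aemeasurable]
    _ ≤ (∫⁻ _, cQ ∂P) * cV := by
        gcongr with x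
        exact hcQ _
    _ = cQ * cV := by rw [lintegral_const, measure_univ, mul_one]

/-- The Markov inequality in pointwise form: one net term has exponent at least `7Dnl² - 4Dnl² =
3Dnl²`, where `n = N ω_k`, and the other terms are nonnegative. -/
theorem one_le_netSum {θ₁ : Param d} (hθ₁ : θ₁ ∈ Θ) (hN : 1 ≤ N) (hω : 1 ≤ ω) (hk : 1 ≤ k)
    {Q V : Set (Param d)} {ϑ v : Param d} (hϑ : ϑ ∈ Q) (hv : v ∈ V) {x : Ω} {R : ℝ}
    (hmem : ∀ i ∈ Finset.Icc 1 k, θ i x ∈ Θ) (hdist : dist (θ (k - win ω k + 1) x) ϑ ≤ R)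
    (hlarge : 7 * (D * ((N : ℝ) * win ω k) * l ^ 2) ≤ l / G * ((N : ℝ) * win ω k) * inner ℝ v
      (mpm M π est ω k (fun _ => alphaCoef ω k) (fun _ => l) (fun i => θ i x) (fun i => τ i x) ϑ -
        gradient (M.J π) ϑ)) :
    1 ≤ ENNReal.ofReal (Real.exp (-(3 * (D * ((N : ℝ) * win ω k) * l ^ 2)))) *
      netSum M π est G D l R Q V (k - win ω k + 1) (k + 1) ⟨θ₁, hθ₁⟩ θ τ x := by
  have hw2 := win_le_right (ω := ω) (k := k)
  have hprod : ∏ i ∈ Finset.Ico (k - win ω k + 1) (k + 1), ∏ j,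
      expWeight M π est G D l v ϑ (toSet (⟨θ₁, hθ₁⟩ : Θ) (θ i x)) (τ i x j) =
      ∏ i ∈ Finset.Icc (k - win ω k + 1) k, ∏ j,
        expWeight M π est G D l v ϑ (θ i x) (τ i x j) := by
    rw [Icc_win_eq]
    refine Finset.prod_congr rfl fun i hi => Finset.prod_congr rfl fun j _ => ?_
    rw [Finset.mem_Ico] at hi
    rw [toSet_of_mem _ (hmem i (Finset.mem_Icc.2 ⟨by omega, by omega⟩))]
  have hterm : 1 ≤ ENNReal.ofReal (Real.exp (-(3 * (D * ((N : ℝ) * win ω k) * l ^ 2)))) *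
      netTerm M π est G D l R (k - win ω k + 1) (k + 1) ⟨θ₁, hθ₁⟩ θ τ ϑ v x := by
    rw [netTerm, hprod, Set.indicator_of_mem (by exact hdist), one_mul,
      prod_expWeight hN hω hk v (fun i => θ i x) (fun i => τ i x),
      ← ENNReal.ofReal_mul (Real.exp_pos _).le, ← Real.exp_add, ← ENNReal.ofReal_one,
      ← Real.exp_zero]
    refine ENNReal.ofReal_le_ofReal (Real.exp_le_exp.2 ?_)
    linarith
  refine hterm.trans (mul_le_mul_right ?_ _)
  exact (ENNReal.le_tsum (f := fun v : V =>
    netTerm M π est G D l R (k - win ω k + 1) (k + 1) ⟨θ₁, hθ₁⟩ θ τ ϑ v x) ⟨v, hv⟩).trans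
    (ENNReal.le_tsum (f := fun ϑ : Q => ∑' v : V,
      netTerm M π est G D l R (k - win ω k + 1) (k + 1) ⟨θ₁, hθ₁⟩ θ τ ϑ v x) ⟨ϑ, hϑ⟩)

/-- The mean squared error of the multiple power mean estimator at iteration `k`. -/
theorem IsRPGRun.exists_error_bound {θ₁ : Param d} (hθ₁ : θ₁ ∈ Θ) (hΘ : IsOpen Θ)
    (hc : Convex ℝ Θ) (hπ : IsPolicyClass M Θ π) (hreg : RegularPolicy Θ π L₁ L₂) (hG0 : 0 < G)
    (hG : EstimatorBounds M Θ π est G G₂) (hd : 1 ≤ d) (hD : 1 ≤ D) (hchi : BoundedChiSq M Θ π D)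
    (hBdef : B = G * M.T * L₁ + G₂) (hB : 0 < B) (hζ : 0 < ζ)
    (hN : 1 ≤ N) (hω : 1 ≤ ω) (hrun : IsRPGRun M Θ π est D B ζ θ₁ N K ω P θ τ I)
    (hk : k ∈ Finset.Icc 1 K)
    (hl1 : ∀ i ∈ Finset.Icc 1 k, lamCoef d D B ζ N ω i ≤ 1) :
    ∃ H : Ω → ENNReal, Measurable H ∧
      (∀ᵐ x ∂P, ENNReal.ofReal (‖mpm M π est ω k (fun _ => alphaCoef ω k)
        (fun _ => lamCoef d D B ζ N ω k) (fun i => θ i x) (fun i => τ i x) (θ k x) -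
          gradient (M.J π) (θ k x)‖ ^ 2) ≤ H x) ∧
      ∫⁻ x, H x ∂P ≤ ENNReal.ofReal (229 * (G * D * lamCoef d D B ζ N ω k) ^ 2) := by
  have hdist := hrun.norm_sub_le hπ hG0 hG hd hD hB hζ hN hω hk hl1
  rw [Finset.mem_Icc] at hk
  have hn := one_le_mul_win hN hω hk.1
  have hw1 := one_le_win hω hk.1
  have hw2 := win_le_right (ω := ω) (k := k)
  have hl := lamCoef_pos (D := D) (B := B) (ζ := ζ) (N := N) (ω := ω) (k := k) hd hD hB.le hζ.le
    hN hω hk.1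
  have hlk := hl1 k (Finset.mem_Icc.2 ⟨hk.1, le_rfl⟩)
  have hρ := covering_ratio_le hd hD hB hζ hG0 hN hω hk.1 rfl rfl
  have htail := sq_div_lamCoef_le (G := G) hd hD hB hζ hN hω hk.1
  set r := ζ * win ω k * G * Real.sqrt (3 * D * ((N : ℝ) * win ω k) / (4 * d)) with hr
  have hcov := covering_mul_exp_le (ρ := _) hd hD hB hζ hN hω hk.1 (by positivity) hρ
  set l := lamCoef d D B ζ N ω k with hldef
  -- The largest mesh for which moving to a net point costs at most `GDl`.
  set η := G * D * l / (B * (1 + 1 / l)) with hη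
  set n := (N : ℝ) * win ω k with hndef
  set m := k - win ω k + 1 with hm
  set ρ := 1 + 2 * (r + η) / η with hρdef
  have hη0 : 0 < η := by positivity
  have hr0 : 0 ≤ r := by positivity
  have hηle : (G * M.T * L₁ + G₂) * (1 + 1 / l) * η ≤ G * D * l := by
    rw [← hBdef, hη]; field_simp; rfl
  obtain ⟨Q, hQΘ, hQc, hQ, hQcard⟩ := exists_separated_net Θ hη0
  -- Mesh `1/2` in the unit ball gives the `5^d` directions, and loses a factor of two in the norm.
  obtain ⟨V, hVb, hVc, hV, hVcard⟩ := exists_separated_net (Metric.closedBall (0 : Param d) 1)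
    (η := 1 / 2) (by norm_num)
  have hVnorm : ∀ v ∈ V, ‖v‖ ≤ 1 := fun v hv => mem_closedBall_zero_iff.1 (hVb hv)
  have hV5 : ∑' _ : V, (1 : ENNReal) ≤ ENNReal.ofReal (5 ^ d) := by
    have h := hVcard 0 1 zero_le_one
    rw [finrank_euclideanSpace_fin] at h
    refine le_trans (le_of_eq (tsum_congr fun v => ?_)) (h.trans (by norm_num))
    rw [Set.indicator_of_mem]
    simpa using hVnorm v v.2
  -- The radius adds the drift `r` of the iterate over the window to the distance `η` from `θ_k` to
  -- its net point.
  have hQρ := fun x => hQcard x (r + η) (by positivity)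
  rw [finrank_euclideanSpace_fin] at hQρ
  have hZm := hrun.measurable_netSum (G := G) (l := l) hθ₁ hΘ hπ hreg hQΘ hQc hVc (r + η) m (k + 1)
  have hZsum := hrun.lintegral_netSum_le hθ₁ hΘ hc hπ hreg hG0 hG hD hchi hl hlk hQΘ hQc hVc hVnorm
    hQρ hV5 (m := m) (n := k + 1) (by omega) (by omega) (by omega)
  set c := ENNReal.ofReal (Real.exp (-(3 * (D * n * l ^ 2)))) with hcdef
  -- The first summand covers the good event, and the second is at least `(2G/l)²` on the bad one.
  -- Exhibiting a measurable majorant avoids measurability of the error itself, in which the target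
  -- is random.
  refine ⟨fun x => ENNReal.ofReal ((15 * (G * D * l)) ^ 2) +
    ENNReal.ofReal ((2 * G / l) ^ 2) * (c * netSum M π est G D l (r + η) Q V m (k + 1) ⟨θ₁, hθ₁⟩ θ τ x), ?_, ?_, ?_⟩
  · exact ((hZm.const_mul _).const_mul _).const_add _
  · filter_upwards [hdist, hrun.mem] with x hx hmem
    have hmemk : ∀ i ∈ Finset.Icc 1 k, θ i x ∈ Θ := fun i hi =>
      hmem i (Finset.Icc_subset_Icc_right (by omega) hi)
    have hkΘ : θ k x ∈ Θ := hmemk k (Finset.mem_Icc.2 ⟨hk.1, le_rfl⟩)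
    rcases norm_mpm_error_le_or_exists hΘ hc hπ hreg hG0 hG hl hlk hN hω hk.1 hηle
      (hBdef ▸ hB.le) hQΘ hQ hV (θs := fun i => θ i x) hmemk (fun i => τ i x) with h | h
    · exact (ENNReal.ofReal_le_ofReal (pow_le_pow_left₀ (norm_nonneg _) h 2)).trans le_self_add
    · obtain ⟨ϑ, hϑ, v, hv, hd1, hd2⟩ := h
      have hbound : ‖mpm M π est ω k (fun _ => alphaCoef ω k) (fun _ => l) (fun i => θ i x)
          (fun i => τ i x) (θ k x) - gradient (M.J π) (θ k x)‖ ≤ 2 * G / l := by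
        have h1 := norm_mpm_le (ω := ω) hπ hG hl hlk hN hω hk.1 (θs := fun i => θ i x) hmemk
          (fun i => τ i x) hkΘ
        have h2 := norm_gradient_J_le hΘ hc hπ hreg hG hkΘ
        have h3 : G ≤ G / l := by rw [le_div_iff₀ hl]; nlinarith
        calc _ ≤ G / l + G / l := (_root_.norm_sub_le _ _).trans (add_le_add h1 (h2.trans h3))
          _ = _ := by ring
      have hZ1 := one_le_netSum (R := r + η) hθ₁ hN hω hk.1 hϑ hv hmemk ?_ hd2
      swap
      · have h3 := dist_triangle (θ m x) (θ k x) ϑ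
        rw [dist_comm (θ m x) (θ k x), dist_eq_norm (θ k x) (θ m x)] at h3
        exact h3.trans (add_le_add hx hd1)
      calc _ ≤ ENNReal.ofReal ((2 * G / l) ^ 2) * 1 := by
            rw [mul_one]
            exact ENNReal.ofReal_le_ofReal (pow_le_pow_left₀ (norm_nonneg _) hbound 2)
        _ ≤ _ := mul_le_mul_right hZ1 _
        _ ≤ _ := le_add_self
  · rw [lintegral_add_left measurable_const, lintegral_const, measure_univ, mul_one,
      lintegral_const_mul _ (hZm.const_mul _), lintegral_const_mul _ hZm]
    have hρ0 : 0 ≤ ρ := by positivity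
    calc _ ≤ ENNReal.ofReal ((15 * (G * D * l)) ^ 2) + ENNReal.ofReal ((2 * G / l) ^ 2) *
          (c * (ENNReal.ofReal (ρ ^ d) * ENNReal.ofReal (5 ^ d))) := by gcongr
      _ = ENNReal.ofReal ((15 * (G * D * l)) ^ 2 + (2 * G / l) ^ 2 *
          (Real.exp (-(3 * (D * n * l ^ 2))) * (ρ ^ d * 5 ^ d))) := by
        rw [hcdef, ← ENNReal.ofReal_mul (by positivity), ← ENNReal.ofReal_mul (by positivity),
          ← ENNReal.ofReal_mul (by positivity), ← ENNReal.ofReal_add (by positivity)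
          (by positivity)]
      _ ≤ _ := by
        refine ENNReal.ofReal_le_ofReal ?_
        have := mul_le_mul_of_nonneg_left hcov (sq_nonneg (2 * G / l))
        -- The constant is `15² + 4 = 229`.
        nlinarith

end IterationBound

/-! ### Inexact gradient ascent for smooth functions -/

section Descent

variable {d : ℕ} {Θ : Set (Param d)} {f : Param d → ℝ} {L ζ : ℝ}

/-- Along the segment, `f` minus its linearization plus the quadratic term has nonnegative
derivative, by Cauchy–Schwarz and the Lipschitz gradient. Convexity keeps the segment in `Θ`. -/
theorem LipschitzSmoothOn.add_inner_sub_le (hf : LipschitzSmoothOn f L Θ) (hc : Convex ℝ Θ)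
    {x y : Param d} (hx : x ∈ Θ) (hy : y ∈ Θ) :
    f x + inner ℝ (gradient f x) (y - x) - L / 2 * ‖y - x‖ ^ 2 ≤ f y := by
  set u := y - x with hu
  have hseg : ∀ t ∈ Set.Icc (0 : ℝ) 1, x + t • u ∈ Θ := fun t ht =>
    hc.add_smul_sub_mem hx hy ht
  set h : ℝ → ℝ := fun t => f (x + t • u) - t * inner ℝ (gradient f x) u + L / 2 * t ^ 2 * ‖u‖ ^ 2
    with hh
  have hd : ∀ t ∈ Set.Icc (0 : ℝ) 1, HasDerivAt h (inner ℝ (gradient f (x + t • u)) u -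
      1 * inner ℝ (gradient f x) u + L / 2 * (2 * t) * ‖u‖ ^ 2) t := by
    intro t ht
    have h1 : HasDerivAt (fun t : ℝ => x + t • u) u t := by
      simpa using ((hasDerivAt_id t).smul_const u).const_add x
    have h2 := (hf.1 _ (hseg t ht)).hasGradientAt.hasFDerivAt.comp_hasDerivAt t h1
    refine HasDerivAt.add (HasDerivAt.sub ?_ ((hasDerivAt_id t).mul_const _)) ?_
    · exact h2
    · have h3 := ((hasDerivAt_pow 2 t).const_mul (L / 2)).mul_const (‖u‖ ^ 2)
      simpa using h3
  have hmono : MonotoneOn h (Set.Icc 0 1) := by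
    refine monotoneOn_of_deriv_nonneg (convex_Icc 0 1)
      (fun t ht => (hd t ht).continuousAt.continuousWithinAt)
      (fun t ht => (hd t (interior_subset ht)).differentiableAt.differentiableWithinAt) ?_
    intro t ht
    have ht' := interior_subset ht
    rw [(hd t ht').deriv]
    have h1 := hf.2 _ hx _ (hseg t ht')
    have h2 := real_inner_le_norm (gradient f x - gradient f (x + t • u)) u
    rw [inner_sub_left] at h2
    have h3 : ‖x - (x + t • u)‖ = t * ‖u‖ := by
      rw [sub_add_cancel_left, norm_neg, norm_smul, Real.norm_eq_abs, abs_of_nonneg ht'.1]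
    rw [h3] at h1
    nlinarith [mul_le_mul_of_nonneg_right h1 (norm_nonneg u)]
  have := hmono (Set.left_mem_Icc.2 zero_le_one) (Set.right_mem_Icc.2 zero_le_one) zero_le_one
  simp only [hh, zero_smul, add_zero, zero_mul, one_smul, one_mul, sub_zero,
    one_pow, mul_one, ne_eq, OfNat.ofNat_ne_zero, not_false_eq_true, zero_pow, mul_zero] at this
  rw [show x + u = y by rw [hu]; abel] at this
  linarith

/-- One step of biased gradient ascent. -/
theorem LipschitzSmoothOn.ascent_step (hf : LipschitzSmoothOn f L Θ) (hc : Convex ℝ Θ)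
    (hL : 0 < L) (hζ : 0 < ζ) (hζL : ζ ≤ 1 / L) {x g : Param d} (hx : x ∈ Θ)
    (hy : x + ζ • g ∈ Θ) :
    ‖gradient f x‖ ^ 2 ≤ 2 / ζ * (f (x + ζ • g) - f x) + ‖g - gradient f x‖ ^ 2 := by
  have h := hf.add_inner_sub_le hc hx hy
  rw [add_sub_cancel_left, real_inner_smul_right, norm_smul, Real.norm_eq_abs, abs_of_pos hζ] at h
  have h1 : ‖g - gradient f x‖ ^ 2 = ‖g‖ ^ 2 - 2 * inner ℝ (gradient f x) g +
      ‖gradient f x‖ ^ 2 := by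
    rw [norm_sub_sq_real, real_inner_comm]
  have h2 : L * ζ ≤ 1 := by rw [le_div_iff₀ hL] at hζL; linarith
  have h3 : L / 2 * (ζ * ‖g‖) ^ 2 ≤ ζ / 2 * ‖g‖ ^ 2 := by
    have : L / 2 * (ζ * ‖g‖) ^ 2 = (L * ζ) * (ζ / 2 * ‖g‖ ^ 2) := by ring
    rw [this]
    exact mul_le_of_le_one_left (by positivity) h2
  have h4 : ζ * inner ℝ (gradient f x) g - ζ / 2 * ‖g‖ ^ 2 ≤ f (x + ζ • g) - f x := by linarith
  have h5 := mul_le_mul_of_nonneg_left h4 (by positivity : 0 ≤ 2 / ζ)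
  have h6 : 2 / ζ * (ζ * inner ℝ (gradient f x) g - ζ / 2 * ‖g‖ ^ 2) =
      2 * inner ℝ (gradient f x) g - ‖g‖ ^ 2 := by field_simp
  linarith

end Descent

/-! ### From iteration errors to the random output -/

section Output

variable {S : Type u} {A : Type v} [MeasurableSpace S] [MeasurableSpace A] {d : ℕ}
  {M : MDP S A} {π : Param d → S → A → ℝ} {Θ : Set (Param d)} {est : GradEstimator}
  {L₁ L₂ G G₂ D B ζ L : ℝ} {N K ω : ℕ}
  {Ω : Type w} [MeasurableSpace Ω] {P : Measure Ω}
  [IsProbabilityMeasure P] {θ : ℕ → Ω → Param d} {τ : ℕ → Ω → Fin N → M.Traj} {I : Ω → ℕ}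
  {θ₁ : Param d}

theorem IsRPGRun.sum_sq_norm_gradient_le (hc : Convex ℝ Θ) (hπ : IsPolicyClass M Θ π)
    (hJ : LipschitzSmoothOn (M.J π) L Θ) (hL : 0 < L) (hζ : 0 < ζ) (hζL : ζ ≤ 1 / L)
    (hK : 1 ≤ K) (hrun : IsRPGRun M Θ π est D B ζ θ₁ N K ω P θ τ I) :
    ∀ᵐ x ∂P, ∑ k ∈ Finset.Icc 1 K, ‖gradient (M.J π) (θ k x)‖ ^ 2 ≤
      2 / ζ * (M.Jstar π Θ - M.J π θ₁) +
        ∑ k ∈ Finset.Icc 1 K, ‖mpm M π est ω k (fun _ => alphaCoef ω k)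
          (fun _ => lamCoef d D B ζ N ω k) (fun i => θ i x) (fun i => τ i x) (θ k x) -
            gradient (M.J π) (θ k x)‖ ^ 2 := by
  have hupd : ∀ᵐ x ∂P, ∀ i ∈ Finset.Icc 1 K, θ (i + 1) x = θ i x +
      ζ • mpm M π est ω i (fun _ => alphaCoef ω i) (fun _ => lamCoef d D B ζ N ω i)
        (fun i => θ i x) (fun i => τ i x) (θ i x) :=
    (Filter.eventually_all_finset _).2 hrun.update
  filter_upwards [hupd, hrun.mem, hrun.init] with x hx hmem hinit
  have hstep : ∀ k ∈ Finset.Icc 1 K, ‖gradient (M.J π) (θ k x)‖ ^ 2 ≤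
      2 / ζ * (M.J π (θ (k + 1) x) - M.J π (θ k x)) +
      ‖mpm M π est ω k (fun _ => alphaCoef ω k)
          (fun _ => lamCoef d D B ζ N ω k) (fun i => θ i x) (fun i => τ i x) (θ k x) -
            gradient (M.J π) (θ k x)‖ ^ 2 := by
    intro k hk
    have h1 := Finset.mem_Icc.1 hk
    have h2 := hmem k (Finset.mem_Icc.2 ⟨h1.1, by omega⟩)
    have h3 := hmem (k + 1) (Finset.mem_Icc.2 ⟨by omega, by omega⟩)
    rw [hx k hk] at h3 ⊢
    exact hJ.ascent_step hc hL hζ hζL h2 h3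
  refine (Finset.sum_le_sum hstep).trans ?_
  rw [Finset.sum_add_distrib, ← Finset.mul_sum]
  gcongr
  have htel : ∑ k ∈ Finset.Icc 1 K, (M.J π (θ (k + 1) x) - M.J π (θ k x)) =
      M.J π (θ (K + 1) x) - M.J π (θ 1 x) := by
    rw [← Finset.Ico_add_one_right_eq_Icc]
    exact Finset.sum_Ico_sub (fun k => M.J π (θ k x)) (by omega)
  rw [htel, hinit]
  have := J_le_Jstar hπ (hmem (K + 1) (Finset.mem_Icc.2 ⟨by omega, le_rfl⟩))
  linarith

theorem measurable_gradient_toSet (hΘ : IsOpen Θ) (hJ : LipschitzSmoothOn (M.J π) L Θ)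
    (θ₁ : Θ) : Measurable fun y => gradient (M.J π) (toSet θ₁ y) := by
  have h : Continuous fun y : Θ => gradient (M.J π) y := by
    refine (LipschitzWith.of_dist_le' (K := L) fun y z => ?_).continuous
    rw [dist_eq_norm, Subtype.dist_eq, dist_eq_norm]
    exact hJ.2 _ y.2 _ z.2
  exact h.measurable.comp (measurable_toSet hΘ.measurableSet θ₁)

theorem IsRPGRun.ae_index_mem (hK : 1 ≤ K)
    (hrun : IsRPGRun M Θ π est D B ζ θ₁ N K ω P θ τ I) :
    ∀ᵐ x ∂P, I x ∈ Finset.Icc 1 K := by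
  have hm : MeasurableSet (I ⁻¹' (Finset.Icc 1 K : Finset ℕ)) :=
    hrun.measurable_I (Finset.measurableSet _)
  have h1 : P (I ⁻¹' (Finset.Icc 1 K : Finset ℕ)) = 1 := by
    have : I ⁻¹' (Finset.Icc 1 K : Finset ℕ) = ⋃ k ∈ Finset.Icc 1 K, I ⁻¹' {k} := by
      ext x; simp
    rw [this, measure_biUnion_finset (fun a _ b _ hab => Disjoint.preimage _ (by simpa using hab))
      fun k _ => hrun.measurable_I (measurableSet_singleton k),
      Finset.sum_congr rfl fun k hk => hrun.uniform k hk]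
    simp only [Finset.sum_const, Nat.card_Icc, add_tsub_cancel_right, nsmul_eq_mul]
    exact ENNReal.mul_inv_cancel (by simp; omega) (by simp)
  rw [← prob_compl_eq_zero_iff hm] at h1
  exact h1

/-- Decomposing over the value of the index, independence factors each piece into the probability
`1/K` and a mean over the process. -/
theorem IsRPGRun.lintegral_output (hK : 1 ≤ K)
    (hrun : IsRPGRun M Θ π est D B ζ θ₁ N K ω P θ τ I) {F : Param d → ENNReal}
    (hF : Measurable F) :
    ∫⁻ x, F (θ (I x) x) ∂P = (K : ENNReal)⁻¹ * ∑ k ∈ Finset.Icc 1 K, ∫⁻ x, F (θ k x) ∂P := by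
  have h1 : ∀ᵐ x ∂P, F (θ (I x) x) = ∑ k ∈ Finset.Icc 1 K,
      Set.indicator (I ⁻¹' {k}) (fun _ => 1) x * F (θ k x) := by
    filter_upwards [hrun.ae_index_mem hK] with x hx
    rw [Finset.sum_eq_single_of_mem _ hx fun k _ hk => ?_]
    · simp
    · rw [Set.indicator_of_notMem, zero_mul]
      simpa using hk.symm
  rw [lintegral_congr_ae h1, lintegral_finsetSum, Finset.mul_sum]
  · refine Finset.sum_congr rfl fun k hk => ?_
    have hk1 := Finset.mem_Icc.1 hk
    rw [lintegral_mul_eq_lintegral_mul_lintegral_of_independent_measurableSpace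
      hrun.measurable_I.comap_le (history_le hrun.measurable_θ hrun.measurable_τ (K + 1))
      hrun.indep (f := Set.indicator (I ⁻¹' {k}) fun _ => 1) (g := fun x => F (θ k x)) ?_ ?_]
    · rw [lintegral_indicator_const (hrun.measurable_I (measurableSet_singleton k)), one_mul,
        hrun.uniform k hk]
    · refine Measurable.indicator measurable_const ?_
      exact ⟨{k}, measurableSet_singleton k, rfl⟩
    · exact hF.comp (measurable_history_left hk1.1 (by omega))
  · intro k _
    exact (measurable_const.indicator (hrun.measurable_I (measurableSet_singleton k))).mul
      (hF.comp (hrun.measurable_θ k))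

theorem IsRPGRun.output_bound (hθ₁ : θ₁ ∈ Θ) (hΘ : IsOpen Θ)
    (hc : Convex ℝ Θ) (hπ : IsPolicyClass M Θ π) (hreg : RegularPolicy Θ π L₁ L₂) (hG0 : 0 < G)
    (hG : EstimatorBounds M Θ π est G G₂) (hd : 1 ≤ d) (hD : 1 ≤ D) (hchi : BoundedChiSq M Θ π D)
    (hBdef : B = G * M.T * L₁ + G₂) (hB : 0 < B) (hζ : 0 < ζ)
    (hJ : LipschitzSmoothOn (M.J π) L Θ) (hL : 0 < L) (hζL : ζ ≤ 1 / L)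
    (hN : 1 ≤ N) (hω : 1 ≤ ω) (hK : 1 ≤ K)
    (hl1 : ∀ i ∈ Finset.Icc 1 K, lamCoef d D B ζ N ω i ≤ 1)
    (hrun : IsRPGRun M Θ π est D B ζ θ₁ N K ω P θ τ I) :
    Integrable (fun x => ‖gradient (M.J π) (θ (I x) x)‖ ^ 2) P ∧
      ∫ x, ‖gradient (M.J π) (θ (I x) x)‖ ^ 2 ∂P ≤
        (K : ℝ)⁻¹ * (2 / ζ * (M.Jstar π Θ - M.J π θ₁) +
          ∑ k ∈ Finset.Icc 1 K, 229 * (G * D * lamCoef d D B ζ N ω k) ^ 2) := by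
  set F : Param d → ℝ := fun y => ‖gradient (M.J π) (toSet ⟨θ₁, hθ₁⟩ y)‖ ^ 2 with hFdef
  have hF : Measurable F := (measurable_gradient_toSet hΘ hJ _).norm.pow_const 2
  have hF0 : ∀ y, 0 ≤ F y := fun y => sq_nonneg _
  have hFΘ : ∀ y ∈ Θ, ‖gradient (M.J π) y‖ ^ 2 = F y := fun y hy => by
    simp only [hFdef]; rw [toSet_of_mem _ hy]
  have hΔ : 0 ≤ M.Jstar π Θ - M.J π θ₁ := sub_nonneg.2 (J_le_Jstar hπ hθ₁)
  have hθI : Measurable fun x => θ (I x) x :=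
    (measurable_from_prod_countable_right (f := fun p : ℕ × Ω => θ p.1 p.2)
      hrun.measurable_θ).comp (hrun.measurable_I.prodMk measurable_id)
  have hae : (fun x => ‖gradient (M.J π) (θ (I x) x)‖ ^ 2) =ᵐ[P] fun x => F (θ (I x) x) := by
    filter_upwards [hrun.ae_index_mem hK, hrun.mem] with x hx hmem
    exact hFΘ _ (hmem _ (Finset.Icc_subset_Icc_right (by omega) hx))
  have hint : Integrable (fun x => F (θ (I x) x)) P := by
    refine integrable_of_bound (hF.comp hθI).aestronglyMeasurable (c := G ^ 2) fun x => ?_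
    rw [Real.norm_eq_abs, abs_of_nonneg (hF0 _)]
    exact pow_le_pow_left₀ (norm_nonneg _)
      (norm_gradient_J_le hΘ hc hπ hreg hG (Subtype.coe_prop _)) 2
  refine ⟨hint.congr hae.symm, ?_⟩
  rw [integral_congr_ae hae]
  have hbound0 : 0 ≤ (K : ℝ)⁻¹ * (2 / ζ * (M.Jstar π Θ - M.J π θ₁) +
      ∑ k ∈ Finset.Icc 1 K, 229 * (G * D * lamCoef d D B ζ N ω k) ^ 2) := by positivity
  rw [← ENNReal.ofReal_le_ofReal_iff hbound0, ofReal_integral_eq_lintegral_ofReal hint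
    (Filter.Eventually.of_forall fun x => hF0 _),
    hrun.lintegral_output hK (F := fun y => ENNReal.ofReal (F y)) hF.ennreal_ofReal]
  -- The error bound at iteration `k` needs admissibility at all earlier iterations too, since these
  -- control the drift of the iterates.
  have herr : ∀ k ∈ Finset.Icc 1 K, _ := fun k hk =>
    hrun.exists_error_bound hθ₁ hΘ hc hπ hreg hG0 hG hd hD hchi hBdef hB hζ hN hω hk
      fun i hi => hl1 i (Finset.Icc_subset_Icc_right (Finset.mem_Icc.1 hk).2 hi)
  choose! H hHm hHae hHint using herr
  have hsum : ∑ k ∈ Finset.Icc 1 K, ∫⁻ x, ENNReal.ofReal (F (θ k x)) ∂P ≤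
      ENNReal.ofReal (2 / ζ * (M.Jstar π Θ - M.J π θ₁) +
        ∑ k ∈ Finset.Icc 1 K, 229 * (G * D * lamCoef d D B ζ N ω k) ^ 2) := by
    rw [← lintegral_finsetSum (f := fun k x => ENNReal.ofReal (F (θ k x))) _
      fun k _ => (hF.comp (hrun.measurable_θ k)).ennreal_ofReal]
    calc ∫⁻ x, ∑ k ∈ Finset.Icc 1 K, ENNReal.ofReal (F (θ k x)) ∂P
        ≤ ∫⁻ x, (ENNReal.ofReal (2 / ζ * (M.Jstar π Θ - M.J π θ₁)) +
            ∑ k ∈ Finset.Icc 1 K, H k x) ∂P := by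
          refine lintegral_mono_ae ?_
          filter_upwards [hrun.sum_sq_norm_gradient_le hc hπ hJ hL hζ hζL hK, hrun.mem,
            (Filter.eventually_all_finset (Finset.Icc 1 K)).2 hHae] with x hx hmem hH
          rw [← ENNReal.ofReal_sum_of_nonneg fun k _ => hF0 _]
          have e : ∑ k ∈ Finset.Icc 1 K, F (θ k x) =
              ∑ k ∈ Finset.Icc 1 K, ‖gradient (M.J π) (θ k x)‖ ^ 2 :=
            Finset.sum_congr rfl fun k hk =>
              (hFΘ _ (hmem _ (Finset.Icc_subset_Icc_right (by omega) hk))).symm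
          rw [e]
          refine (ENNReal.ofReal_le_ofReal hx).trans ?_
          rw [ENNReal.ofReal_add (by positivity) (by positivity),
            ENNReal.ofReal_sum_of_nonneg fun k _ => by positivity]
          gcongr with k hk
          exact hH k hk
      _ = ENNReal.ofReal (2 / ζ * (M.Jstar π Θ - M.J π θ₁)) +
            ∑ k ∈ Finset.Icc 1 K, ∫⁻ x, H k x ∂P := by
          rw [lintegral_add_left measurable_const, lintegral_const, measure_univ, mul_one,
            lintegral_finsetSum _ hHm]
      _ ≤ ENNReal.ofReal (2 / ζ * (M.Jstar π Θ - M.J π θ₁)) +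
            ∑ k ∈ Finset.Icc 1 K,
              ENNReal.ofReal (229 * (G * D * lamCoef d D B ζ N ω k) ^ 2) := by
          gcongr with k hk
          exact hHint k hk
      _ = _ := by
          rw [← ENNReal.ofReal_sum_of_nonneg fun k _ => by positivity,
            ← ENNReal.ofReal_add (by positivity) (by positivity)]
  have hKe : (K : ENNReal)⁻¹ = ENNReal.ofReal (K : ℝ)⁻¹ := by
    rw [ENNReal.ofReal_inv_of_pos (by positivity), ENNReal.ofReal_natCast]
  rw [hKe, ENNReal.ofReal_mul (by positivity)]
  gcongr

end Output

/-! ### Logarithmic factors and the averaged error -/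

section Rates

variable {d N K ω k : ℕ} {D B ζ G ε : ℝ}

/-- The base `6 + B ζ √(D / d)` of the logarithmic factors. -/
def logBase (d : ℕ) (D B ζ : ℝ) : ℝ := 6 + B * ζ * Real.sqrt (D / d)

theorem six_le_logBase (hB : 0 ≤ B) (hζ : 0 ≤ ζ) : 6 ≤ logBase d D B ζ := by
  have : 0 ≤ B * ζ * Real.sqrt (D / d) := by positivity
  unfold logBase; linarith

theorem one_le_log_logBase (hB : 0 ≤ B) (hζ : 0 ≤ ζ) : 1 ≤ Real.log (logBase d D B ζ) :=
  one_le_log_six.trans (Real.log_le_log (by norm_num) (six_le_logBase hB hζ))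

/-- Separates the problem constants, collected in `logBase`, from the sample size. Taking logarithms
turns the powers into harmless factors. -/
theorem six_add_lamArg_le (hD : 1 ≤ D) (hB : 0 ≤ B) (hζ : 0 ≤ ζ) (hN : 1 ≤ N)
    (hω : 1 ≤ ω) (hk : 1 ≤ k) :
    6 + lamArg d D B ζ N ω k ≤ logBase d D B ζ ^ 2 * ((N : ℝ) * win ω k) ^ 3 := by
  have hn := one_le_mul_win hN hω hk
  have hΨ := six_le_logBase (d := d) (D := D) hB hζ
  have hN' : (1 : ℝ) ≤ N := by exact_mod_cast hN
  have hWn : (win ω k : ℝ) ≤ (N : ℝ) * win ω k := le_mul_of_one_le_left (Nat.cast_nonneg _) hN'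
  have e0 : lamArg d D B ζ N ω k = B * ζ * (1 + Real.sqrt (3 / 4 * D * ((N : ℝ) * win ω k))) *
      (3 / 4 * Real.sqrt 3) * win ω k * ((N : ℝ) * win ω k) / Real.sqrt d := by
    rw [lamArg, show 3 / 4 * D * N * (win ω k : ℝ) = 3 / 4 * D * ((N : ℝ) * win ω k) by ring]
    rcases eq_or_ne (Real.sqrt (d : ℝ)) 0 with h | h
    · simp [h]
    · field_simp
  set n := (N : ℝ) * win ω k
  have h3 : Real.sqrt 3 ≤ 2 := by rw [Real.sqrt_le_left (by norm_num)]; norm_num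
  have hsn : Real.sqrt n ≤ n := by rw [Real.sqrt_le_left (by linarith)]; nlinarith
  have hs : 1 + Real.sqrt (3 / 4 * D * n) ≤ 2 * (Real.sqrt D * n) := by
    have h1 : Real.sqrt (3 / 4 * D * n) ≤ Real.sqrt (D * n) := by
      refine Real.sqrt_le_sqrt ?_
      have : 0 ≤ D * n := by positivity
      nlinarith
    have h2 : Real.sqrt (D * n) = Real.sqrt D * Real.sqrt n := Real.sqrt_mul (by linarith) _
    have h4 : 1 ≤ Real.sqrt D := Real.one_le_sqrt.2 hD
    have h5 : Real.sqrt D * Real.sqrt n ≤ Real.sqrt D * n := by gcongr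
    have h6 : 1 ≤ Real.sqrt D * n := one_le_mul_of_one_le_of_one_le h4 hn
    linarith
  have h4 : lamArg d D B ζ N ω k ≤ 3 * (B * ζ * Real.sqrt (D / d)) * n ^ 3 := by
    rw [e0]
    calc _ ≤ B * ζ * (2 * (Real.sqrt D * n)) * (3 / 4 * 2) * n * n / Real.sqrt d := by gcongr
      _ = 3 * (B * ζ * (Real.sqrt D / Real.sqrt d)) * n ^ 3 := by ring
      _ = _ := by rw [Real.sqrt_div (by linarith)]
  have hn3 : 1 ≤ n ^ 3 := one_le_pow₀ hn
  have h5 : 6 + lamArg d D B ζ N ω k ≤ 3 * logBase d D B ζ * n ^ 3 := by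
    unfold logBase; nlinarith
  refine h5.trans ?_
  have : 3 * logBase d D B ζ ≤ logBase d D B ζ ^ 2 := by nlinarith
  gcongr

/-- With `n = N ω_k` and `Ψ = logBase`, the exact formula is at most `4/3 (2d log Ψ + 3d log n + 2
log n)`, whose largest coefficient is `20/3 ≤ 7`. -/
theorem mul_lamCoef_sq_le (hd : 1 ≤ d) (hD : 1 ≤ D) (hB : 0 ≤ B) (hζ : 0 ≤ ζ) (hN : 1 ≤ N)
    (hω : 1 ≤ ω) (hk : 1 ≤ k) :
    D * ((N : ℝ) * win ω k) * lamCoef d D B ζ N ω k ^ 2 ≤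
      7 * d * Real.log (logBase d D B ζ * ((N : ℝ) * win ω k)) := by
  have hn := one_le_mul_win hN hω hk
  have hΨ := six_le_logBase (d := d) (D := D) hB hζ
  have hA := lamArg_nonneg (d := d) (D := D) (N := N) (ω := ω) (k := k) hB hζ
  rw [mul_lamCoef_sq hD hB hζ hN hω hk]
  have h1 := Real.log_le_log (by linarith) (six_add_lamArg_le (d := d) hD hB hζ hN hω hk)
  set n := (N : ℝ) * win ω k
  have hd' : (1 : ℝ) ≤ d := by exact_mod_cast hd
  rw [Real.log_mul (by positivity) (by positivity), Real.log_pow, Real.log_pow] at h1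
  rw [Real.log_mul (show logBase d D B ζ ≠ 0 by linarith) (show n ≠ 0 by linarith)]
  have h2 := Real.log_nonneg hn
  have h3 := one_le_log_logBase (d := d) (D := D) hB hζ
  push_cast at h1
  have h4 := mul_le_mul_of_nonneg_left h1 (by linarith : (0 : ℝ) ≤ d)
  have h5 : Real.log n ≤ d * Real.log n := le_mul_of_one_le_left h2 hd'
  have h6 : 0 ≤ d * Real.log (logBase d D B ζ) := by positivity
  nlinarith

/-- While the window is filling up the terms form a harmonic sum, and afterwards they are constant.
The harmonic part is absorbed because `K` is at least the final window size; it is the source of the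
second logarithm. -/
theorem sum_inv_win_le (hω : 1 ≤ ω) (hK : 1 ≤ K) :
    ∑ k ∈ Finset.Icc 1 K, ((win ω k : ℕ) : ℝ)⁻¹ ≤
      K / (win ω K : ℝ) * (2 + Real.log (win ω K)) := by
  have hW := one_le_win hω hK
  have hWK := win_le_right (ω := ω) (k := K)
  set W := win ω K with hWdef
  have hW' : (1 : ℝ) ≤ W := by exact_mod_cast hW
  have hterm : ∀ k ∈ Finset.Icc 1 K, ((win ω k : ℕ) : ℝ)⁻¹ ≤
      (W : ℝ)⁻¹ + if k ≤ W then (k : ℝ)⁻¹ else 0 := by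
    intro k hk
    rw [Finset.mem_Icc] at hk
    by_cases h : k ≤ W
    · have : win ω k = k := by
        rw [hWdef] at h; unfold win at h ⊢; omega
      rw [if_pos h, this]
      have : (0 : ℝ) ≤ (W : ℝ)⁻¹ := by positivity
      linarith
    · have : win ω k = W := by
        rw [hWdef] at h ⊢; unfold win at h ⊢; omega
      rw [if_neg h, this, add_zero]
  refine (Finset.sum_le_sum hterm).trans ?_
  rw [Finset.sum_add_distrib, Finset.sum_const, Nat.card_Icc, ← Finset.sum_filter]
  have hfil : (Finset.Icc 1 K).filter (fun k => k ≤ W) = Finset.Icc 1 W := by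
    ext k; simp only [Finset.mem_filter, Finset.mem_Icc]; omega
  have hharm : ∑ k ∈ Finset.Icc 1 W, ((k : ℕ) : ℝ)⁻¹ ≤ 1 + Real.log W := by
    have := harmonic_le_one_add_log W
    rw [harmonic_eq_sum_Icc] at this
    push_cast at this
    exact this
  rw [hfil]
  have h1 : 1 ≤ (K : ℝ) / W := by
    rw [one_le_div (by linarith)]; exact_mod_cast hWK
  have h2 := Real.log_nonneg hW'
  have h3 : (1 + Real.log W) ≤ (K : ℝ) / W * (1 + Real.log W) :=
    le_mul_of_one_le_left (by linarith) h1
  simp only [add_tsub_cancel_right, nsmul_eq_mul]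
  have e : (K : ℝ) * (W : ℝ)⁻¹ = K / W := rfl
  rw [e]
  nlinarith

theorem log_le_four_mul_sqrt_sqrt {y : ℝ} (hy : 0 < y) :
    Real.log y ≤ 4 * Real.sqrt (Real.sqrt y) := by
  have h1 := Real.log_le_self (Real.sqrt_nonneg (Real.sqrt y))
  rw [Real.log_sqrt (Real.sqrt_nonneg y), Real.log_sqrt hy.le] at h1
  linarith

/-- The constant in the sufficient conditions. -/
def rateConst : ℝ := 250000 ^ 2

theorem sqrt_rateConst : Real.sqrt rateConst = 250000 := Real.sqrt_sq (by norm_num)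

theorem sqrt_le_div_of_rateConst_le {y : ℝ} (hy : rateConst ≤ y) : Real.sqrt y ≤ y / 250000 := by
  have hy0 : 0 < y := lt_of_lt_of_le (by norm_num [rateConst]) hy
  have h1 := Real.sqrt_le_sqrt hy
  rw [sqrt_rateConst] at h1
  rw [le_div_iff₀ (by norm_num)]
  calc Real.sqrt y * 250000 ≤ Real.sqrt y * Real.sqrt y := by gcongr
    _ = y := Real.mul_self_sqrt hy0.le

/-- Removes `n` from the logarithm: with `y = n/X` one has `log(Ψn) = ℓ + log y`. The first part is
small against `y` by assumption, and `log² y ≤ 16√y` is small once `y` is large. -/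
theorem sq_log_le {Ψ X n ℓ : ℝ} (hΨ : 0 < Ψ) (hX : 0 < X) (hℓ : ℓ = Real.log (X * Ψ))
    (hℓ1 : 1 ≤ ℓ) (hn : rateConst * ℓ ^ 2 * X ≤ n) :
    Real.log (Ψ * n) ^ 2 * X ≤ n / 6412 := by
  set y := n / X with hy
  have hyn : n = y * X := by rw [hy]; field_simp
  have hyC : rateConst * ℓ ^ 2 ≤ y := by rw [hy, le_div_iff₀ hX]; exact hn
  have hC0 : (0 : ℝ) < rateConst := by norm_num [rateConst]
  have hyC' : rateConst ≤ y := (le_mul_of_one_le_right hC0.le (one_le_pow₀ hℓ1)).trans hyC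
  have hy0 : 0 < y := by linarith
  have e : Real.log (Ψ * n) = ℓ + Real.log y := by
    rw [hyn, hℓ, ← Real.log_mul (by positivity) hy0.ne']; ring_nf
  have h1 := log_le_four_mul_sqrt_sqrt hy0
  have h0 : 0 ≤ Real.log y := Real.log_nonneg (by
    have : (1 : ℝ) ≤ rateConst := by norm_num [rateConst]
    linarith)
  have h2 : Real.log y ^ 2 ≤ 16 * Real.sqrt y := by
    calc Real.log y ^ 2 ≤ (4 * Real.sqrt (Real.sqrt y)) ^ 2 := pow_le_pow_left₀ h0 h1 2
      _ = 16 * Real.sqrt (Real.sqrt y) ^ 2 := by ring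
      _ = _ := by rw [Real.sq_sqrt (Real.sqrt_nonneg y)]
  have h3 := sqrt_le_div_of_rateConst_le hyC'
  have h4 : ℓ ^ 2 ≤ y / 62500000000 := by
    rw [le_div_iff₀ (by norm_num)]
    have : rateConst = 62500000000 := by norm_num [rateConst]
    rw [this] at hyC
    linarith
  -- Here `(ℓ + log y)² ≤ 2ℓ² + 2 log² y`, and the main part is `32√y ≤ 32y/250000`. This comparison
  -- accounts for the size of `rateConst`.
  have h5 : (ℓ + Real.log y) ^ 2 ≤ y / 6412 := by
    nlinarith [sq_nonneg (ℓ - Real.log y)]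
  rw [e, hyn]
  calc _ ≤ y / 6412 * X := by gcongr
    _ = _ := by ring

/-- With `n = N ω_k` and `m = Dn/d`, it suffices that `7 log(Ψn) ≤ m`. Since `Ψn ≤ dΨm`, the
logarithm is at most `ℓ₀ + log m`, and both parts are small against `m`. The assumption is free of
`ω`, so it serves all iterations at once. -/
theorem lamCoef_le_one (hd : 1 ≤ d) (hD : 1 ≤ D) (hB : 0 ≤ B) (hζ : 0 ≤ ζ) (hN : 1 ≤ N)
    (hω : 1 ≤ ω) (hk : 1 ≤ k)
    (hNd : rateConst * logFactor d D B ζ * (d / D) ≤ N) : lamCoef d D B ζ N ω k ≤ 1 := by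
  have hn := one_le_mul_win hN hω hk
  have hΨ := six_le_logBase (d := d) (D := D) hB hζ
  have hd' : (1 : ℝ) ≤ d := by exact_mod_cast hd
  have hW : (1 : ℝ) ≤ win ω k := by exact_mod_cast one_le_win hω hk
  have h1 := mul_lamCoef_sq_le hd hD hB hζ hN hω hk
  have hNn : (N : ℝ) ≤ (N : ℝ) * win ω k := le_mul_of_one_le_right (Nat.cast_nonneg _) hW
  set n := (N : ℝ) * win ω k
  have hℓ0 : 1 ≤ logFactor d D B ζ := by
    rw [logFactor]
    refine one_le_log_six.trans (Real.log_le_log (by norm_num) ?_)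
    change 6 ≤ d * logBase d D B ζ
    nlinarith
  have hC0 : (1 : ℝ) ≤ rateConst := by norm_num [rateConst]
  set m := D * n / d with hm
  have hmC : rateConst * logFactor d D B ζ ≤ m := by
    rw [hm, le_div_iff₀ (by linarith)]
    have h2 := mul_le_mul_of_nonneg_left (hNd.trans hNn) (by linarith : 0 ≤ D)
    have e : D * (rateConst * logFactor d D B ζ * (d / D)) = rateConst * logFactor d D B ζ * d := by
      field_simp
    linarith
  have hmC' : rateConst ≤ m := by nlinarith
  have hm0 : 0 < m := by linarith
  have hlog : Real.log (logBase d D B ζ * n) ≤ logFactor d D B ζ + Real.log m := by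
    have e : logFactor d D B ζ = Real.log (d * logBase d D B ζ) := rfl
    rw [e, ← Real.log_mul (by positivity) hm0.ne']
    refine Real.log_le_log (by positivity) ?_
    have e2 : d * logBase d D B ζ * m = logBase d D B ζ * n * D := by rw [hm]; field_simp
    rw [e2]
    exact le_mul_of_one_le_right (by positivity) hD
  have hlm : Real.log m ≤ 2 * Real.sqrt m := by
    have h := Real.log_le_self (Real.sqrt_nonneg m)
    rw [Real.log_sqrt hm0.le] at h
    linarith
  have h3 := sqrt_le_div_of_rateConst_le hmC'
  have h4 : logFactor d D B ζ ≤ m / 62500000000 := by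
    rw [le_div_iff₀ (by norm_num)]
    have : rateConst = 62500000000 := by norm_num [rateConst]
    rw [this] at hmC
    linarith
  have h5 : 7 * Real.log (logBase d D B ζ * n) ≤ m := by linarith
  have h6 : D * n * lamCoef d D B ζ N ω k ^ 2 ≤ D * n * 1 := by
    have e : D * n * 1 = d * m := by rw [hm]; field_simp
    rw [e]
    refine h1.trans ?_
    rw [mul_comm 7 (d : ℝ), mul_assoc]
    gcongr
  have h7 : lamCoef d D B ζ N ω k ^ 2 ≤ 1 := le_of_mul_le_mul_left h6 (by positivity)
  exact (sq_le_one_iff₀ lamCoef_nonneg).1 h7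

/-- The mean of the estimation errors over the iterations. -/
theorem mean_error_le (hd : 1 ≤ d) (hD : 1 ≤ D) (hB : 0 ≤ B) (hζ : 0 ≤ ζ) (hG : 0 < G)
    (hε : 0 < ε) (hεG : ε ≤ G ^ 2) (hN : 1 ≤ N) (hω : 1 ≤ ω) (hK : 1 ≤ K)
    (hn : rateConst * logFactorEps d G D B ζ ε ^ 2 * (G ^ 2 * D * d / ε) ≤ (N : ℝ) * win ω K) :
    (K : ℝ)⁻¹ * ∑ k ∈ Finset.Icc 1 K, 229 * (G * D * lamCoef d D B ζ N ω k) ^ 2 ≤ ε / 2 := by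
  have hΨ := six_le_logBase (d := d) (D := D) hB hζ
  have hlΨ := one_le_log_logBase (d := d) (D := D) hB hζ
  have hd' : (1 : ℝ) ≤ d := by exact_mod_cast hd
  have hN' : (1 : ℝ) ≤ N := by exact_mod_cast hN
  have hK' : (1 : ℝ) ≤ K := by exact_mod_cast hK
  have hn1 := one_le_mul_win hN hω hK
  have hW : (1 : ℝ) ≤ win ω K := by exact_mod_cast one_le_win hω hK
  have hX1 : 1 ≤ G ^ 2 * D * d / ε := by
    rw [le_div_iff₀ hε, one_mul]
    calc ε ≤ G ^ 2 * 1 * 1 := by linarith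
      _ ≤ G ^ 2 * D * d := by gcongr
  have hℓ : 1 ≤ logFactorEps d G D B ζ ε := by
    refine one_le_log_six.trans (Real.log_le_log (by norm_num) ?_)
    change 6 ≤ G ^ 2 * D * d / ε * logBase d D B ζ
    nlinarith
  have hsq := sq_log_le (Ψ := logBase d D B ζ) (by linarith) (by linarith) rfl hℓ hn
  have hsumW := sum_inv_win_le hω hK
  set n := (N : ℝ) * win ω K with hndef
  set lg := Real.log (logBase d D B ζ * n) with hlg
  have hlge : lg = Real.log (logBase d D B ζ) + Real.log n :=
    Real.log_mul (by linarith) (by linarith)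
  have hlogn := Real.log_nonneg hn1
  have hlogW : Real.log (win ω K) ≤ Real.log n :=
    Real.log_le_log (by linarith) (le_mul_of_one_le_left (by linarith) hN')
  have hlg0 : 0 ≤ lg := by linarith
  have hterm : ∀ k ∈ Finset.Icc 1 K, 229 * (G * D * lamCoef d D B ζ N ω k) ^ 2 ≤
      1603 * (G ^ 2 * D * d) * lg / N * ((win ω k : ℕ) : ℝ)⁻¹ := by
    intro k hk
    rw [Finset.mem_Icc] at hk
    have h1 := mul_lamCoef_sq_le hd hD hB hζ hN hω hk.1
    have hWk : (1 : ℝ) ≤ win ω k := by exact_mod_cast one_le_win hω hk.1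
    have hWle : (win ω k : ℝ) ≤ win ω K := by exact_mod_cast min_le_min le_rfl hk.2
    have h2 : Real.log (logBase d D B ζ * ((N : ℝ) * win ω k)) ≤ lg :=
      Real.log_le_log (by positivity) (by rw [hndef]; gcongr)
    have h3 : D * ((N : ℝ) * win ω k) * lamCoef d D B ζ N ω k ^ 2 ≤ 7 * d * lg :=
      h1.trans (by gcongr)
    have e1 : 229 * (G * D * lamCoef d D B ζ N ω k) ^ 2 =
        229 * G ^ 2 * D * (D * ((N : ℝ) * win ω k) * lamCoef d D B ζ N ω k ^ 2) /
          ((N : ℝ) * win ω k) := by field_simp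
    rw [e1]
    calc _ ≤ 229 * G ^ 2 * D * (7 * d * lg) / ((N : ℝ) * win ω k) := by gcongr
      _ = _ := by field_simp; ring
  have hsum : ∑ k ∈ Finset.Icc 1 K, 229 * (G * D * lamCoef d D B ζ N ω k) ^ 2 ≤
      1603 * (G ^ 2 * D * d) * lg / N * (K / (win ω K : ℝ) * (2 * lg)) := by
    refine (Finset.sum_le_sum hterm).trans ?_
    rw [← Finset.mul_sum]
    gcongr
    refine hsumW.trans ?_
    gcongr
    linarith
  -- The constants are `1603 = 229 · 7` and `3206 = 2 · 1603`; the divisor `6412` in `sq_log_le` is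
  -- twice the latter, which leaves `ε/2`.
  calc _ ≤ (K : ℝ)⁻¹ * (1603 * (G ^ 2 * D * d) * lg / N * (K / (win ω K : ℝ) * (2 * lg))) := by
        gcongr
    _ = 3206 * ε * (lg ^ 2 * (G ^ 2 * D * d / ε)) / n := by
        rw [hndef]; field_simp; ring
    _ ≤ 3206 * ε * (n / 6412) / n := by gcongr
    _ = ε / 2 := by field_simp; norm_num

end Rates

/-! ### A common sufficient condition for both reuse regimes -/

section Achieves

variable {S : Type u} {A : Type v} [MeasurableSpace S] [MeasurableSpace A] {M : MDP S A} {d : ℕ}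
  {Θ : Set (Param d)} {π : Param d → S → A → ℝ} {est : GradEstimator}
  {L₁ L₂ L D B G G₂ ζ ε : ℝ} {θ₁ : Param d} {N K ω : ℕ}

theorem four_le_rateConst : 4 ≤ rateConst := by norm_num [rateConst]

/-- Partial and full reuse differ only in the value of the final window `win ω K`, so one criterion
in terms of `N * win ω K` covers both. The telescoped gain and the estimation error receive `ε/2`
each. -/
theorem rpgAchieves_of_le (hθ₁ : θ₁ ∈ Θ) (hΘ : IsOpen Θ) (hc : Convex ℝ Θ)
    (hπ : IsPolicyClass M Θ π) (hreg : RegularPolicy Θ π L₁ L₂) (hG0 : 0 < G)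
    (hG : EstimatorBounds M Θ π est G G₂) (hd : 1 ≤ d) (hD : 1 ≤ D) (hchi : BoundedChiSq M Θ π D)
    (hBdef : B = G * M.T * L₁ + G₂) (hB : 0 < B) (hζ : 0 < ζ)
    (hJ : LipschitzSmoothOn (M.J π) L Θ) (hL : 0 < L) (hζL : ζ ≤ 1 / L)
    (hε : 0 < ε) (hεG : ε ≤ G ^ 2) (hN : 1 ≤ N) (hω : 1 ≤ ω) (hK : 1 ≤ K)
    (hl1 : ∀ i ∈ Finset.Icc 1 K, lamCoef d D B ζ N ω i ≤ 1)
    (hKΔ : rateConst * ((M.Jstar π Θ - M.J π θ₁) / (ζ * ε)) ≤ K)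
    (hn : rateConst * logFactorEps d G D B ζ ε ^ 2 * (G ^ 2 * D * d / ε) ≤ (N : ℝ) * win ω K) :
    RPGAchieves.{u, v, w} M Θ π est D B ζ θ₁ N K ω ε := by
  intro Ω _ P _ θ τ I hrun
  obtain ⟨h1, h2⟩ := hrun.output_bound hθ₁ hΘ hc hπ hreg hG0 hG hd hD hchi hBdef hB hζ hJ hL hζL
    hN hω hK hl1
  refine ⟨h1, h2.trans ?_⟩
  have hm := mean_error_le hd hD hB.le hζ.le hG0 hε hεG hN hω hK hn
  have hK' : (0 : ℝ) < K := by exact_mod_cast hK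
  have hΔ : 0 ≤ (M.Jstar π Θ - M.J π θ₁) / (ζ * ε) :=
    div_nonneg (sub_nonneg.2 (J_le_Jstar hπ hθ₁)) (by positivity)
  have h4 : 4 * ((M.Jstar π Θ - M.J π θ₁) / (ζ * ε)) ≤ K :=
    (mul_le_mul_of_nonneg_right four_le_rateConst hΔ).trans hKΔ
  have h5 : (K : ℝ)⁻¹ * (2 / ζ * (M.Jstar π Θ - M.J π θ₁)) ≤ ε / 2 := by
    have e : (K : ℝ)⁻¹ * (2 / ζ * (M.Jstar π Θ - M.J π θ₁)) =
        ε / 2 * (K : ℝ)⁻¹ * (4 * ((M.Jstar π Θ - M.J π θ₁) / (ζ * ε))) := by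
      field_simp; ring
    rw [e]
    calc _ ≤ ε / 2 * (K : ℝ)⁻¹ * K := by gcongr
      _ = ε / 2 := by field_simp
  rw [mul_add]
  linarith

end Achieves

/-! ### Integer batch sizes and iteration numbers -/

section Choice

variable {d ω : ℕ} {c D B ζ G ε Δ ℓ ℓ₀ : ℝ}

theorem one_le_logFactor (hd : 1 ≤ d) (hB : 0 ≤ B) (hζ : 0 ≤ ζ) : 1 ≤ logFactor d D B ζ := by
  have hΨ := six_le_logBase (d := d) (D := D) hB hζ
  have hd' : (1 : ℝ) ≤ d := by exact_mod_cast hd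
  refine one_le_log_six.trans (Real.log_le_log (by norm_num) ?_)
  change 6 ≤ d * logBase d D B ζ
  nlinarith

theorem logFactor_le_logFactorEps (hd : 1 ≤ d) (hD : 1 ≤ D) (hB : 0 ≤ B) (hζ : 0 ≤ ζ)
    (hε : 0 < ε) (hεG : ε ≤ G ^ 2) : logFactor d D B ζ ≤ logFactorEps d G D B ζ ε := by
  have hΨ := six_le_logBase (d := d) (D := D) hB hζ
  have hd' : (1 : ℝ) ≤ d := by exact_mod_cast hd
  have h0 : 0 < d * logBase d D B ζ := by nlinarith
  refine Real.log_le_log h0 (mul_le_mul_of_nonneg_right ?_ (by linarith : 0 ≤ logBase d D B ζ))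
  rw [le_div_iff₀ hε]
  calc (d : ℝ) * ε ≤ G ^ 2 * 1 * d := by nlinarith
    _ ≤ G ^ 2 * D * d := by gcongr

/-- Batch size and number of iterations for partial reuse. -/
theorem exists_partial_reuse_sizes (hc : 1 ≤ c) (hd : 1 ≤ d) (hD : 1 ≤ D) (hζ : 0 < ζ)
    (hG : 0 < G) (hε : 0 < ε) (hΔ : 0 ≤ Δ) (hℓ₀ : 1 ≤ ℓ₀) (hℓ : ℓ₀ ≤ ℓ) (hω : 1 ≤ ω) :
    ∃ N K : ℕ, 1 ≤ N ∧ ω < K ∧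
      (N : ℝ) ≤ 2 * c * (4 + c) * ℓ ^ 2 *
        (G ^ 2 * D * d / (ε * ω) * max 1 (ε * ω / (G ^ 2 * D * min D d))) ∧
      (N : ℝ) * K ≤ 2 * c * (4 + c) * ℓ ^ 2 * (G ^ 2 * D * d / ε * max 1 (Δ / (ζ * ω * ε)) *
        max 1 (ε * ω / (G ^ 2 * D * min D d))) ∧
      c * (Δ / (ζ * ε)) ≤ K ∧ c * ℓ₀ * (d / D) ≤ N ∧
      c * ℓ ^ 2 * (G ^ 2 * D * d / ε) ≤ (N : ℝ) * ω := by
  have hd' : (1 : ℝ) ≤ d := by exact_mod_cast hd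
  have hω' : (1 : ℝ) ≤ ω := by exact_mod_cast hω
  have hmin : 1 ≤ min D (d : ℝ) := le_min hD hd'
  set m := min D (d : ℝ) with hm
  have hmD : m ≤ D := min_le_left _ _
  have hmd : m ≤ d := min_le_right _ _
  set κ := max 1 (ε * ω / (G ^ 2 * D * m)) with hκ
  have hκ1 : 1 ≤ κ := le_max_left _ _
  set Y := G ^ 2 * D * d / (ε * ω) with hY
  have hY0 : 0 < Y := by positivity
  have hX : G ^ 2 * D * d / ε = Y * ω := by rw [hY]; field_simp
  -- This is the purpose of `κ`: the batch stays of order at least `d/D`, hence admissible, even for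
  -- windows so long that accuracy alone would allow a smaller one.
  have hYκ : d / m ≤ Y * κ := by
    calc d / m = Y * (ε * ω / (G ^ 2 * D * m)) := by rw [hY]; field_simp
      _ ≤ Y * κ := by gcongr; exact le_max_right _ _
  have hdm : 1 ≤ (d : ℝ) / m := by rw [one_le_div (by linarith)]; exact hmd
  have hdD : (d : ℝ) / D ≤ d / m := by gcongr
  have hℓ1 : 1 ≤ ℓ := hℓ₀.trans hℓ
  have hℓ2 : ℓ₀ ≤ ℓ ^ 2 := by nlinarith
  set E := c * ℓ ^ 2 * (Y * κ) with hE
  have hE1 : 1 ≤ E := one_le_mul_of_one_le_of_one_le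
    (one_le_mul_of_one_le_of_one_le hc (one_le_pow₀ hℓ1)) (hdm.trans hYκ)
  have hNle : E ≤ (⌈E⌉₊ : ℝ) := Nat.le_ceil _
  have hNub : (⌈E⌉₊ : ℝ) ≤ 2 * E := by
    have := Nat.ceil_lt_add_one (by linarith : 0 ≤ E); linarith
  set R := max 1 (Δ / (ζ * ω * ε)) with hR
  have hR1 : 1 ≤ R := le_max_left _ _
  have hRω : Δ / (ζ * ε) ≤ ω * R := by
    calc Δ / (ζ * ε) = ω * (Δ / (ζ * ω * ε)) := by field_simp
      _ ≤ ω * R := by gcongr; exact le_max_right _ _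
  -- The entry `ω + 1` enforces partial reuse, and the other is what the telescoped gain demands.
  have hKub : ((max (ω + 1) ⌈c * (Δ / (ζ * ε))⌉₊ : ℕ) : ℝ) ≤ (4 + c) * (ω * R) := by
    have h0 : 0 ≤ Δ / (ζ * ε) := by positivity
    have h1 := Nat.ceil_lt_add_one (by positivity : 0 ≤ c * (Δ / (ζ * ε)))
    have h2 : 1 ≤ ω * R := one_le_mul_of_one_le_of_one_le hω' hR1
    have h3 : (ω : ℝ) ≤ ω * R := le_mul_of_one_le_right (by linarith) hR1
    have h4 : c * (Δ / (ζ * ε)) ≤ c * (ω * R) := by gcongr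
    have h5 : 0 ≤ c * (ω * R) := by positivity
    push_cast
    refine max_le ?_ ?_ <;> nlinarith
  have hE4 : 2 * E ≤ 2 * c * (4 + c) * ℓ ^ 2 * (Y * κ) := by
    calc 2 * E = 2 * c * 1 * ℓ ^ 2 * (Y * κ) := by rw [hE]; ring
      _ ≤ _ := by gcongr; linarith
  refine ⟨⌈E⌉₊, max (ω + 1) ⌈c * (Δ / (ζ * ε))⌉₊, Nat.one_le_ceil_iff.2 (by linarith),
    lt_of_lt_of_le (Nat.lt_succ_self _) (le_max_left _ _), hNub.trans hE4, ?_, ?_, ?_, ?_⟩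
  · rw [hX]
    calc _ ≤ 2 * E * ((4 + c) * (ω * R)) := by gcongr
      _ = _ := by rw [hE]; ring
  · push_cast
    exact (Nat.le_ceil _).trans (le_max_right _ _)
  · refine le_trans ?_ hNle
    rw [hE]
    gcongr
    exact hdD.trans hYκ
  · rw [hX]
    calc c * ℓ ^ 2 * (Y * ω) ≤ c * ℓ ^ 2 * (Y * ω) * κ := le_mul_of_one_le_right (by positivity) hκ1
      _ = E * ω := by rw [hE]; ring
      _ ≤ _ := by gcongr

/-- Batch size and number of iterations for full reuse. -/
theorem exists_full_reuse_sizes (hc : 1 ≤ c) (hd : 1 ≤ d) (hD : 1 ≤ D) (hζ : 0 < ζ)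
    (hε : 0 < ε) (hεG : ε ≤ G ^ 2) (hΔ : 0 ≤ Δ) (hℓ₀ : 1 ≤ ℓ₀) (hℓ : ℓ₀ ≤ ℓ) :
    ∃ N K : ℕ, 1 ≤ N ∧ 1 ≤ K ∧
      (N : ℝ) ≤ 2 * c * (4 + c) * ℓ₀ * (d / min D d) ∧
      (N : ℝ) * K ≤ 2 * c * (4 + c) * ℓ ^ 2 *
        (d / ε * max (G ^ 2 * D) (Δ / (min D d * ζ))) ∧
      c * (Δ / (ζ * ε)) ≤ K ∧ c * ℓ₀ * (d / D) ≤ N ∧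
      c * ℓ ^ 2 * (G ^ 2 * D * d / ε) ≤ (N : ℝ) * K := by
  have hd' : (1 : ℝ) ≤ d := by exact_mod_cast hd
  have hmin : 1 ≤ min D (d : ℝ) := le_min hD hd'
  set m := min D (d : ℝ) with hm
  have hmD : m ≤ D := min_le_left _ _
  have hmd : m ≤ d := min_le_right _ _
  have hdm : 1 ≤ (d : ℝ) / m := by rw [one_le_div (by linarith)]; exact hmd
  have hdD : (d : ℝ) / D ≤ d / m := by gcongr
  have hdm' : (d : ℝ) / m ≤ d := div_le_self (by linarith) hmin
  have hℓ1 : 1 ≤ ℓ := hℓ₀.trans hℓ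
  have hℓ2 : ℓ₀ ≤ ℓ ^ 2 := by nlinarith
  -- The batch is taken only as large as admissibility requires, and all remaining accuracy is
  -- bought with iterations. Using `m` instead of `D` keeps `E ≥ 1`, so rounding up at most doubles
  -- it.
  set E := c * ℓ₀ * (d / m) with hE
  have hE1 : 1 ≤ E := one_le_mul_of_one_le_of_one_le
    (one_le_mul_of_one_le_of_one_le hc hℓ₀) hdm
  set N := ⌈E⌉₊ with hN
  have hN1 : 1 ≤ N := Nat.one_le_ceil_iff.2 (by linarith)
  have hNle : E ≤ (N : ℝ) := Nat.le_ceil _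
  have hNub : (N : ℝ) ≤ 2 * E := by
    have := Nat.ceil_lt_add_one (by linarith : 0 ≤ E); linarith
  have hN0 : (0 : ℝ) < N := by exact_mod_cast hN1
  set Q := max (G ^ 2 * D) (Δ / (m * ζ)) with hQ
  have hQG : G ^ 2 * D ≤ Q := le_max_left _ _
  have hQΔ : Δ / (m * ζ) ≤ Q := le_max_right _ _
  have hεQ : ε ≤ Q := hεG.trans ((le_mul_of_one_le_right (sq_nonneg _) hD).trans hQG)
  have hQ0 : 0 < Q := by linarith
  set Z := c * ℓ ^ 2 * (G ^ 2 * D * d / ε) with hZ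
  have hZ0 : 0 ≤ Z := by positivity
  have hΔ0 : 0 ≤ Δ / (ζ * ε) := by positivity
  set K := max 1 (max ⌈c * (Δ / (ζ * ε))⌉₊ ⌈Z / N⌉₊) with hK
  have hK1 : c * (Δ / (ζ * ε)) ≤ K :=
    (Nat.le_ceil _).trans (by exact_mod_cast (le_max_left _ _).trans (le_max_right 1 _))
  have hK2 : Z / N ≤ K :=
    (Nat.le_ceil _).trans (by exact_mod_cast (le_max_right _ _).trans (le_max_right 1 _))
  have hKub : (K : ℝ) ≤ 1 + c * (Δ / (ζ * ε)) + Z / N := by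
    have h1 := Nat.ceil_lt_add_one (by positivity : 0 ≤ c * (Δ / (ζ * ε)))
    have h2 := Nat.ceil_lt_add_one (by positivity : 0 ≤ Z / N)
    have h3 : 0 ≤ c * (Δ / (ζ * ε)) := by positivity
    have h4 : 0 ≤ Z / N := by positivity
    rw [hK]
    push_cast
    refine max_le (by linarith) (max_le (by linarith) (by linarith))
  refine ⟨N, K, hN1, le_max_left _ _, hNub.trans ?_, ?_, hK1, ?_, ?_⟩
  · calc 2 * E = 2 * c * 1 * ℓ₀ * (d / m) := by rw [hE]; ring
      _ ≤ _ := by gcongr; linarith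
  · have hU : 0 ≤ ℓ ^ 2 * (d / ε * Q) := by positivity
    have h1 : E ≤ c * (ℓ ^ 2 * (d / ε * Q)) := by
      calc E ≤ c * ℓ ^ 2 * d := by rw [hE]; gcongr
        _ ≤ c * ℓ ^ 2 * d * (Q / ε) :=
          le_mul_of_one_le_right (by positivity) ((one_le_div hε).2 hεQ)
        _ = _ := by ring
    have h2 : E * (c * (Δ / (ζ * ε))) ≤ c ^ 2 * (ℓ ^ 2 * (d / ε * Q)) := by
      calc E * (c * (Δ / (ζ * ε))) = c ^ 2 * (ℓ₀ * (d / ε * (Δ / (m * ζ)))) := by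
            rw [hE]; field_simp
        _ ≤ _ := by gcongr
    have h3 : Z ≤ c * (ℓ ^ 2 * (d / ε * Q)) := by
      calc Z = c * (ℓ ^ 2 * (d / ε * (G ^ 2 * D))) := by rw [hZ]; ring
        _ ≤ _ := by gcongr
    have hcU : 0 ≤ c * (ℓ ^ 2 * (d / ε * Q)) := by positivity
    calc (N : ℝ) * K ≤ N * (1 + c * (Δ / (ζ * ε)) + Z / N) := by gcongr
      _ = N + N * (c * (Δ / (ζ * ε))) + Z := by field_simp
      _ ≤ 2 * E + 2 * E * (c * (Δ / (ζ * ε))) + Z := by gcongr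
      _ ≤ 8 * (c * (ℓ ^ 2 * (d / ε * Q))) + 2 * (c ^ 2 * (ℓ ^ 2 * (d / ε * Q))) := by linarith
      _ = _ := by ring
  · refine le_trans ?_ hNle
    rw [hE]
    gcongr
  · rw [div_le_iff₀ hN0] at hK2
    linarith

end Choice

end

theorem theorem6p1 :
    -- one absolute constant serves all bounds
    ∃ C : ℝ, 0 < C ∧
      ∀ (S : Type u) (A : Type v) [MeasurableSpace S] [MeasurableSpace A] (M : MDP S A)
        (d : ℕ) (Θ : Set (Param d)) (π : Param d → S → A → ℝ) (est : GradEstimator)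
        (L₁ L₂ D : ℝ),
      1 ≤ d → IsOpen Θ → Convex ℝ Θ → IsPolicyClass M Θ π →
      0 < L₁ → 0 < L₂ → RegularPolicy Θ π L₁ L₂ →
      1 ≤ D → BoundedChiSq M Θ π D →
      -- bounds `G`, `G₂` of the single-trajectory estimator exist
      (∃ G G₂ : ℝ, 0 < G ∧ 0 < G₂ ∧ EstimatorBounds M Θ π est G G₂) ∧
      ∀ G G₂ : ℝ, 0 < G → 0 < G₂ → EstimatorBounds M Θ π est G G₂ →
        -- a smoothness constant of `J` exists
        LipschitzSmoothOn (M.J π) (G * M.T * L₁ + G₂) Θ ∧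
        ∀ (L ζ ε : ℝ) (θ₁ : Param d), 0 < L → LipschitzSmoothOn (M.J π) L Θ →
          0 < ζ → ζ ≤ 1 / L → 0 < ε → ε ≤ G ^ 2 → θ₁ ∈ Θ →
          -- partial reuse: sufficient iteration number and batch size
          (∀ N K ω : ℕ, 1 ≤ ω → ω < K →
            (∀ k ∈ Finset.Icc 1 K, lamCoef d D (G * M.T * L₁ + G₂) ζ N ω k ≤ 1) →
            C * ((M.Jstar π Θ - M.J π θ₁) / (ζ * ε)) ≤ K →
            C * logFactorEps d G D (G * M.T * L₁ + G₂) ζ ε ^ 2 * (G ^ 2 * D * d / (ε * ω)) ≤ N →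
            RPGAchieves.{u, v, w} M Θ π est D (G * M.T * L₁ + G₂) ζ θ₁ N K ω ε) ∧
          -- full reuse: sufficient iteration number, batch size and number of trajectories
          (∀ N K ω : ℕ, 1 ≤ N → 1 ≤ K → K ≤ ω →
            C * ((M.Jstar π Θ - M.J π θ₁) / (ζ * ε)) ≤ K →
            C * logFactor d D (G * M.T * L₁ + G₂) ζ * (d / D) ≤ N →
            C * logFactorEps d G D (G * M.T * L₁ + G₂) ζ ε ^ 2 * (G ^ 2 * D * d / ε) ≤ N * K →
            RPGAchieves.{u, v, w} M Θ π est D (G * M.T * L₁ + G₂) ζ θ₁ N K ω ε) ∧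
          -- partial reuse: sample complexity
          (∀ ω : ℕ, 1 ≤ ω → ∃ N K : ℕ, 1 ≤ N ∧ ω < K ∧
            (N : ℝ) ≤ C * logFactorEps d G D (G * M.T * L₁ + G₂) ζ ε ^ 2 *
              (G ^ 2 * D * d / (ε * ω) * max 1 (ε * ω / (G ^ 2 * D * min D d))) ∧
            (N : ℝ) * K ≤ C * logFactorEps d G D (G * M.T * L₁ + G₂) ζ ε ^ 2 *
              (G ^ 2 * D * d / ε * max 1 ((M.Jstar π Θ - M.J π θ₁) / (ζ * ω * ε)) *
                max 1 (ε * ω / (G ^ 2 * D * min D d))) ∧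
            RPGAchieves.{u, v, w} M Θ π est D (G * M.T * L₁ + G₂) ζ θ₁ N K ω ε) ∧
          -- full reuse: sample complexity
          (∃ N K : ℕ, 1 ≤ N ∧ 1 ≤ K ∧
            (N : ℝ) ≤ C * logFactor d D (G * M.T * L₁ + G₂) ζ * (d / min D d) ∧
            (N : ℝ) * K ≤ C * logFactorEps d G D (G * M.T * L₁ + G₂) ζ ε ^ 2 *
              (d / ε * max (G ^ 2 * D)
                ((M.Jstar π Θ - M.J π θ₁) / (min D d * ζ))) ∧
            ∀ ω : ℕ, K ≤ ω →
              RPGAchieves.{u, v, w} M Θ π est D (G * M.T * L₁ + G₂) ζ θ₁ N K ω ε) := by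
  have hC0 := four_le_rateConst
  set c := rateConst with hc
  have hcC : c ≤ 2 * c * (4 + c) := by nlinarith
  -- The upper bounds on the sizes dictate this constant. It also serves as the lower-bound constant
  -- in the sufficient conditions, because it is at least `c`.
  refine ⟨2 * c * (4 + c), by nlinarith, ?_⟩
  intro S A _ _ M d Θ π est L₁ L₂ D hd hΘ hcv hπ hL₁ hL₂ hreg hD hchi
  refine ⟨exists_estimatorBounds hL₁ hL₂ hreg, fun G G₂ hG hG₂ hest =>
    ⟨lipschitzSmoothOn_J hΘ hcv hπ hreg hest, ?_⟩⟩
  intro L ζ ε θ₁ hL hJ hζ hζL hε hεG hθ₁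
  have hT := M.T_pos
  have hB : 0 < G * M.T * L₁ + G₂ := by positivity
  generalize hBdef : G * M.T * L₁ + G₂ = B at hB ⊢
  have hd' : (1 : ℝ) ≤ d := by exact_mod_cast hd
  have hℓ₀ := one_le_logFactor (d := d) (D := D) hd hB.le hζ.le
  have hℓ := logFactor_le_logFactorEps hd hD hB.le hζ.le hε hεG
  have hℓ1 := hℓ₀.trans hℓ
  have hΔ : 0 ≤ M.Jstar π Θ - M.J π θ₁ := sub_nonneg.2 (J_le_Jstar hπ hθ₁)
  have hΔ' : 0 ≤ (M.Jstar π Θ - M.J π θ₁) / (ζ * ε) := by positivity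
  have key {N K ω : ℕ} := rpgAchieves_of_le.{u, v, w} (N := N) (K := K) (ω := ω) hθ₁ hΘ hcv hπ hreg
    hG hest hd hD hchi hBdef.symm hB hζ hJ hL hζL hε hεG
  refine ⟨?_, ?_, ?_, ?_⟩
  · intro N K ω hω hωK hl1 hK hN
    have hω' : (1 : ℝ) ≤ ω := by exact_mod_cast hω
    -- A nonempty batch is forced by the lower bound, since `logFactorEps` is at least one.
    have hN0 : (0 : ℝ) < N := lt_of_lt_of_le (by positivity) hN
    refine key (by exact_mod_cast hN0) hω (by omega) hl1
      ((mul_le_mul_of_nonneg_right hcC hΔ').trans hK) ?_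
    rw [show win ω K = ω from min_eq_left hωK.le]
    calc c * logFactorEps d G D B ζ ε ^ 2 * (G ^ 2 * D * d / ε)
        ≤ 2 * c * (4 + c) * logFactorEps d G D B ζ ε ^ 2 * (G ^ 2 * D * d / ε) := by gcongr
      _ = 2 * c * (4 + c) * logFactorEps d G D B ζ ε ^ 2 * (G ^ 2 * D * d / (ε * ω)) * ω := by
        field_simp
      _ ≤ N * ω := by gcongr
  · intro N K ω hN hK hKω hKΔ hNd hNK
    have hω : 1 ≤ ω := hK.trans hKω
    refine key hN hω hK (fun k hk => lamCoef_le_one hd hD hB.le hζ.le hN hω (Finset.mem_Icc.1 hk).1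
      (le_trans ?_ hNd)) ((mul_le_mul_of_nonneg_right hcC hΔ').trans hKΔ) ?_
    · gcongr
    · rw [show win ω K = K from min_eq_right hKω]
      exact le_trans (by gcongr) hNK
  · intro ω hω
    obtain ⟨N, K, hN, hK, h1, h2, h3, h4, h5⟩ := exists_partial_reuse_sizes (c := c) (by linarith)
      hd hD hζ hG hε hΔ hℓ₀ hℓ hω
    refine ⟨N, K, hN, hK, h1, h2, key hN hω (by omega) (fun k hk =>
      lamCoef_le_one hd hD hB.le hζ.le hN hω (Finset.mem_Icc.1 hk).1 h4) h3 ?_⟩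
    rwa [show win ω K = ω from min_eq_left hK.le]
  · obtain ⟨N, K, hN, hK, h1, h2, h3, h4, h5⟩ := exists_full_reuse_sizes (c := c) (by linarith)
      hd hD hζ hε hεG hΔ hℓ₀ hℓ
    refine ⟨N, K, hN, hK, h1, h2, fun ω hKω => ?_⟩
    have hω : 1 ≤ ω := hK.trans hKω
    refine key hN hω hK (fun k hk =>
      lamCoef_le_one hd hD hB.le hζ.le hN hω (Finset.mem_Icc.1 hk).1 h4) h3 ?_
    rwa [show win ω K = K from min_eq_right hKω]
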